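/- Let $0<k<1$, $k'=\sqrt{1-k^2}$, let $K=K(k)=\int_0^{\pi/2}\frac{du}{\sqrt{1-k^2\sin^2u}}$ and $E=E(k)=\int_0^{\pi/2}\sqrt{1-k^2\sin^2u}\,du$ be the complete elliptic integrals, and put $\tau=iK(k')/K(k)$. Let $\mathcal C$ be the compact Riemann surface (elliptic curve) of $$0=\eta^2+\tfrac{K^2}{4}\bigl(\zeta^4+2(k^2-k'^2)\zeta^2+1\bigr),$$ let $\infty_1\in\mathcal C$ be the point over $\zeta=\infty$ at which $\eta/\zeta^2=-iK/2$, and let $P_0=(k'+ik,0)$, a branch point. Let $$\boldsymbol v=\frac{d\zeta}{4\eta},\qquad \gamma_\infty=\frac{K^2}{4\eta}\Bigl(\zeta^2-\frac{2E-K}{K}\Bigr)d\zeta$$ be the normalized holomorphic differential and the normalized differential of the second kind, whose poles are the two points over $\zeta=\infty$. Let $(x_1,x_2,x_3)\in\mathbb R^3$ and $x_-=x_1-ix_2$, with $K^2\neq4x_-^2$, and let $P_i=(\zeta_i,\eta_i)$, $i=1,\dots,4$, be the four points of $\mathcal C$ (counted with multiplicity) that satisfy the Atiyah–Ward (mini-twistor)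 relation $$\eta=(x_2-ix_1)-2x_3\zeta-(x_2+ix_1)\zeta^2;$$ that is, $\zeta_1,\dots,\zeta_4$ are the roots of the quartic obtained by substituting this relation into the equation of the curve. Then for any choice of contours from $\infty_1$ to the $P_i$ there are integers $N,M$ with $$\sum_{i=1}^4\int_{\infty_1}^{P_i}\boldsymbol v=N\tau+M.$$ Moreover, let contours from $P_0$ to the $P_i$, avoiding the points over $\zeta=\infty$, be correlated with these contours in the sense that, for each $i$, up to an integer, $$\int_{\infty_1}^{P_i}\boldsymbol v=\int_{P_0}^{P_i}\boldsymbol v-\frac{1+\tau}{4}.$$ Then, integrating $\gamma_\infty$ along these contours from $P_0$, $$\sum_{i=1}^4\int_{P_0}^{P_i}\gamma_\infty=\frac{4K^2x_3}{K^2-4x_-^2}-i\pi(N+1),$$ and the quantities $\mu_i=\beta_1(P_i)+i\pi N-i\bigl(x_-\zeta_i-ix_3\bigr)$, where $\beta_1(P_i)=\int_{P_0}^{P_i}\gamma_\infty+\frac{i\pi}{4}$, satisfy $$\sum_{i=1}^4\mu_i=3i\pi N.$$ -/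

import Mathlib

open Complex Polynomial

noncomputable section

namespace TwoMonopole

/-- The complete elliptic integral of the first kind, as a function of the modulus `k`. -/
def ellK (k : ℝ) : ℝ :=
  ∫ u in (0 : ℝ)..(Real.pi / 2), 1 / Real.sqrt (1 - k ^ 2 * Real.sin u ^ 2)

/-- The complete elliptic integral of the second kind, as a function of the modulus `k`. -/
def ellE (k : ℝ) : ℝ :=
  ∫ u in (0 : ℝ)..(Real.pi / 2), Real.sqrt (1 - k ^ 2 * Real.sin u ^ 2)

/-- The complementary modulus `k'`. -/
def compl (k : ℝ) : ℝ := Real.sqrt (1 - k ^ 2)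

/-- The period `τ = i K(k') / K(k)`. -/
def tau (k : ℝ) : ℂ := I * (ellK (compl k) : ℂ) / (ellK k : ℂ)

/-- The mini-twistor relation: `η` as a function of `ζ` for the point `(x₁, x₂, x₃)`. -/
def miniTwistor (x₁ x₂ x₃ : ℝ) (ζ : ℂ) : ℂ :=
  ((x₂ : ℂ) - I * x₁) - 2 * (x₃ : ℂ) * ζ - ((x₂ : ℂ) + I * x₁) * ζ ^ 2

/-- The Atiyah–Ward polynomial in `ζ`: the mini-twistor relation substituted into the equation
`η² + (K²/4) (ζ⁴ + 2 (k² - k'²) ζ² + 1) = 0` of the curve. -/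
def atiyahWard (k x₁ x₂ x₃ : ℝ) : ℂ[X] :=
  (C ((x₂ : ℂ) - I * x₁) - C (2 * (x₃ : ℂ)) * X - C ((x₂ : ℂ) + I * x₁) * X ^ 2) ^ 2
    + C ((ellK k : ℂ) ^ 2 / 4) *
      (X ^ 4 + C (2 * ((k : ℂ) ^ 2 - (compl k : ℂ) ^ 2)) * X ^ 2 + 1)

/-- A `C¹` path on the compact curve `𝒞`, the smooth compactification of
`η² + (K²/4) (ζ⁴ + 2 (k² - k'²) ζ² + 1) = 0`, given in the homogeneous coordinates
`[Z₀ : Z₁ : W]` of weights `1, 1, 2`, where `ζ = Z₁ / Z₀` and `η = W / Z₀²`. The two points at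
infinity are the points with `Z₀ = 0`. -/
structure CurvePath (k : ℝ) where
  Z₀ : ℝ → ℂ
  Z₁ : ℝ → ℂ
  W : ℝ → ℂ
  contDiffOn_Z₀ : ContDiffOn ℝ 1 Z₀ (Set.Icc 0 1)
  contDiffOn_Z₁ : ContDiffOn ℝ 1 Z₁ (Set.Icc 0 1)
  contDiffOn_W : ContDiffOn ℝ 1 W (Set.Icc 0 1)
  ne_zero : ∀ s ∈ Set.Icc (0 : ℝ) 1, Z₀ s ≠ 0 ∨ Z₁ s ≠ 0
  on_curve : ∀ s ∈ Set.Icc (0 : ℝ) 1,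
    W s ^ 2 + (ellK k : ℂ) ^ 2 / 4 *
      (Z₁ s ^ 4 + 2 * ((k : ℂ) ^ 2 - (compl k : ℂ) ^ 2) * Z₀ s ^ 2 * Z₁ s ^ 2 + Z₀ s ^ 4) = 0

namespace CurvePath

variable {k : ℝ}

/-- At time `s` the path is at the finite point `(ζ, η)`. -/
def IsAt (c : CurvePath k) (s : ℝ) (ζ η : ℂ) : Prop :=
  c.Z₀ s ≠ 0 ∧ c.Z₁ s = ζ * c.Z₀ s ∧ c.W s = η * c.Z₀ s ^ 2

/-- At time `s` the path is at `∞₁`, the point over `ζ = ∞` on sheet `1`, where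
`η / ζ² = -i K / 2`. -/
def IsAtInftyOne (c : CurvePath k) (s : ℝ) : Prop :=
  c.Z₀ s = 0 ∧ c.W s = -(I * (ellK k : ℂ) / 2) * c.Z₁ s ^ 2

/-- The path avoids both points at infinity. -/
def AvoidsInfty (c : CurvePath k) : Prop := ∀ s ∈ Set.Icc (0 : ℝ) 1, c.Z₀ s ≠ 0

/-- The pull-back of `dζ / η` to the parameter interval. In homogeneous coordinates
`dζ / η = (Z₀ dZ₁ - Z₁ dZ₀) / W`. For almost every `s` at which the path sits at a branch point
(`W s = 0`) the numerator vanishes as well and so does the pull-back of the form, in agreement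
with the value given by division by zero. -/
def dzetaOverEta (c : CurvePath k) (s : ℝ) : ℂ :=
  (c.Z₀ s * deriv c.Z₁ s - c.Z₁ s * deriv c.Z₀ s) / c.W s

/-- The integral along the path of the normalized holomorphic differential `v = dζ / (4 η)`. -/
def intV (c : CurvePath k) : ℂ :=
  ∫ s in (0 : ℝ)..1, c.dzetaOverEta s / 4

/-- The integral along the path of the normalized differential of the second kind
`γ_∞ = (K² / (4 η)) (ζ² - (2 E - K) / K) dζ`, whose poles are the two points at infinity. -/
def intGamma (c : CurvePath k) : ℂ :=
  ∫ s in (0 : ℝ)..1, (ellK k : ℂ) ^ 2 / 4 *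
    ((c.Z₁ s / c.Z₀ s) ^ 2 - (2 * (ellE k : ℂ) - ellK k) / ellK k) * c.dzetaOverEta s

/-- Correlated contours: `δ` runs from `∞₁` to `P` and `c` from the branch point `P₀` to `P`, and
they are related by `∫_{∞₁}^P v = ∫_{P₀}^P v - φ(∞₁)` with `φ(∞₁) = (1 + τ) / 4`, up to
`𝔞`-periods (on which `γ_∞` has integral zero). As homology classes are determined by their
`v`-periods, this says that `δ` is homologous, modulo `𝔞`, to a fixed contour from `∞₁` to `P₀`
followed by `c`. -/
def Correlated (δ c : CurvePath k) : Prop :=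
  ∃ m : ℤ, δ.intV = c.intV - (1 + tau k) / 4 + m

end CurvePath

/-- `β₁(P) = ∫_{P₀}^P γ_∞ + i π / 4`, for the contour `c` from `P₀` to `P`. -/
def betaOne {k : ℝ} (c : CurvePath k) : ℂ := c.intGamma + I * Real.pi / 4

/-- `μ = β₁(P) + i π N - i [(x₁ - i x₂) ζ - i x₃]`, for a point `P` with first coordinate `ζ` and
a contour `c` from `P₀` to `P`. -/
def mu {k : ℝ} (x₁ x₂ x₃ : ℝ) (N : ℤ) (ζ : ℂ) (c : CurvePath k) : ℂ :=
  betaOne c + I * Real.pi * N - I * (((x₁ : ℂ) - I * x₂) * ζ - I * x₃)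

end TwoMonopole

end

/-!
The curve is uniformised by three theta functions `A, B, C` of one complex variable `z`, with
`ζ = B / A` and `η = C / A²`: the quotient `B / A` is a Jacobi elliptic function, recognised by its
poles and by its values on the real axis. In this coordinate `v = dz`, and `γ_∞` is the exact form
`d(A' / (4 A))`, because both are quasi-periodic with the same poles and the same `𝔞`-period. Every
path on the curve lifts to the plane, so `∫ v` is a difference of endpoints `z` and `∫ γ_∞` is a
difference of values of `A' / (4 A)`.

Pulled back to the plane, the mini-twistor section `W - (a Z₀² - b Z₀ Z₁ - e Z₁²)` is a theta
function of order four, whose zeros are the lifts `z i` of the `P i`; by Liouville it equals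
`c e^(2πi n w) ∏ θ(w - z i)`. Comparing multipliers gives `∑ z i` modulo periods. Since `A` vanishes
exactly at the two points over `ζ = ∞`, comparing logarithmic derivatives at these two points gives
`∑ A'(z i) / A(z i)`, with the same integer `n`.
-/

noncomputable section

namespace TwoMonopole

open Filter Topology MeasureTheory

/-! ### A theta function given by an infinite product -/

/-- The infinite product `∏ (1 - qⁿ w)` over `n ≥ 0`, that is, the `q`-Pochhammer symbol
`(w; q)_∞`. -/
def qProd (q w : ℂ) : ℂ := ∏' n : ℕ, (1 + -(q ^ n * w))

lemma summable_norm_neg_pow_mul {q : ℂ} (hq : ‖q‖ < 1) (w : ℂ) :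
    Summable fun n : ℕ ↦ ‖-(q ^ n * w)‖ := by
  simpa only [norm_neg, norm_mul, norm_pow] using
    (summable_geometric_of_lt_one (norm_nonneg q) hq).mul_right ‖w‖

lemma differentiable_qProd {q : ℂ} (hq : ‖q‖ < 1) : Differentiable ℂ (qProd q) := by
  have h : HasProdLocallyUniformlyOn (fun (n : ℕ) (w : ℂ) ↦ 1 + -(q ^ n * w)) (qProd q)
      Set.univ := by
    refine hasProdLocallyUniformlyOn_of_forall_compact isOpen_univ fun K _ hK ↦ ?_
    obtain ⟨R, hR⟩ := hK.isBounded.exists_norm_le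
    refine ((summable_geometric_of_lt_one (norm_nonneg q) hq).mul_right
      R).hasProdUniformlyOn_nat_one_add hK (.of_forall fun n w hw ↦ ?_) (fun _ ↦ by fun_prop)
    rw [norm_neg, norm_mul, norm_pow]
    exact mul_le_mul_of_nonneg_left (hR w hw) (by positivity)
  rw [← differentiableOn_univ]
  exact h.differentiableOn (.of_forall fun _ ↦ by
    simpa [Finset.prod_fn] using DifferentiableOn.finsetProd (fun _ _ ↦ by fun_prop)) isOpen_univ

lemma qProd_eq_mul {q : ℂ} (hq : ‖q‖ < 1) (w : ℂ) : qProd q w = (1 - w) * qProd q (q * w) := by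
  have hshift : ∀ n : ℕ, 1 + -(q ^ n * (q * w)) = 1 + -(q ^ (n + 1) * w) := fun n ↦ by ring
  have h := tprod_eq_zero_mul' (f := fun n : ℕ ↦ (1 + -(q ^ n * w)))
    ((multipliable_one_add_of_summable (summable_norm_neg_pow_mul hq (q * w))).congr hshift)
  rwa [← tprod_congr hshift, pow_zero, one_mul, ← sub_eq_add_neg] at h

lemma qProd_ne_zero {q : ℂ} (hq : ‖q‖ < 1) {w : ℂ} (hw : ∀ n : ℕ, q ^ n * w ≠ 1) :
    qProd q w ≠ 0 :=
  tprod_one_add_ne_zero_of_summable (fun n h ↦ hw n (by linear_combination -h))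
    (summable_norm_neg_pow_mul hq w)

/-- The exponential `e^{2πiz}` of period `1`. -/
def expTwoPi (z : ℂ) : ℂ := exp (2 * Real.pi * I * z)

lemma expTwoPi_ne_zero (z : ℂ) : expTwoPi z ≠ 0 := exp_ne_zero _

lemma expTwoPi_add (z w : ℂ) : expTwoPi (z + w) = expTwoPi z * expTwoPi w := by
  rw [expTwoPi, mul_add, exp_add]; rfl

lemma expTwoPi_neg (z : ℂ) : expTwoPi (-z) = (expTwoPi z)⁻¹ := by
  rw [expTwoPi, mul_neg, exp_neg]; rfl

lemma expTwoPi_zero : expTwoPi 0 = 1 := by rw [expTwoPi, mul_zero, exp_zero]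

lemma expTwoPi_half : expTwoPi (1 / 2) = -1 := by
  rw [expTwoPi, show 2 * (Real.pi : ℂ) * I * (1 / 2) = Real.pi * I by ring, exp_pi_mul_I]

lemma expTwoPi_nat_mul (n : ℕ) (z : ℂ) : expTwoPi (n * z) = expTwoPi z ^ n := by
  rw [expTwoPi, expTwoPi, ← exp_nat_mul]; ring_nf

lemma expTwoPi_eq_one_iff {z : ℂ} : expTwoPi z = 1 ↔ ∃ n : ℤ, z = n := by
  rw [expTwoPi, exp_eq_one_iff]
  refine exists_congr fun n ↦ ?_
  rw [mul_comm]
  exact mul_left_inj' two_pi_I_ne_zero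

lemma expTwoPi_one : expTwoPi 1 = 1 := expTwoPi_eq_one_iff.2 ⟨1, Int.cast_one.symm⟩

lemma hasDerivAt_expTwoPi (z : ℂ) :
    HasDerivAt expTwoPi (2 * Real.pi * I * expTwoPi z) z :=
  ((hasDerivAt_id z).const_mul (2 * (Real.pi : ℂ) * I)).cexp.congr_deriv (by
    rw [mul_one]; exact mul_comm _ _)

@[fun_prop]
lemma differentiable_expTwoPi : Differentiable ℂ expTwoPi :=
  fun z ↦ (hasDerivAt_expTwoPi z).differentiableAt

lemma norm_expTwoPi_lt_one {τ : ℂ} (hτ : 0 < τ.im) : ‖expTwoPi τ‖ < 1 := by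
  have hre : (2 * (Real.pi : ℂ) * I * τ).re = -(2 * Real.pi * τ.im) := by simp
  rw [expTwoPi, norm_exp, Real.exp_lt_one_iff, hre, neg_lt_zero]
  positivity

/-- The entire function of `z` given by the product `∏ (1 - qⁿ w) ∏ (1 - qⁿ⁺¹ / w)` over `n ≥ 0`,
where `q = e^{2πiτ}` and `w = e^{2πiz}`. By the Jacobi triple product it is, up to an exponential
factor, the odd Jacobi theta function; its zeros are simple and form the lattice `ℤ + ℤ τ`. -/
def theta (τ z : ℂ) : ℂ :=
  qProd (expTwoPi τ) (expTwoPi z) * qProd (expTwoPi τ) (expTwoPi (τ - z))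

/-- The product `∏ (1 - qⁿ⁺¹ w) ∏ (1 - qⁿ⁺¹ / w)`, that is, `theta` without its factor `1 - w`. -/
def thetaCofactor (τ z : ℂ) : ℂ :=
  qProd (expTwoPi τ) (expTwoPi (τ + z)) * qProd (expTwoPi τ) (expTwoPi (τ - z))

lemma thetaCofactor_neg (τ z : ℂ) : thetaCofactor τ (-z) = thetaCofactor τ z := by
  rw [thetaCofactor, thetaCofactor, sub_neg_eq_add, ← sub_eq_add_neg, mul_comm]

lemma theta_tau_sub (τ z : ℂ) : theta τ (τ - z) = theta τ z := by
  rw [theta, theta, sub_sub_cancel, mul_comm]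

lemma theta_add_one (τ z : ℂ) : theta τ (z + 1) = theta τ z := by
  have h : expTwoPi (τ - z) = expTwoPi (τ - (z + 1)) := by
    rw [show τ - z = τ - (z + 1) + 1 by ring, expTwoPi_add, expTwoPi_one, mul_one]
  rw [theta, theta, h, expTwoPi_add, expTwoPi_one, mul_one]

/-- The lattice `ℤ + ℤ τ`. -/
def periodLattice (τ : ℂ) : AddSubgroup ℂ := AddSubgroup.closure {1, τ}

lemma mem_periodLattice {τ z : ℂ} : z ∈ periodLattice τ ↔ ∃ m n : ℤ, z = m * τ + n := by
  rw [periodLattice, AddSubgroup.mem_closure_pair, exists_comm]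
  simp only [zsmul_eq_mul, mul_one, add_comm (_ * τ), eq_comm]

lemma tau_mem_periodLattice (τ : ℂ) : τ ∈ periodLattice τ :=
  AddSubgroup.subset_closure (Set.mem_insert_of_mem _ rfl)

section

variable {τ : ℂ} [hτ : Fact (0 < τ.im)]

lemma differentiable_qProd_comp_expTwoPi (τ : ℂ) [hτ : Fact (0 < τ.im)] {f : ℂ → ℂ}
    (hf : Differentiable ℂ f) : Differentiable ℂ fun z ↦ qProd (expTwoPi τ) (expTwoPi (f z)) :=
  (differentiable_qProd (norm_expTwoPi_lt_one hτ.out)).comp (differentiable_expTwoPi.comp hf)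

@[fun_prop]
lemma differentiable_theta (τ : ℂ) [Fact (0 < τ.im)] : Differentiable ℂ (theta τ) :=
  (differentiable_qProd_comp_expTwoPi τ differentiable_id).mul
    (differentiable_qProd_comp_expTwoPi τ (differentiable_id.const_sub τ))

lemma differentiable_thetaCofactor (τ : ℂ) [Fact (0 < τ.im)] :
    Differentiable ℂ (thetaCofactor τ) :=
  (differentiable_qProd_comp_expTwoPi τ (differentiable_id.const_add τ)).mul
    (differentiable_qProd_comp_expTwoPi τ (differentiable_id.const_sub τ))

lemma theta_eq_mul (z : ℂ) : theta τ z = (1 - expTwoPi z) * thetaCofactor τ z := by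
  rw [theta, qProd_eq_mul (norm_expTwoPi_lt_one hτ.out), thetaCofactor, expTwoPi_add, mul_assoc]

lemma theta_neg (z : ℂ) : theta τ (-z) = -expTwoPi (-z) * theta τ z := by
  rw [theta_eq_mul, theta_eq_mul, thetaCofactor_neg, expTwoPi_neg]
  field_simp [expTwoPi_ne_zero z]
  ring

lemma theta_add_tau (z : ℂ) : theta τ (z + τ) = -expTwoPi (-z) * theta τ z := by
  rw [← theta_neg, ← theta_tau_sub τ (-z), sub_neg_eq_add, add_comm]

lemma exists_theta_add_lattice {l : ℂ} (hl : l ∈ periodLattice τ) :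
    ∃ a b : ℂ, a ≠ 0 ∧ ∀ z, theta τ (z + l) = a * exp (b * z) * theta τ z := by
  induction hl using AddSubgroup.closure_induction with
  | mem l hl =>
    obtain rfl | rfl := hl
    · exact ⟨1, 0, one_ne_zero, fun z ↦ by simp [theta_add_one]⟩
    · refine ⟨-1, -(2 * Real.pi * I), by simp, fun z ↦ ?_⟩
      rw [theta_add_tau, expTwoPi]
      ring_nf
  | zero => exact ⟨1, 0, one_ne_zero, fun z ↦ by simp⟩
  | add l₁ l₂ _ _ h₁ h₂ =>
    obtain ⟨a₁, b₁, ha₁, h₁⟩ := h₁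
    obtain ⟨a₂, b₂, ha₂, h₂⟩ := h₂
    refine ⟨a₁ * a₂ * exp (b₂ * l₁), b₁ + b₂, by simp [ha₁, ha₂], fun z ↦ ?_⟩
    rw [← add_assoc, h₂, h₁, mul_add, exp_add, add_mul, exp_add]
    ring
  | neg l _ h =>
    obtain ⟨a, b, ha, h⟩ := h
    refine ⟨a⁻¹ * exp (b * l), -b, by simp [ha], fun z ↦ ?_⟩
    have hz := h (z + -l)
    rw [neg_add_cancel_right, mul_add, mul_neg, exp_add, exp_neg] at hz
    rw [hz, neg_mul, exp_neg]
    field_simp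

lemma thetaCofactor_ne_zero {z : ℂ} (h₁ : ∀ n : ℕ, expTwoPi ((n + 1) * τ + z) ≠ 1)
    (h₂ : ∀ n : ℕ, expTwoPi ((n + 1) * τ - z) ≠ 1) : thetaCofactor τ z ≠ 0 := by
  have hq := norm_expTwoPi_lt_one hτ.out
  refine mul_ne_zero (qProd_ne_zero hq fun n ↦ ?_) (qProd_ne_zero hq fun n ↦ ?_)
  · rw [← expTwoPi_nat_mul, ← expTwoPi_add]
    convert h₁ n using 2; ring
  · rw [← expTwoPi_nat_mul, ← expTwoPi_add]
    convert h₂ n using 2; ring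

lemma theta_eq_zero_iff {z : ℂ} : theta τ z = 0 ↔ z ∈ periodLattice τ := by
  refine ⟨fun h ↦ ?_, fun h ↦ ?_⟩
  · by_contra hz
    rw [mem_periodLattice] at hz
    have hfactor : 1 - expTwoPi z ≠ 0 := fun h₀ ↦ by
      obtain ⟨n, hn⟩ := expTwoPi_eq_one_iff.1 (sub_eq_zero.1 h₀).symm
      exact hz ⟨0, n, by simp [hn]⟩
    refine mul_ne_zero hfactor (thetaCofactor_ne_zero (fun n h₁ ↦ ?_) fun n h₁ ↦ ?_)
      ((theta_eq_mul z).symm.trans h)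
    · obtain ⟨j, hj⟩ := expTwoPi_eq_one_iff.1 h₁
      exact hz ⟨-(n + 1), j, by push_cast; linear_combination hj⟩
    · obtain ⟨j, hj⟩ := expTwoPi_eq_one_iff.1 h₁
      exact hz ⟨n + 1, -j, by push_cast; linear_combination -hj⟩
  · obtain ⟨a, b, -, h⟩ := exists_theta_add_lattice h
    simpa [theta_eq_mul 0, expTwoPi_zero] using h 0

lemma thetaCofactor_zero_ne_zero : thetaCofactor τ 0 ≠ 0 := by
  have h : ∀ n : ℕ, expTwoPi ((n + 1) * τ) ≠ 1 := fun n h ↦ by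
    obtain ⟨j, hj⟩ := expTwoPi_eq_one_iff.1 h
    have him : (n + 1) * τ.im = 0 := by simpa using congrArg Complex.im hj
    exact (mul_pos n.cast_add_one_pos hτ.out).ne' him
  exact thetaCofactor_ne_zero (by simpa using h) (by simpa using h)

lemma deriv_theta_zero_ne_zero : deriv (theta τ) 0 ≠ 0 := by
  have h := ((hasDerivAt_expTwoPi 0).const_sub 1).mul (differentiable_thetaCofactor τ 0).hasDerivAt
  rw [show theta τ = (fun z ↦ 1 - expTwoPi z) * thetaCofactor τ from funext theta_eq_mul, h.deriv,
    expTwoPi_zero, sub_self, zero_mul, add_zero, mul_one]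
  exact mul_ne_zero (neg_ne_zero.2 two_pi_I_ne_zero) thetaCofactor_zero_ne_zero

lemma deriv_theta_ne_zero {l : ℂ} (hl : l ∈ periodLattice τ) : deriv (theta τ) l ≠ 0 := by
  obtain ⟨a, b, ha, h⟩ := exists_theta_add_lattice hl
  have hd : HasDerivAt (fun z ↦ a * exp (b * z)) (a * (exp (b * 0) * (b * 1))) 0 :=
    (((hasDerivAt_id (0 : ℂ)).const_mul b).cexp).const_mul a
  have h₁ := hd.mul (differentiable_theta τ 0).hasDerivAt
  rw [← show (fun z ↦ theta τ (z + l)) = (fun z ↦ a * exp (b * z)) * theta τ from funext h,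
    theta_eq_zero_iff.2 (zero_mem _)] at h₁
  have h₂ := deriv_comp_add_const (theta τ) l 0
  rw [zero_add, h₁.deriv] at h₂
  rw [← h₂]
  simpa using ⟨ha, deriv_theta_zero_ne_zero⟩

open Classical in
lemma analyticOrderAt_theta_sub (a z : ℂ) :
    analyticOrderAt (fun z ↦ theta τ (z - a)) z = if z - a ∈ periodLattice τ then 1 else 0 := by
  have h : Differentiable ℂ fun z ↦ theta τ (z - a) := by fun_prop
  split_ifs with hz
  · refine (h.analyticAt z).analyticOrderAt_eq_one_of_zero_deriv_ne_zero
      (theta_eq_zero_iff.2 hz) ?_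
    rw [deriv_comp_sub_const]
    exact deriv_theta_ne_zero hz
  · exact (h.analyticAt z).analyticOrderAt_eq_zero.2 (mt theta_eq_zero_iff.1 hz)

end

lemma logDeriv_comp_add_const (f : ℂ → ℂ) (a z : ℂ) :
    logDeriv (fun w ↦ f (w + a)) z = logDeriv f (z + a) := by
  rw [logDeriv_apply, logDeriv_apply, deriv_comp_add_const]

lemma logDeriv_theta_add_one (τ z : ℂ) : logDeriv (theta τ) (z + 1) = logDeriv (theta τ) z := by
  rw [← logDeriv_comp_add_const, funext (theta_add_one τ)]

lemma logDeriv_neg_expTwoPi_neg (z : ℂ) :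
    logDeriv (fun z ↦ -expTwoPi (-z)) z = -(2 * Real.pi * I) := by
  have h := ((hasDerivAt_expTwoPi (-z)).comp z (hasDerivAt_neg z)).neg
  have h' : HasDerivAt (fun z ↦ -expTwoPi (-z)) _ z := h
  rw [logDeriv_apply, h'.deriv, div_eq_iff (neg_ne_zero.2 (expTwoPi_ne_zero _))]
  ring

section

variable {τ : ℂ} [hτ : Fact (0 < τ.im)]

lemma logDeriv_neg_expTwoPi_neg_mul_theta {z : ℂ} (hz : z ∉ periodLattice τ) :
    logDeriv (fun z ↦ -expTwoPi (-z) * theta τ z) z = logDeriv (theta τ) z - 2 * Real.pi * I := by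
  rw [logDeriv_mul (f := fun z ↦ -expTwoPi (-z)) z (neg_ne_zero.2 (expTwoPi_ne_zero _))
    (mt theta_eq_zero_iff.1 hz) (by fun_prop) (by fun_prop), logDeriv_neg_expTwoPi_neg,
    neg_add_eq_sub]

lemma logDeriv_theta_add_tau {z : ℂ} (hz : z ∉ periodLattice τ) :
    logDeriv (theta τ) (z + τ) = logDeriv (theta τ) z - 2 * Real.pi * I := by
  rw [← logDeriv_comp_add_const, _root_.funext theta_add_tau,
    logDeriv_neg_expTwoPi_neg_mul_theta hz]

lemma logDeriv_theta_neg {z : ℂ} (hz : z ∉ periodLattice τ) :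
    logDeriv (theta τ) (-z) = 2 * Real.pi * I - logDeriv (theta τ) z := by
  have h : logDeriv (fun w ↦ theta τ (-w)) z = -logDeriv (theta τ) (-z) := by
    rw [logDeriv_apply, logDeriv_apply, deriv_comp_neg, neg_div]
  rw [_root_.funext theta_neg, logDeriv_neg_expTwoPi_neg_mul_theta hz] at h
  linear_combination h

lemma half_ne_intCast (n : ℤ) : (1 / 2 : ℝ) ≠ n := fun h ↦ by
  have : (1 : ℤ) = 2 * n := by exact_mod_cast (by linarith : (1 : ℝ) = 2 * n)
  omega

lemma mem_periodLattice_iff_of_real {a b : ℝ} :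
    (a * τ + b : ℂ) ∈ periodLattice τ ↔ (∃ m : ℤ, a = m) ∧ ∃ n : ℤ, b = n := by
  rw [mem_periodLattice]
  constructor
  · rintro ⟨m, n, h⟩
    have him : a * τ.im = m * τ.im := by simpa using congrArg Complex.im h
    have ha : a = m := mul_right_cancel₀ hτ.out.ne' him
    have hb : (b : ℂ) = (n : ℝ) := by rw [ha] at h; simpa using h
    exact ⟨⟨m, ha⟩, n, ofReal_injective hb⟩
  · rintro ⟨⟨m, rfl⟩, n, rfl⟩
    exact ⟨m, n, by simp⟩

lemma exists_real_coords (τ : ℂ) [hτ : Fact (0 < τ.im)] (z : ℂ) : ∃ a b : ℝ, z = a * τ + b := by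
  have hne := hτ.out.ne'
  refine ⟨z.im / τ.im, z.re - z.im / τ.im * τ.re, Complex.ext (by simp) ?_⟩
  simp [hne]

end

/-! ### Entire functions with two periods -/

lemma add_eq_of_mem_periodLattice {τ : ℂ} {E : Type*} {f : ℂ → E} (h₁ : ∀ z, f (z + 1) = f z)
    (hτ : ∀ z, f (z + τ) = f z) {l : ℂ} (hl : l ∈ periodLattice τ) (z : ℂ) :
    f (z + l) = f z := by
  have hle : periodLattice τ ≤
      { carrier := {l | ∀ z, f (z + l) = f z}
        add_mem' := fun h h' z ↦ by rw [← add_assoc, h', h]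
        zero_mem' := fun z ↦ by rw [add_zero]
        neg_mem' := fun {l} h z ↦ by rw [← h (z + -l), neg_add_cancel_right] } :=
    (AddSubgroup.closure_le _).2 (by rintro _ (rfl | rfl) <;> assumption)
  exact hle hl z

section

variable {τ : ℂ} [hτ : Fact (0 < τ.im)]

lemma exists_eq_const_of_periodic {f : ℂ → ℂ} (hf : Differentiable ℂ f)
    (h₁ : ∀ z, f (z + 1) = f z) (h₂ : ∀ z, f (z + τ) = f z) : ∃ c, ∀ z, f z = c := by
  refine hf.exists_const_forall_eq_of_bounded ?_
  have hc : IsCompact ((fun p : ℝ × ℝ ↦ f (p.1 * τ + p.2)) '' (Set.Icc 0 1 ×ˢ Set.Icc 0 1)) := by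
    refine (isCompact_Icc.prod isCompact_Icc).image ?_
    have := hf.continuous
    fun_prop
  refine hc.isBounded.subset ?_
  rintro _ ⟨z, rfl⟩
  obtain ⟨a, b, rfl⟩ := exists_real_coords τ z
  refine ⟨(Int.fract a, Int.fract b), ⟨⟨Int.fract_nonneg _, (Int.fract_lt_one _).le⟩,
    ⟨Int.fract_nonneg _, (Int.fract_lt_one _).le⟩⟩, ?_⟩
  have h := add_eq_of_mem_periodLattice h₁ h₂ (mem_periodLattice.2 ⟨⌊a⌋, ⌊b⌋, rfl⟩)
    ((Int.fract a : ℝ) * τ + (Int.fract b : ℝ))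
  refine h.symm.trans (congrArg f ?_)
  simp only [Int.fract]
  push_cast
  ring

lemma exists_eq_mul_exp_of_deriv_eq_mul {H : ℂ → ℂ} (hH : Differentiable ℂ H) {d : ℂ}
    (hd : ∀ z, deriv H z = d * H z) (z : ℂ) : H z = H 0 * exp (d * z) := by
  have hder : ∀ z, HasDerivAt (fun z ↦ H z * exp (-(d * z))) 0 z := fun z ↦ by
    refine ((hH z).hasDerivAt.fun_mul
      (((hasDerivAt_id z).const_mul d).fun_neg).cexp).congr_deriv ?_
    rw [hd]
    simp only [id_eq]
    ring
  have h := is_const_of_deriv_eq_zero (fun z ↦ (hder z).differentiableAt)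
    (fun z ↦ (hder z).deriv) z 0
  rw [mul_zero, neg_zero, exp_zero, mul_one, exp_neg] at h
  rw [← h, inv_mul_cancel_right₀ (exp_ne_zero _)]

lemma exists_eq_exp_of_quasiperiodic {H : ℂ → ℂ} (hH : Differentiable ℂ H)
    (h₀ : ∀ z, H z ≠ 0) {s : ℂ} (h₁ : ∀ z, H (z + 1) = H z)
    (h₂ : ∀ z, H (z + τ) = expTwoPi s * H z) :
    ∃ n m : ℤ, s = n * τ + m ∧ ∀ z, H z = H 0 * expTwoPi (n * z) := by
  obtain ⟨d, hd⟩ := exists_eq_const_of_periodic (τ := τ) (f := logDeriv H)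
    (hH.deriv.div hH h₀)
    (fun z ↦ by rw [← logDeriv_comp_add_const, funext h₁])
    (fun z ↦ by
      rw [← logDeriv_comp_add_const, funext h₂, logDeriv_const_mul _ _ (expTwoPi_ne_zero s)])
  have hexp := exists_eq_mul_exp_of_deriv_eq_mul hH fun z ↦ (div_eq_iff (h₀ z)).1 (hd z)
  have hd₁ : exp d = 1 := mul_left_cancel₀ (h₀ 0) (by
    rw [mul_one, ← mul_one d, ← hexp 1, ← h₁ 0, zero_add])
  obtain ⟨n, rfl⟩ := exp_eq_one_iff.1 hd₁
  have hexp' : ∀ z, H z = H 0 * expTwoPi (n * z) := fun z ↦ by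
    rw [hexp z, expTwoPi]; ring_nf
  have hτs : expTwoPi (s + -(n * τ)) = 1 := by
    have h := h₂ 0
    rw [zero_add, hexp' τ, mul_comm] at h
    rw [expTwoPi_add, ← mul_right_cancel₀ (h₀ 0) h, expTwoPi_neg,
      mul_inv_cancel₀ (expTwoPi_ne_zero _)]
  obtain ⟨m, hm⟩ := expTwoPi_eq_one_iff.1 hτs
  exact ⟨n, m, by linear_combination hm, hexp'⟩

end

/-! ### Quotients of entire functions -/

lemma exists_differentiable_of_meromorphicOrderAt_nonneg {f : ℂ → ℂ}
    (hf : ∀ z, MeromorphicAt f z) (h₀ : ∀ z, 0 ≤ meromorphicOrderAt f z) :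
    ∃ g : ℂ → ℂ, Differentiable ℂ g ∧ ∀ z, f =ᶠ[𝓝[≠] z] g := by
  have hf' : MeromorphicOn f Set.univ := fun z _ ↦ hf z
  have hnf := meromorphicNFOn_toMeromorphicNFOn f Set.univ
  refine ⟨toMeromorphicNFOn f Set.univ, fun z ↦ AnalyticAt.differentiableAt ?_, fun z ↦
    (hf'.toMeromorphicNFOn_eq_self_on_nhdsNE (Set.mem_univ z)).symm⟩
  rw [← (hnf (Set.mem_univ z)).meromorphicOrderAt_nonneg_iff_analyticAt,
    meromorphicOrderAt_toMeromorphicNFOn hf' (Set.mem_univ z)]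
  exact h₀ z

lemma eq_of_forall_eventuallyEq_nhdsNE {f g : ℂ → ℂ} (hf : Continuous f) (hg : Continuous g)
    (h : ∀ z, f =ᶠ[𝓝[≠] z] g) : f = g :=
  funext fun z ↦ ((hf.continuousAt.eventuallyEq_nhds_iff_eventuallyEq_nhdsNE
    hg.continuousAt).1 (h z)).eq_of_nhds

lemma tendsto_add_const_nhdsNE (z a : ℂ) : Tendsto (· + a) (𝓝[≠] z) (𝓝[≠] (z + a)) :=
  tendsto_nhdsWithin_iff.2 ⟨((continuous_add_const a).tendsto z).mono_left nhdsWithin_le_nhds,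
    eventually_mem_nhdsWithin.mono fun w hw ↦ by simpa using hw⟩

lemma exists_eventuallyEq_const_of_periodic {τ : ℂ} [Fact (0 < τ.im)] {f : ℂ → ℂ}
    (hf : ∀ z, MeromorphicAt f z)
    (h₀ : ∀ z, 0 ≤ meromorphicOrderAt f z) (h₁ : ∀ z, f (z + 1) = f z)
    (h₂ : ∀ z, f (z + τ) = f z) : ∃ c, ∀ z, f =ᶠ[𝓝[≠] z] fun _ ↦ c := by
  obtain ⟨g, hg, hfg⟩ := exists_differentiable_of_meromorphicOrderAt_nonneg hf h₀
  have hper {a : ℂ} (ha : ∀ z, f (z + a) = f z) (z : ℂ) : g (z + a) = g z := by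
    refine congrFun (eq_of_forall_eventuallyEq_nhdsNE (f := fun z ↦ g (z + a)) (g := g)
      (hg.continuous.comp (continuous_add_const a)) hg.continuous fun w ↦ ?_) z
    filter_upwards [hfg w, (tendsto_add_const_nhdsNE w a).eventually (hfg (w + a))] with v h h'
    rw [← h, ← h', ha]
  obtain ⟨c, hc⟩ := exists_eq_const_of_periodic hg (hper h₁) (hper h₂)
  exact ⟨c, fun z ↦ (hfg z).trans (.of_forall hc)⟩

lemma two_le_analyticOrderAt {f : ℂ → ℂ} {z : ℂ} (hf : AnalyticAt ℂ f z) (h₀ : f z = 0)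
    (h₁ : deriv f z = 0) : 2 ≤ analyticOrderAt f z := by
  rw [show (2 : ℕ∞) = (2 : ℕ) from rfl, natCast_le_analyticOrderAt_iff_iteratedDeriv_eq_zero hf]
  intro i hi
  interval_cases i
  · rw [iteratedDeriv_zero, h₀]
  · rw [iteratedDeriv_one, h₁]

lemma analyticOrderAt_finset_prod {𝕜 ι : Type*} [NontriviallyNormedField 𝕜] (s : Finset ι)
    {f : ι → 𝕜 → 𝕜} {z : 𝕜} (hf : ∀ i ∈ s, AnalyticAt 𝕜 (f i) z) :
    analyticOrderAt (∏ i ∈ s, f i) z = ∑ i ∈ s, analyticOrderAt (f i) z := by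
  induction s using Finset.cons_induction with
  | empty => exact (analyticAt_const (v := (1 : 𝕜))).analyticOrderAt_eq_zero.2 one_ne_zero
  | cons i s hi ih =>
    rw [Finset.forall_mem_cons] at hf
    rw [Finset.prod_cons, Finset.sum_cons,
      analyticOrderAt_mul hf.1 (Finset.analyticAt_prod s hf.2), ih hf.2]

lemma eq_of_mul_eq_mul_of_analyticOrderAt_ne_top {f g G : ℂ → ℂ} (hf : Continuous f)
    (hg : Continuous g) (hG : Differentiable ℂ G) (htop : ∀ z, analyticOrderAt G z ≠ ⊤)
    (h : ∀ z, f z * G z = g z * G z) : f = g :=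
  eq_of_forall_eventuallyEq_nhdsNE hf hg fun z ↦
    (((hG.analyticAt z).eventually_eq_zero_or_eventually_ne_zero.resolve_left
      (mt analyticOrderAt_eq_top.2 (htop z))).mono fun w hw ↦ mul_right_cancel₀ hw (h w))

lemma exists_eq_mul_of_analyticOrderAt_eq {F G : ℂ → ℂ} (hF : Differentiable ℂ F)
    (hG : Differentiable ℂ G) (htop : ∀ z, analyticOrderAt G z ≠ ⊤)
    (hord : ∀ z, analyticOrderAt F z = analyticOrderAt G z) :
    ∃ H : ℂ → ℂ, Differentiable ℂ H ∧ (∀ z, H z ≠ 0) ∧ ∀ z, F z = H z * G z := by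
  obtain ⟨H, hH, hFG⟩ := exists_differentiable_of_meromorphicOrderAt_nonneg
    (f := fun z ↦ F z / G z)
    (fun z ↦ (hF.analyticAt z).meromorphicAt.div (hG.analyticAt z).meromorphicAt)
    (fun z ↦ by
      have h := meromorphicOrderAt_div (hF.analyticAt z).meromorphicAt
        (hG.analyticAt z).meromorphicAt
      rw [(hF.analyticAt z).meromorphicOrderAt_eq, (hG.analyticAt z).meromorphicOrderAt_eq,
        hord z, LinearOrderedAddCommGroupWithTop.sub_self_eq_zero_of_ne_top
          (by simpa using htop z)] at h
      exact h.ge)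
  have hmul : F = fun z ↦ H z * G z :=
    eq_of_forall_eventuallyEq_nhdsNE hF.continuous (hH.mul hG).continuous fun z ↦ by
      filter_upwards [hFG z, (hG.analyticAt z).eventually_eq_zero_or_eventually_ne_zero.resolve_left
        (mt analyticOrderAt_eq_top.2 (htop z))] with w hw hGw
      rw [← hw, div_mul_cancel₀ _ hGw]
  refine ⟨H, hH, fun z ↦ ?_, congrFun hmul⟩
  have h := hord z
  rw [hmul, show (fun z ↦ H z * G z) = H * G from rfl,
    analyticOrderAt_mul (hH.analyticAt z) (hG.analyticAt z)] at h
  exact (hH.analyticAt z).analyticOrderAt_eq_zero.1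
    (WithTop.add_right_cancel (htop z) (h.trans (zero_add _).symm))

lemma exists_eq_mul_expTwoPi_mul {τ : ℂ} [Fact (0 < τ.im)] {F G u : ℂ → ℂ} {s : ℂ}
    (hF : Differentiable ℂ F) (hG : Differentiable ℂ G) (htop : ∀ z, analyticOrderAt G z ≠ ⊤)
    (hord : ∀ z, analyticOrderAt F z = analyticOrderAt G z) (hF₁ : ∀ z, F (z + 1) = F z)
    (hG₁ : ∀ z, G (z + 1) = G z) (hu : ∀ z, u z ≠ 0)
    (hFτ : ∀ z, F (z + τ) = expTwoPi s * u z * F z) (hGτ : ∀ z, G (z + τ) = u z * G z) :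
    ∃ n m : ℤ, ∃ c : ℂ, s = n * τ + m ∧ ∀ z, F z = c * expTwoPi (n * z) * G z := by
  obtain ⟨H, hH, hH₀, hmul⟩ := exists_eq_mul_of_analyticOrderAt_eq hF hG htop hord
  have hshift (a : ℂ) : Continuous fun z ↦ H (z + a) :=
    hH.continuous.comp (continuous_add_const a)
  have h₁ := eq_of_mul_eq_mul_of_analyticOrderAt_ne_top (hshift 1) hH.continuous hG htop
    fun z ↦ by rw [← hmul, ← hF₁, hmul, hG₁]
  have h₂ := eq_of_mul_eq_mul_of_analyticOrderAt_ne_top (hshift τ)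
    (hH.continuous.const_mul (expTwoPi s)) hG htop fun z ↦ mul_left_cancel₀ (hu z) <| by
      rw [mul_left_comm, ← hGτ, ← hmul, hFτ, hmul]
      ring
  obtain ⟨n, m, hs, hexp⟩ := exists_eq_exp_of_quasiperiodic hH hH₀ (congrFun h₁) (congrFun h₂)
  exact ⟨n, m, H 0, hs, fun z ↦ by rw [hmul, hexp]⟩

/-! ### Jacobi's elliptic functions of a real variable -/

lemma integral_zero_pi_of_symm {f : ℝ → ℝ} (hf : Continuous f) (h : ∀ u, f (Real.pi - u) = f u) :
    ∫ u in (0 : ℝ)..Real.pi, f u = 2 * ∫ u in (0 : ℝ)..Real.pi / 2, f u := by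
  have hsymm := intervalIntegral.integral_comp_sub_left (a := 0) (b := Real.pi / 2) f Real.pi
  simp only [h, sub_zero, show Real.pi - Real.pi / 2 = Real.pi / 2 by ring] at hsymm
  rw [← intervalIntegral.integral_add_adjacent_intervals (hf.intervalIntegrable _ (Real.pi / 2))
    (hf.intervalIntegrable _ _), ← hsymm, two_mul]

section

variable {k : ℝ}

/-- The function `√(1 - k² sin² φ)`, the derivative of the elliptic integral of the second kind. -/
def ellDelta (k φ : ℝ) : ℝ := Real.sqrt (1 - k ^ 2 * Real.sin φ ^ 2)

/-- The incomplete elliptic integral of the first kind. -/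
def ellF (k φ : ℝ) : ℝ := ∫ u in (0 : ℝ)..φ, 1 / ellDelta k u

lemma ellDelta_le_one (φ : ℝ) : ellDelta k φ ≤ 1 := by
  rw [ellDelta, Real.sqrt_le_one]
  linarith [mul_nonneg (sq_nonneg k) (sq_nonneg (Real.sin φ))]

@[fun_prop]
lemma continuous_ellDelta : Continuous (ellDelta k) := by
  unfold ellDelta; fun_prop

lemma ellDelta_pi_sub (φ : ℝ) : ellDelta k (Real.pi - φ) = ellDelta k φ := by simp [ellDelta]

lemma ellDelta_add_pi (φ : ℝ) : ellDelta k (φ + Real.pi) = ellDelta k φ := by simp [ellDelta]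

lemma ellF_half_pi : ellF k (Real.pi / 2) = ellK k := rfl

lemma ellF_zero : ellF k 0 = 0 := intervalIntegral.integral_same

variable [hk : Fact (|k| < 1)]

lemma sq_modulus_lt_one : k ^ 2 < 1 := sq_lt_one_iff_abs_lt_one k |>.2 hk.out

lemma one_sub_sq_mul_sin_sq_pos (φ : ℝ) : 0 < 1 - k ^ 2 * Real.sin φ ^ 2 := by
  nlinarith [sq_modulus_lt_one (k := k), Real.sin_sq_le_one φ, sq_nonneg (Real.sin φ)]

lemma ellDelta_pos (φ : ℝ) : 0 < ellDelta k φ :=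
  Real.sqrt_pos.2 (one_sub_sq_mul_sin_sq_pos φ)

lemma ellDelta_sq (φ : ℝ) : ellDelta k φ ^ 2 = 1 - k ^ 2 * Real.sin φ ^ 2 :=
  Real.sq_sqrt (one_sub_sq_mul_sin_sq_pos φ).le

lemma continuous_one_div_ellDelta : Continuous fun φ ↦ 1 / ellDelta k φ :=
  continuous_const.div continuous_ellDelta fun φ ↦ (ellDelta_pos φ).ne'

lemma intervalIntegrable_one_div_ellDelta (a b : ℝ) :
    IntervalIntegrable (fun φ ↦ 1 / ellDelta k φ) volume a b :=
  continuous_one_div_ellDelta.intervalIntegrable a b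

lemma hasDerivAt_ellF (φ : ℝ) : HasDerivAt (ellF k) (1 / ellDelta k φ) φ :=
  intervalIntegral.integral_hasDerivAt_right (intervalIntegrable_one_div_ellDelta _ _)
    (continuous_one_div_ellDelta.stronglyMeasurableAtFilter _ _)
    continuous_one_div_ellDelta.continuousAt

lemma strictMono_ellF : StrictMono (ellF k) :=
  strictMono_of_hasDerivAt_pos hasDerivAt_ellF fun φ ↦ one_div_pos.2 (ellDelta_pos φ)

lemma monotone_ellF_sub_id : Monotone fun φ ↦ ellF k φ - φ := by
  refine monotone_of_hasDerivAt_nonneg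
    (fun φ ↦ (hasDerivAt_ellF φ).sub (hasDerivAt_id φ)) fun φ ↦ sub_nonneg.2 ?_
  exact (one_le_div (ellDelta_pos φ)).2 (ellDelta_le_one φ)

lemma surjective_ellF : Function.Surjective (ellF k) := by
  have hcont : Continuous (ellF k) :=
    continuous_iff_continuousAt.2 fun φ ↦ (hasDerivAt_ellF φ).continuousAt
  refine hcont.surjective (tendsto_atTop_mono' _ ?_ tendsto_id)
    (tendsto_atBot_mono' _ ?_ tendsto_id)
  · filter_upwards [eventually_ge_atTop 0] with φ hφ
    simpa [ellF_zero] using monotone_ellF_sub_id (k := k) hφ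
  · filter_upwards [eventually_le_atBot 0] with φ hφ
    simpa [ellF_zero] using monotone_ellF_sub_id (k := k) hφ

lemma ellF_pi : ellF k Real.pi = 2 * ellK k :=
  integral_zero_pi_of_symm continuous_one_div_ellDelta fun u ↦ by rw [ellDelta_pi_sub]

lemma ellF_add_pi (φ : ℝ) : ellF k (φ + Real.pi) = ellF k φ + 2 * ellK k := by
  have hshift := intervalIntegral.integral_comp_add_right (a := 0) (b := φ)
    (fun u ↦ 1 / ellDelta k u) Real.pi
  simp only [ellDelta_add_pi, zero_add] at hshift
  rw [← ellF_pi, ellF, ellF, ellF, hshift, add_comm (∫ _ in _.._, _),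
    intervalIntegral.integral_add_adjacent_intervals (intervalIntegrable_one_div_ellDelta _ _)
      (intervalIntegrable_one_div_ellDelta _ _)]

lemma ellF_int_mul_pi (n : ℤ) : ellF k (n * Real.pi) = n * (2 * ellK k) := by
  have hstep (m : ℤ) :
      ellF k ((m + 1 : ℤ) * Real.pi) = ellF k (m * Real.pi) + 2 * ellK k := by
    rw [← ellF_add_pi]; push_cast; ring_nf
  induction n using Int.induction_on with
  | zero => simp [ellF_zero]
  | succ n ih => rw [hstep, ih]; push_cast; ring
  | pred n ih =>
    have h := hstep (-n - 1)
    rw [sub_add_cancel, ih] at h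
    push_cast at h ⊢
    linarith

lemma ellK_pos (k : ℝ) [Fact (|k| < 1)] : 0 < ellK k := by
  rw [← ellF_half_pi, ← ellF_zero (k := k)]
  exact strictMono_ellF (by positivity)

end

/-- Jacobi's amplitude, the inverse function of `ellF k` for `|k| < 1`. -/
def amplitude (k : ℝ) : ℝ → ℝ := Function.invFun (ellF k)

/-- Jacobi's sine amplitude. -/
def sn (k u : ℝ) : ℝ := Real.sin (amplitude k u)

/-- Jacobi's cosine amplitude. -/
def cn (k u : ℝ) : ℝ := Real.cos (amplitude k u)

/-- Jacobi's delta amplitude. -/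
def dn (k u : ℝ) : ℝ := ellDelta k (amplitude k u)

section

variable {k : ℝ}

lemma sn_sq (u : ℝ) : sn k u ^ 2 = 1 - cn k u ^ 2 := Real.sin_sq _

variable [Fact (|k| < 1)]

lemma ellF_amplitude (u : ℝ) : ellF k (amplitude k u) = u :=
  Function.invFun_eq (surjective_ellF u)

lemma amplitude_eq_iff {u φ : ℝ} : amplitude k u = φ ↔ u = ellF k φ :=
  ⟨fun h ↦ by rw [← h, ellF_amplitude],
    fun h ↦ strictMono_ellF.injective (by rw [ellF_amplitude, h])⟩

lemma continuous_amplitude : Continuous (amplitude k) := by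
  let e := (strictMono_ellF (k := k)).orderIsoOfSurjective _ surjective_ellF
  have h : amplitude k = e.symm :=
    _root_.funext fun u ↦ amplitude_eq_iff.2 (e.apply_symm_apply u).symm
  exact h ▸ e.symm.continuous

lemma hasDerivAt_amplitude (u : ℝ) : HasDerivAt (amplitude k) (ellDelta k (amplitude k u)) u := by
  have h := HasDerivAt.of_local_left_inverse continuous_amplitude.continuousAt
    (hasDerivAt_ellF (amplitude k u)) (one_div_ne_zero (ellDelta_pos _).ne')
    (Eventually.of_forall ellF_amplitude)
  simpa using h

lemma amplitude_zero : amplitude k 0 = 0 := by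
  rw [amplitude_eq_iff, ellF_zero]

lemma amplitude_ellK : amplitude k (ellK k) = Real.pi / 2 := by
  rw [amplitude_eq_iff, ellF_half_pi]

lemma amplitude_add (u : ℝ) : amplitude k (u + 2 * ellK k) = amplitude k u + Real.pi := by
  rw [amplitude_eq_iff, ellF_add_pi, ellF_amplitude]

lemma dn_sq (u : ℝ) : dn k u ^ 2 = 1 - k ^ 2 * sn k u ^ 2 := ellDelta_sq _

lemma dn_pos (u : ℝ) : 0 < dn k u := ellDelta_pos _

lemma hasDerivAt_sn (u : ℝ) : HasDerivAt (sn k) (cn k u * dn k u) u :=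
  (hasDerivAt_amplitude u).sin

lemma hasDerivAt_cn (u : ℝ) : HasDerivAt (cn k) (-(sn k u * dn k u)) u :=
  (hasDerivAt_amplitude u).cos.congr_deriv (neg_mul _ _)

lemma hasDerivAt_dn (u : ℝ) : HasDerivAt (dn k) (-(k ^ 2 * sn k u * cn k u)) u := by
  have hsq : HasDerivAt (fun u ↦ 1 - k ^ 2 * sn k u ^ 2)
      (-(k ^ 2 * (2 * sn k u * (cn k u * dn k u)))) u :=
    ((((hasDerivAt_sn u).pow 2).const_mul (k ^ 2)).const_sub 1).congr_deriv (by simp)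
  refine (hsq.sqrt (one_sub_sq_mul_sin_sq_pos _).ne').congr_deriv ?_
  change _ / (2 * dn k u) = _
  have := (dn_pos (k := k) u).ne'
  field_simp

lemma sn_add (u : ℝ) : sn k (u + 2 * ellK k) = -sn k u := by
  simp [sn, amplitude_add]

lemma cn_add (u : ℝ) : cn k (u + 2 * ellK k) = -cn k u := by
  simp [cn, amplitude_add]

lemma dn_add (u : ℝ) : dn k (u + 2 * ellK k) = dn k u := by
  rw [dn, amplitude_add, ellDelta_add_pi, dn]

lemma sn_eq_zero_iff {u : ℝ} : sn k u = 0 ↔ ∃ n : ℤ, u = n * (2 * ellK k) := by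
  simp only [sn, Real.sin_eq_zero_iff, eq_comm (b := amplitude k u), amplitude_eq_iff,
    ellF_int_mul_pi]

lemma cn_int_mul (n : ℤ) : cn k (n * (2 * ellK k)) = (-1) ^ n := by
  rw [cn, amplitude_eq_iff.2 (ellF_int_mul_pi n).symm, Real.cos_int_mul_pi]

lemma sn_zero : sn k 0 = 0 := by simp [sn, amplitude_zero]

lemma cn_zero : cn k 0 = 1 := by simp [cn, amplitude_zero]

lemma dn_zero : dn k 0 = 1 := by simp [dn, ellDelta, amplitude_zero]

lemma sn_ellK : sn k (ellK k) = 1 := by simp [sn, amplitude_ellK]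

lemma cn_ellK : cn k (ellK k) = 0 := by simp [cn, amplitude_ellK]

end

/-! ### The coordinate `ζ` as an elliptic function -/

lemma hasDerivAt_of_partial {f : ℂ → ℂ} {a z : ℂ} (hf : DifferentiableAt ℝ f z)
    (hre : HasDerivAt (fun t : ℝ ↦ f (z + t)) a 0)
    (him : HasDerivAt (fun t : ℝ ↦ f (z + t * I)) (I * a) 0) : HasDerivAt f a z := by
  have hline (w : ℂ) : HasDerivAt (fun t : ℝ ↦ f (z + t * w)) (fderiv ℝ f z w) 0 := by
    have hw : HasDerivAt (fun t : ℝ ↦ z + t * w) w 0 := by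
      simpa using ((ofRealCLM.hasDerivAt (x := (0 : ℝ))).mul_const w).const_add z
    have hf' : HasFDerivAt f (fderiv ℝ f z) (z + ((0 : ℝ) : ℂ) * w) := by
      simpa using hf.hasFDerivAt
    exact hf'.comp_hasDerivAt (0 : ℝ) hw
  have h_one : fderiv ℝ f z 1 = a := (hline 1).unique (by simpa using hre)
  have h_I : fderiv ℝ f z I = I * a := (hline I).unique him
  have hC : fderiv ℝ f z I = I • fderiv ℝ f z 1 := by rw [h_one, h_I, smul_eq_mul]
  have hd := (differentiableAt_complex_iff_differentiableAt_real.2 ⟨hf, hC⟩).hasDerivAt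
  rwa [complexOfReal_deriv hf hC, h_one] at hd

lemma hasDerivAt_ofReal_comp_add {f : ℝ → ℝ} {f' : ℝ} (a x : ℝ) (hf : HasDerivAt f f' (a * x)) :
    HasDerivAt (fun t : ℝ ↦ (f (a * (x + t)) : ℂ)) (a * f') 0 := by
  have haff : HasDerivAt (fun t : ℝ ↦ a * (x + t)) a 0 := by
    simpa using ((hasDerivAt_id (0 : ℝ)).const_add x).const_mul a
  have hf' : HasDerivAt f f' (a * (x + 0)) := by simpa using hf
  refine (hf'.comp (0 : ℝ) haff).ofReal_comp.congr_deriv ?_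
  push_cast; ring

section

variable {k : ℝ} [hk : Fact (|k| < 1)]

lemma compl_pos : 0 < compl k := Real.sqrt_pos.2 (sub_pos.2 sq_modulus_lt_one)

lemma compl_sq : compl k ^ 2 = 1 - k ^ 2 := Real.sq_sqrt (sub_pos.2 sq_modulus_lt_one).le

variable [NeZero k]

instance fact_abs_compl_lt_one : Fact (|compl k| < 1) := ⟨by
  rw [← sq_lt_one_iff_abs_lt_one, compl_sq]
  linarith [sq_pos_of_ne_zero (NeZero.ne k)]⟩

omit hk [NeZero k] in
lemma tau_re : (tau k).re = 0 := by simp [tau, div_re, normSq]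

omit [NeZero k] in
lemma ellK_mul_tau_im : ellK k * (tau k).im = ellK (compl k) := by
  have hK := (ellK_pos k).ne'
  have h : tau k = ((ellK (compl k) / ellK k : ℝ) : ℂ) * I := by
    rw [tau]; push_cast; ring
  rw [h, im_ofReal_mul, I_im]
  field_simp

instance fact_tau_im_pos : Fact (0 < (tau k).im) :=
  ⟨pos_of_mul_pos_right (ellK_mul_tau_im (k := k) ▸ ellK_pos (compl k)) (ellK_pos k).le⟩

end

/-- `sn` of the modulus `k` in the real direction of the normalised parameter `z = ∫ v`. -/
def snRe (k : ℝ) (z : ℂ) : ℝ := sn k (4 * ellK k * z.re)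

/-- `cn` of the modulus `k` in the real direction of the normalised parameter `z = ∫ v`. -/
def cnRe (k : ℝ) (z : ℂ) : ℝ := cn k (4 * ellK k * z.re)

/-- `dn` of the modulus `k` in the real direction of the normalised parameter `z = ∫ v`. -/
def dnRe (k : ℝ) (z : ℂ) : ℝ := dn k (4 * ellK k * z.re)

/-- `sn` of the modulus `k'` in the imaginary direction of the normalised parameter `z = ∫ v`. -/
def snIm (k : ℝ) (z : ℂ) : ℝ := sn (compl k) (4 * ellK k * z.im)

/-- `cn` of the modulus `k'` in the imaginary direction of the normalised parameter `z = ∫ v`. -/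
def cnIm (k : ℝ) (z : ℂ) : ℝ := cn (compl k) (4 * ellK k * z.im)

/-- `dn` of the modulus `k'` in the imaginary direction of the normalised parameter `z = ∫ v`. -/
def dnIm (k : ℝ) (z : ℂ) : ℝ := dn (compl k) (4 * ellK k * z.im)

/-- The denominator of `zetaFun`. -/
def zetaDen (k : ℝ) (z : ℂ) : ℂ := 1 + cnRe k z * cnIm k z

/-- The coordinate `ζ` of the curve as a function of `z = ∫ v`, expressed by Jacobi functions of
real arguments; by the addition theorem it is an elliptic function of `z`. -/
def zetaFun (k : ℝ) (z : ℂ) : ℂ :=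
  (I * snRe k z * dnIm k z - snIm k z * dnRe k z) / zetaDen k z

/-- The derivative of `zetaFun`. -/
def zetaFunDeriv (k : ℝ) (z : ℂ) : ℂ :=
  4 * ellK k * (I * dnRe k z * dnIm k z * (cnRe k z + cnIm k z)
    + snRe k z * snIm k z * (k ^ 2 * cnRe k z - compl k ^ 2 * cnIm k z)) / zetaDen k z ^ 2

section

variable {k : ℝ}

lemma snRe_sq (z : ℂ) : (snRe k z : ℂ) ^ 2 = 1 - cnRe k z ^ 2 := mod_cast sn_sq _

lemma snIm_sq (z : ℂ) : (snIm k z : ℂ) ^ 2 = 1 - cnIm k z ^ 2 := mod_cast sn_sq _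

lemma four_mul_ellK_mul_re_add_half (z : ℂ) :
    4 * ellK k * (z + 1 / 2).re = 4 * ellK k * z.re + 2 * ellK k := by
  have : (1 / 2 : ℂ).re = 1 / 2 := by norm_num
  rw [add_re, this]; ring

lemma im_add_half (z : ℂ) : (z + 1 / 2).im = z.im := by simp

lemma snIm_add_half (z : ℂ) : snIm k (z + 1 / 2) = snIm k z := by rw [snIm, im_add_half, snIm]

lemma cnIm_add_half (z : ℂ) : cnIm k (z + 1 / 2) = cnIm k z := by rw [cnIm, im_add_half, cnIm]

lemma dnIm_add_half (z : ℂ) : dnIm k (z + 1 / 2) = dnIm k z := by rw [dnIm, im_add_half, dnIm]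

variable [Fact (|k| < 1)]

lemma ofReal_compl_sq : (compl k : ℂ) ^ 2 = 1 - k ^ 2 := mod_cast compl_sq

lemma dnRe_sq (z : ℂ) : (dnRe k z : ℂ) ^ 2 = 1 - k ^ 2 * snRe k z ^ 2 := mod_cast dn_sq _

lemma snRe_add_half (z : ℂ) : snRe k (z + 1 / 2) = -snRe k z := by
  rw [snRe, four_mul_ellK_mul_re_add_half, sn_add, snRe]

lemma cnRe_add_half (z : ℂ) : cnRe k (z + 1 / 2) = -cnRe k z := by
  rw [cnRe, four_mul_ellK_mul_re_add_half, cn_add, cnRe]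

lemma dnRe_add_half (z : ℂ) : dnRe k (z + 1 / 2) = dnRe k z := by
  rw [dnRe, four_mul_ellK_mul_re_add_half, dn_add, dnRe]

lemma zetaDen_add_half (z : ℂ) : zetaDen k (z + 1 / 2) = 1 - cnRe k z * cnIm k z := by
  rw [zetaDen, cnRe_add_half, cnIm_add_half]; push_cast; ring

lemma zetaFun_add_half (z : ℂ) : zetaFun k (z + 1 / 2) =
    (-(I * snRe k z * dnIm k z) - snIm k z * dnRe k z) / (1 - cnRe k z * cnIm k z) := by
  rw [zetaFun, zetaDen_add_half, snRe_add_half, dnIm_add_half, snIm_add_half, dnRe_add_half]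
  push_cast; ring

lemma zetaDen_add_half_ne_zero {z : ℂ} (hz : zetaDen k z = 0) : zetaDen k (z + 1 / 2) ≠ 0 := by
  have : zetaDen k z + zetaDen k (z + 1 / 2) = 2 := by rw [zetaDen_add_half, zetaDen]; ring
  rw [hz, zero_add] at this
  rw [this]
  exact two_ne_zero

lemma four_mul_ellK_mul_im_add_half_tau (z : ℂ) :
    4 * ellK k * (z + tau k / 2).im = 4 * ellK k * z.im + 2 * ellK (compl k) := by
  rw [add_im, ← ellK_mul_tau_im, div_ofNat_im]; ring

lemma zetaFun_add_one (z : ℂ) : zetaFun k (z + 1) = zetaFun k z := by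
  rw [show z + 1 = z + 1 / 2 + 1 / 2 by ring, zetaFun_add_half, zetaFun, zetaDen, snRe_add_half,
    cnRe_add_half, dnRe_add_half, snIm_add_half, cnIm_add_half, dnIm_add_half]
  push_cast; ring_nf

variable [NeZero k]

lemma dnIm_sq (z : ℂ) : (dnIm k z : ℂ) ^ 2 = 1 - compl k ^ 2 * snIm k z ^ 2 := mod_cast dn_sq _

lemma zetaDen_add_half_tau (z : ℂ) : zetaDen k (z + tau k / 2) = zetaDen k (z + 1 / 2) := by
  have hre : (z + tau k / 2).re = z.re := by simp [tau_re]
  rw [zetaDen, zetaDen_add_half, cnRe, hre, cnIm, four_mul_ellK_mul_im_add_half_tau, cn_add]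
  push_cast [cnRe, cnIm]; ring

lemma zetaFun_add_half_tau (z : ℂ) : zetaFun k (z + tau k / 2) = -zetaFun k (z + 1 / 2) := by
  have hre : (z + tau k / 2).re = z.re := by simp [tau_re]
  rw [zetaFun, zetaDen_add_half_tau, zetaDen_add_half, zetaFun_add_half, snRe, dnRe, hre, dnIm,
    snIm, four_mul_ellK_mul_im_add_half_tau, sn_add, dn_add, ← neg_div]
  push_cast [snRe, dnRe, snIm, dnIm]; ring

lemma zetaFun_add_tau (z : ℂ) : zetaFun k (z + tau k) = zetaFun k z := by
  rw [show z + tau k = z + tau k / 2 + tau k / 2 by ring, zetaFun_add_half_tau,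
    show z + tau k / 2 + 1 / 2 = z + 1 / 2 + tau k / 2 by ring, zetaFun_add_half_tau, neg_neg,
    show z + 1 / 2 + 1 / 2 = z + 1 by ring, zetaFun_add_one]

lemma zetaFun_mul_zetaFun_add_half {z : ℂ} (hz : zetaDen k z ≠ 0)
    (hz' : zetaDen k (z + 1 / 2) ≠ 0) : zetaFun k z * zetaFun k (z + 1 / 2) = 1 := by
  have hD₁ := dnIm_sq (k := k) z
  rw [ofReal_compl_sq, snIm_sq] at hD₁
  have hD := dnRe_sq (k := k) z
  rw [snRe_sq] at hD
  rw [zetaDen_add_half] at hz'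
  rw [zetaFun_add_half, zetaFun, div_mul_div_comm, div_eq_one_iff_eq (mul_ne_zero hz hz'), zetaDen]
  linear_combination (norm := ring_nf) (-(snRe k z : ℂ) ^ 2 * dnIm k z ^ 2) * I_sq +
    (dnIm k z : ℂ) ^ 2 * snRe_sq z + (dnRe k z : ℂ) ^ 2 * snIm_sq z +
    (1 - (cnRe k z : ℂ) ^ 2) * hD₁ + (1 - (cnIm k z : ℂ) ^ 2) * hD

end

section

variable {k : ℝ} [Fact (|k| < 1)] [NeZero k]

omit [NeZero k] in
lemma differentiable_snRe : Differentiable ℝ (snRe k) :=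
  .comp (fun u ↦ (hasDerivAt_sn u).differentiableAt) (reCLM.differentiable.const_mul _)

omit [NeZero k] in
lemma differentiable_cnRe : Differentiable ℝ (cnRe k) :=
  .comp (fun u ↦ (hasDerivAt_cn u).differentiableAt) (reCLM.differentiable.const_mul _)

omit [NeZero k] in
lemma differentiable_dnRe : Differentiable ℝ (dnRe k) :=
  .comp (fun u ↦ (hasDerivAt_dn u).differentiableAt) (reCLM.differentiable.const_mul _)

lemma differentiable_snIm : Differentiable ℝ (snIm k) :=
  .comp (fun u ↦ (hasDerivAt_sn u).differentiableAt) (imCLM.differentiable.const_mul _)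

lemma differentiable_cnIm : Differentiable ℝ (cnIm k) :=
  .comp (fun u ↦ (hasDerivAt_cn u).differentiableAt) (imCLM.differentiable.const_mul _)

lemma differentiable_dnIm : Differentiable ℝ (dnIm k) :=
  .comp (fun u ↦ (hasDerivAt_dn u).differentiableAt) (imCLM.differentiable.const_mul _)

lemma differentiable_zetaDen : Differentiable ℝ (zetaDen k) :=
  ((ofRealCLM.differentiable.comp differentiable_cnRe).mul
    (ofRealCLM.differentiable.comp differentiable_cnIm)).const_add 1

lemma differentiableAt_real_zetaFun {z : ℂ} (hz : zetaDen k z ≠ 0) :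
    DifferentiableAt ℝ (zetaFun k) z := by
  have hnum : Differentiable ℝ fun z ↦ I * snRe k z * dnIm k z - snIm k z * dnRe k z :=
    (((ofRealCLM.differentiable.comp differentiable_snRe).const_mul I).mul
      (ofRealCLM.differentiable.comp differentiable_dnIm)).sub
      ((ofRealCLM.differentiable.comp differentiable_snIm).mul
        (ofRealCLM.differentiable.comp differentiable_dnRe))
  exact (hnum z).mul ((differentiable_zetaDen z).inv hz)

omit [NeZero k] in
lemma hasDerivAt_zetaFun_add_ofReal {z : ℂ} (hz : zetaDen k z ≠ 0) :
    HasDerivAt (fun t : ℝ ↦ zetaFun k (z + t)) (zetaFunDeriv k z) 0 := by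
  have hS := hasDerivAt_ofReal_comp_add (4 * ellK k) z.re (hasDerivAt_sn (k := k) _)
  have hC := hasDerivAt_ofReal_comp_add (4 * ellK k) z.re (hasDerivAt_cn (k := k) _)
  have hD := hasDerivAt_ofReal_comp_add (4 * ellK k) z.re (hasDerivAt_dn (k := k) _)
  have hquot := (((hS.const_mul I).mul_const (dnIm k z : ℂ)).sub
    (hD.const_mul (snIm k z : ℂ))).div ((hC.mul_const (cnIm k z : ℂ)).const_add 1)
    (by simpa [zetaDen, cnRe] using hz)
  have hline : (fun t : ℝ ↦ zetaFun k (z + t)) = _ := _root_.funext fun t ↦ by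
    simp only [zetaFun, zetaDen, snRe, cnRe, dnRe, snIm, cnIm, dnIm, add_re, add_im, ofReal_re,
      ofReal_im, add_zero]
    rfl
  rw [hline]
  refine hquot.congr_deriv ?_
  simp only [zetaFunDeriv, zetaDen, add_zero, Pi.sub_apply]
  rw [show sn k _ = snRe k z from rfl, show cn k _ = cnRe k z from rfl,
    show dn k _ = dnRe k z from rfl]
  push_cast
  congr 1
  linear_combination 4 * ellK k * (I * dnRe k z * dnIm k z * cnIm k z * snRe_sq z +
    snRe k z * snIm k z * cnIm k z *
      (-dnRe_sq (k := k) z + k ^ 2 * snRe_sq z + ofReal_compl_sq (k := k)))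

lemma hasDerivAt_zetaFun_add_ofReal_mul_I {z : ℂ} (hz : zetaDen k z ≠ 0) :
    HasDerivAt (fun t : ℝ ↦ zetaFun k (z + t * I)) (I * zetaFunDeriv k z) 0 := by
  have hS := hasDerivAt_ofReal_comp_add (4 * ellK k) z.im (hasDerivAt_sn (k := compl k) _)
  have hC := hasDerivAt_ofReal_comp_add (4 * ellK k) z.im (hasDerivAt_cn (k := compl k) _)
  have hD := hasDerivAt_ofReal_comp_add (4 * ellK k) z.im (hasDerivAt_dn (k := compl k) _)
  have hquot := ((hD.const_mul (I * (snRe k z : ℂ))).sub (hS.mul_const (dnRe k z : ℂ))).div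
    ((hC.const_mul (cnRe k z : ℂ)).const_add 1) (by simpa [zetaDen, cnIm] using hz)
  have hline : (fun t : ℝ ↦ zetaFun k (z + t * I)) = _ := _root_.funext fun t ↦ by
    simp only [zetaFun, zetaDen, snRe, cnRe, dnRe, snIm, cnIm, dnIm, add_re, add_im,
      re_ofReal_mul, im_ofReal_mul, I_re, I_im, mul_zero, mul_one, add_zero]
    rfl
  rw [hline]
  refine hquot.congr_deriv ?_
  simp only [zetaFunDeriv, zetaDen, add_zero, Pi.sub_apply]
  rw [show sn (compl k) _ = snIm k z from rfl, show cn (compl k) _ = cnIm k z from rfl,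
    show dn (compl k) _ = dnIm k z from rfl]
  push_cast
  rw [← mul_div_assoc]
  congr 1
  linear_combination 4 * ellK k * (-dnRe k z * dnIm k z * cnRe k z * snIm_sq z +
    I * snRe k z * snIm k z * cnRe k z *
      (dnIm_sq (k := k) z - compl k ^ 2 * snIm_sq z - ofReal_compl_sq (k := k))) -
    4 * ellK k * dnRe k z * dnIm k z * (cnRe k z + cnIm k z) * I_sq

lemma hasDerivAt_zetaFun {z : ℂ} (hz : zetaDen k z ≠ 0) :
    HasDerivAt (zetaFun k) (zetaFunDeriv k z) z :=
  hasDerivAt_of_partial (differentiableAt_real_zetaFun hz) (hasDerivAt_zetaFun_add_ofReal hz)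
    (hasDerivAt_zetaFun_add_ofReal_mul_I hz)

lemma four_mul_zetaNum_sq (z : ℂ) :
    4 * (I * dnRe k z * dnIm k z * (cnRe k z + cnIm k z)
      + snRe k z * snIm k z * (k ^ 2 * cnRe k z - compl k ^ 2 * cnIm k z)) ^ 2 =
    -((I * snRe k z * dnIm k z - snIm k z * dnRe k z) ^ 4 + 2 * (k ^ 2 - compl k ^ 2) *
      (I * snRe k z * dnIm k z - snIm k z * dnRe k z) ^ 2 * zetaDen k z ^ 2 + zetaDen k z ^ 4) := by
  have hS := snRe_sq (k := k) z
  have hS₁ := snIm_sq (k := k) z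
  have hD := dnRe_sq (k := k) z
  have hD₁ := dnIm_sq (k := k) z
  rw [hS] at hD
  rw [hS₁, ofReal_compl_sq] at hD₁
  rw [ofReal_compl_sq, zetaDen]
  generalize (snRe k z : ℂ) = S, (cnRe k z : ℂ) = C, (dnRe k z : ℂ) = D,
    (snIm k z : ℂ) = S₁, (cnIm k z : ℂ) = C₁, (dnIm k z : ℂ) = D₁ at *
  have hnum : (I * S * D₁ - S₁ * D) ^ 2 = -(1 - C ^ 2) * (1 - (1 - k ^ 2) * (1 - C₁ ^ 2)) +
      (1 - C₁ ^ 2) * (1 - k ^ 2 * (1 - C ^ 2)) - 2 * I * (S * S₁ * D * D₁) := by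
    rw [← hD, ← hD₁, ← hS, ← hS₁]; linear_combination (S ^ 2 * D₁ ^ 2) * I_sq
  have hprod : (S * S₁ * D * D₁) ^ 2 = (1 - C ^ 2) * (1 - C₁ ^ 2) * (1 - k ^ 2 * (1 - C ^ 2)) *
      (1 - (1 - k ^ 2) * (1 - C₁ ^ 2)) := by
    rw [← hD, ← hD₁, ← hS, ← hS₁]; ring
  have hderiv : (I * D * D₁ * (C + C₁) + S * S₁ * (k ^ 2 * C - (1 - k ^ 2) * C₁)) ^ 2 =
      -(1 - k ^ 2 * (1 - C ^ 2)) * (1 - (1 - k ^ 2) * (1 - C₁ ^ 2)) * (C + C₁) ^ 2 +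
      (1 - C ^ 2) * (1 - C₁ ^ 2) * (k ^ 2 * C - (1 - k ^ 2) * C₁) ^ 2 +
      2 * I * (S * S₁ * D * D₁) * (C + C₁) * (k ^ 2 * C - (1 - k ^ 2) * C₁) := by
    rw [← hD, ← hD₁, ← hS, ← hS₁]; linear_combination (D ^ 2 * D₁ ^ 2 * (C + C₁) ^ 2) * I_sq
  rw [hderiv, show (I * S * D₁ - S₁ * D) ^ 4 = ((I * S * D₁ - S₁ * D) ^ 2) ^ 2 by ring, hnum]
  linear_combination (4 * (S * S₁ * D * D₁) ^ 2) * I_sq - 4 * hprod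

lemma zetaFunDeriv_sq {z : ℂ} (hz : zetaDen k z ≠ 0) :
    zetaFunDeriv k z ^ 2 = -4 * ellK k ^ 2 *
      (zetaFun k z ^ 4 + 2 * (k ^ 2 - compl k ^ 2) * zetaFun k z ^ 2 + 1) := by
  rw [zetaFunDeriv, zetaFun]
  field_simp
  linear_combination (ellK k : ℂ) ^ 2 * four_mul_zetaNum_sq (k := k) z

end

/-! ### The coordinate `ζ` as a quotient of theta functions -/

/-- The denominator of `ζ` as a theta function. -/
def thetaA (k : ℝ) (z : ℂ) : ℂ := theta (tau k) (z - 1 / 2) * theta (tau k) (z - tau k / 2)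

/-- The numerator of `ζ` as a theta function, up to a constant factor. -/
def thetaNum (k : ℝ) (z : ℂ) : ℂ := theta (tau k) z * theta (tau k) (z - (1 + tau k) / 2)

/-- The factor of automorphy of `thetaA` and `thetaNum` for the period `τ`. -/
def thetaFactor (k : ℝ) (z : ℂ) : ℂ := -expTwoPi (tau k / 2 - 2 * z)

section

variable {k : ℝ}

lemma thetaFactor_ne_zero (z : ℂ) : thetaFactor k z ≠ 0 := neg_ne_zero.2 (expTwoPi_ne_zero _)

lemma thetaFactor_add_half (z : ℂ) : thetaFactor k (z + 1 / 2) = thetaFactor k z := by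
  rw [thetaFactor, thetaFactor, show tau k / 2 - 2 * z = tau k / 2 - 2 * (z + 1 / 2) + 1 by ring,
    expTwoPi_add _ 1, expTwoPi_one, mul_one]

lemma thetaA_add_half (z : ℂ) : thetaA k (z + 1 / 2) = thetaNum k z := by
  have h : theta (tau k) (z + 1 / 2 - tau k / 2) = theta (tau k) (z - (1 + tau k) / 2) := by
    rw [← theta_add_one _ (z - (1 + tau k) / 2)]; ring_nf
  rw [thetaA, thetaNum, h, add_sub_cancel_right]

lemma thetaA_add_one (z : ℂ) : thetaA k (z + 1) = thetaA k z := by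
  rw [thetaA, thetaA, add_sub_right_comm, theta_add_one, add_sub_right_comm, theta_add_one]

lemma thetaNum_add_half (z : ℂ) : thetaNum k (z + 1 / 2) = thetaA k z := by
  rw [← thetaA_add_half, ← thetaA_add_one z]; ring_nf

lemma thetaNum_add_one (z : ℂ) : thetaNum k (z + 1) = thetaNum k z := by
  rw [← thetaA_add_half, ← thetaA_add_half, add_right_comm, thetaA_add_one]

variable [Fact (|k| < 1)] [NeZero k]

@[fun_prop]
lemma differentiable_thetaA : Differentiable ℂ (thetaA k) := by unfold thetaA; fun_prop

@[fun_prop]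
lemma differentiable_thetaNum : Differentiable ℂ (thetaNum k) := by unfold thetaNum; fun_prop

lemma thetaA_add_tau (z : ℂ) : thetaA k (z + tau k) = thetaFactor k z * thetaA k z := by
  have h : expTwoPi (-(z - 1 / 2)) * expTwoPi (-(z - tau k / 2)) = thetaFactor k z := by
    rw [← expTwoPi_add, show -(z - 1 / 2) + -(z - tau k / 2) = 1 / 2 + (tau k / 2 - 2 * z) by ring,
      expTwoPi_add, expTwoPi_half, neg_one_mul, thetaFactor]
  rw [thetaA, thetaA, add_sub_right_comm, theta_add_tau, add_sub_right_comm, theta_add_tau, ← h]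
  ring

lemma thetaNum_add_tau (z : ℂ) : thetaNum k (z + tau k) = thetaFactor k z * thetaNum k z := by
  rw [← thetaA_add_half, ← thetaA_add_half, add_right_comm, thetaA_add_tau, thetaFactor_add_half]

lemma half_sub_half_tau_notMem_periodLattice : (1 / 2 - tau k / 2) ∉ periodLattice (tau k) := by
  have h : (1 / 2 - tau k / 2) = ((-1 / 2 : ℝ) : ℂ) * tau k + ((1 / 2 : ℝ) : ℂ) := by
    push_cast; ring
  rw [h, mem_periodLattice_iff_of_real]
  exact fun ⟨_, n, hn⟩ ↦ half_ne_intCast n hn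

lemma theta_sub_half_tau_ne_zero {z : ℂ} (hz : theta (tau k) (z - 1 / 2) = 0) :
    theta (tau k) (z - tau k / 2) ≠ 0 := fun h ↦ by
  have := sub_mem (theta_eq_zero_iff.1 h) (theta_eq_zero_iff.1 hz)
  rw [sub_sub_sub_cancel_left] at this
  exact half_sub_half_tau_notMem_periodLattice this

lemma deriv_thetaA_ne_zero {z : ℂ} (hz : thetaA k z = 0) : deriv (thetaA k) z ≠ 0 := by
  have hshift (a : ℂ) : HasDerivAt (fun w ↦ theta (tau k) (w - a))
      (deriv (theta (tau k)) (z - a)) z :=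
    (differentiable_theta (tau k)).differentiableAt.hasDerivAt.comp_sub_const z a
  have h : HasDerivAt (thetaA k) _ z := (hshift (1 / 2)).mul (hshift (tau k / 2))
  rw [h.deriv]
  rcases mul_eq_zero.1 hz with h₁ | h₂
  · rw [h₁, zero_mul, add_zero]
    exact mul_ne_zero (deriv_theta_ne_zero (theta_eq_zero_iff.1 h₁))
      (theta_sub_half_tau_ne_zero h₁)
  · rw [h₂, mul_zero, zero_add]
    exact mul_ne_zero (fun h₁ ↦ theta_sub_half_tau_ne_zero h₁ h₂)
      (deriv_theta_ne_zero (theta_eq_zero_iff.1 h₂))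

lemma deriv_thetaNum_ne_zero {z : ℂ} (hz : thetaNum k z = 0) : deriv (thetaNum k) z ≠ 0 := by
  rw [← thetaA_add_half] at hz
  rw [← _root_.funext thetaA_add_half, deriv_comp_add_const]
  exact deriv_thetaA_ne_zero hz

lemma exists_half_period {z : ℂ} (h : snRe k z = 0) (h' : snIm k z = 0) :
    ∃ m n : ℤ, z = (m * tau k + n) / 2 := by
  obtain ⟨n, hn⟩ := sn_eq_zero_iff.1 h
  obtain ⟨m, hm⟩ := sn_eq_zero_iff.1 h'
  have hK := ellK_pos k
  rw [← ellK_mul_tau_im] at hm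
  refine ⟨m, n, Complex.ext ?_ ?_⟩
  · have : z.re = n / 2 := mul_left_cancel₀ hK.ne' (by linarith)
    simp [this, tau_re]
  · have : z.im = m * (tau k).im / 2 := mul_left_cancel₀ hK.ne' (by linarith)
    simp [this]

lemma zetaDen_half_period (m n : ℤ) : zetaDen k ((m * tau k + n) / 2) = 1 + (-1) ^ (n + m) := by
  have hre : 4 * ellK k * ((m * tau k + n) / 2).re = n * (2 * ellK k) := by
    simp [tau_re]; ring
  have him : 4 * ellK k * ((m * tau k + n) / 2).im = m * (2 * ellK (compl k)) := by
    rw [← ellK_mul_tau_im]; simp; ring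
  rw [zetaDen, cnRe, hre, cnIm, him, cn_int_mul, cn_int_mul, zpow_add₀ (by norm_num)]
  push_cast; rfl

lemma zetaDen_half_period_eq_zero_iff (m n : ℤ) :
    zetaDen k ((m * tau k + n) / 2) = 0 ↔ Odd (n + m) := by
  rw [zetaDen_half_period]
  rcases Int.even_or_odd (n + m) with h | h
  · simp only [h.neg_one_zpow, ← Int.not_even_iff_odd, h, not_true_eq_false, iff_false]
    norm_num
  · simp [h.neg_one_zpow, h]

omit [NeZero k] in
lemma zetaDen_mul_zetaDen_add_half (z : ℂ) :
    zetaDen k z * zetaDen k (z + 1 / 2) = (1 - cnRe k z ^ 2 * cnIm k z ^ 2 : ℝ) := by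
  rw [zetaDen_add_half, zetaDen]
  push_cast
  ring

omit [NeZero k] in
lemma snRe_eq_zero_and_snIm_eq_zero_iff {z : ℂ} :
    snRe k z = 0 ∧ snIm k z = 0 ↔ zetaDen k z = 0 ∨ zetaDen k (z + 1 / 2) = 0 := by
  have h : snRe k z ^ 2 = 1 - cnRe k z ^ 2 := sn_sq _
  have h' : snIm k z ^ 2 = 1 - cnIm k z ^ 2 := sn_sq _
  rw [← mul_eq_zero, zetaDen_mul_zetaDen_add_half, ofReal_eq_zero,
    ← sq_eq_zero_iff (a := snRe k z), ← sq_eq_zero_iff (a := snIm k z), h, h']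
  have hc : cnRe k z ^ 2 ≤ 1 := by linarith [sq_nonneg (snRe k z)]
  have hc' : cnIm k z ^ 2 ≤ 1 := by linarith [sq_nonneg (snIm k z)]
  constructor
  · rintro ⟨h₁, h₂⟩
    rw [← sub_eq_zero.1 h₁, ← sub_eq_zero.1 h₂, one_mul, sub_self]
  · intro h₀
    constructor <;> nlinarith [hc, hc', sq_nonneg (cnRe k z), sq_nonneg (cnIm k z)]

lemma thetaA_eq_zero_iff {z : ℂ} : thetaA k z = 0 ↔ zetaDen k z = 0 := by
  rw [thetaA, mul_eq_zero, theta_eq_zero_iff, theta_eq_zero_iff, mem_periodLattice,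
    mem_periodLattice]
  constructor
  · rintro (⟨m, n, h⟩ | ⟨m, n, h⟩)
    · rw [show z = ((2 * m : ℤ) * tau k + (2 * n + 1 : ℤ)) / 2 by
        push_cast; linear_combination h, zetaDen_half_period_eq_zero_iff]
      exact ⟨n + m, by ring⟩
    · rw [show z = ((2 * m + 1 : ℤ) * tau k + (2 * n : ℤ)) / 2 by
        push_cast; linear_combination h, zetaDen_half_period_eq_zero_iff]
      exact ⟨n + m, by ring⟩
  · intro hz
    obtain ⟨hs, hs'⟩ := snRe_eq_zero_and_snIm_eq_zero_iff.2 (.inl hz)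
    obtain ⟨m, n, rfl⟩ := exists_half_period hs hs'
    have hodd := (zetaDen_half_period_eq_zero_iff m n).1 hz
    rcases Int.even_or_odd' m with ⟨a, rfl | rfl⟩
    · obtain ⟨b, hb⟩ := hodd
      obtain rfl : n = 2 * (b - a) + 1 := by linarith
      exact .inl ⟨a, b - a, by push_cast; ring⟩
    · obtain ⟨b, hb⟩ := hodd
      obtain rfl : n = 2 * (b - a) := by linarith
      exact .inr ⟨a, b - a, by push_cast; ring⟩

lemma thetaNum_eq_zero_iff {z : ℂ} : thetaNum k z = 0 ↔ zetaDen k (z + 1 / 2) = 0 := by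
  rw [← thetaA_add_half, thetaA_eq_zero_iff]

omit [Fact (|k| < 1)] [NeZero k] in
lemma zetaFun_eq_zero {z : ℂ} (hs : snRe k z = 0) (hs' : snIm k z = 0) : zetaFun k z = 0 := by
  simp [zetaFun, hs, hs']

lemma zetaFun_eq_zero_of_thetaNum {z : ℂ} (hz : thetaNum k z = 0) : zetaFun k z = 0 :=
  have h := snRe_eq_zero_and_snIm_eq_zero_iff.2 (.inr (thetaNum_eq_zero_iff.1 hz))
  zetaFun_eq_zero h.1 h.2

lemma zetaFun_add_half_eq_zero {z : ℂ} (hz : zetaDen k z = 0) : zetaFun k (z + 1 / 2) = 0 :=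
  zetaFun_eq_zero_of_thetaNum (by rwa [thetaNum_add_half, thetaA_eq_zero_iff])

lemma snRe_eq_zero_and_snIm_eq_zero {z : ℂ} (hz : zetaDen k z ≠ 0) (h : zetaFun k z = 0) :
    snRe k z = 0 ∧ snIm k z = 0 := by
  have hd : dnRe k z ≠ 0 := (dn_pos _).ne'
  have hd' : dnIm k z ≠ 0 := (dn_pos _).ne'
  rw [zetaFun, div_eq_zero_iff, or_iff_left hz] at h
  have hre := congrArg Complex.re h
  have him := congrArg Complex.im h
  simp only [sub_re, mul_re, I_re, ofReal_re, zero_mul, I_im, ofReal_im, mul_zero, sub_self, mul_im,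
    one_mul, zero_add, sub_zero, zero_sub, zero_re, neg_eq_zero, mul_eq_zero, hd, or_false, sub_im,
    add_zero, zero_im, hd'] at hre him
  exact ⟨him, hre⟩

lemma thetaNum_eq_zero_of_zetaFun {z : ℂ} (hz : zetaDen k z ≠ 0) (h : zetaFun k z = 0) :
    thetaNum k z = 0 :=
  thetaNum_eq_zero_iff.2 <| (snRe_eq_zero_and_snIm_eq_zero_iff.1
    (snRe_eq_zero_and_snIm_eq_zero hz h)).resolve_left hz

lemma eventually_zetaDen_ne_zero {z : ℂ} (hz : zetaDen k z ≠ 0) :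
    ∀ᶠ w in 𝓝 z, zetaDen k w ≠ 0 :=
  differentiable_zetaDen.continuous.continuousAt.eventually_ne hz

lemma analyticAt_zetaFun {z : ℂ} (hz : zetaDen k z ≠ 0) : AnalyticAt ℂ (zetaFun k) z :=
  analyticAt_iff_eventually_differentiableAt.2 <| (eventually_zetaDen_ne_zero hz).mono
    fun _ hw ↦ (hasDerivAt_zetaFun hw).differentiableAt

lemma zetaFunDeriv_ne_zero {z : ℂ} (hz : zetaDen k z ≠ 0) (h : zetaFun k z = 0) :
    zetaFunDeriv k z ≠ 0 := by
  have hK : (ellK k : ℂ) ≠ 0 := ofReal_ne_zero.2 (ellK_pos k).ne'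
  rw [← sq_eq_zero_iff.ne, zetaFunDeriv_sq hz, h]
  simp [hK]

/-- The quotient of `ζ` by the corresponding quotient of theta functions. -/
def zetaRatio (k : ℝ) (z : ℂ) : ℂ := zetaFun k z * thetaA k z / thetaNum k z

omit [NeZero k] in
lemma zetaRatio_add_one (z : ℂ) : zetaRatio k (z + 1) = zetaRatio k z := by
  rw [zetaRatio, zetaFun_add_one, thetaA_add_one, thetaNum_add_one, zetaRatio]

lemma zetaRatio_add_tau (z : ℂ) : zetaRatio k (z + tau k) = zetaRatio k z := by
  rw [zetaRatio, zetaFun_add_tau, thetaA_add_tau, thetaNum_add_tau, mul_left_comm,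
    mul_div_mul_left _ _ (thetaFactor_ne_zero z), zetaRatio]

lemma meromorphicAt_zetaRatio_of_ne_zero {z : ℂ} (hz : zetaDen k z ≠ 0) :
    MeromorphicAt (zetaRatio k) z :=
  ((analyticAt_zetaFun hz).mul (differentiable_thetaA.analyticAt z)).meromorphicAt.div
    (differentiable_thetaNum.analyticAt z).meromorphicAt

lemma meromorphicOrderAt_zetaRatio_of_ne_zero {z : ℂ} (hz : zetaDen k z ≠ 0) :
    meromorphicOrderAt (zetaRatio k) z = 0 := by
  have hζ := analyticAt_zetaFun hz
  have hA := (differentiable_thetaA (k := k)).analyticAt z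
  have hN := (differentiable_thetaNum (k := k)).analyticAt z
  have hdiv : meromorphicOrderAt (zetaRatio k) z =
      meromorphicOrderAt (zetaFun k * thetaA k) z - meromorphicOrderAt (thetaNum k) z :=
    meromorphicOrderAt_div (hζ.mul hA).meromorphicAt hN.meromorphicAt
  rw [hdiv, meromorphicOrderAt_mul hζ.meromorphicAt hA.meromorphicAt, hζ.meromorphicOrderAt_eq,
    hA.meromorphicOrderAt_eq, hN.meromorphicOrderAt_eq,
    hA.analyticOrderAt_eq_zero.2 (mt thetaA_eq_zero_iff.1 hz)]
  by_cases h : zetaFun k z = 0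
  · have hN₀ := thetaNum_eq_zero_of_zetaFun hz h
    rw [hN.analyticOrderAt_eq_one_of_zero_deriv_ne_zero hN₀ (deriv_thetaNum_ne_zero hN₀),
      hζ.analyticOrderAt_eq_one_of_zero_deriv_ne_zero h
        ((hasDerivAt_zetaFun hz).deriv ▸ zetaFunDeriv_ne_zero hz h)]
    rfl
  · rw [hζ.analyticOrderAt_eq_zero.2 h,
      hN.analyticOrderAt_eq_zero.2 (mt zetaFun_eq_zero_of_thetaNum h)]
    rfl

lemma zetaRatio_mul_zetaRatio_add_half {z : ℂ} (hz : zetaDen k z ≠ 0)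
    (hz' : zetaDen k (z + 1 / 2) ≠ 0) : zetaRatio k z * zetaRatio k (z + 1 / 2) = 1 := by
  have hA : thetaA k z ≠ 0 := mt thetaA_eq_zero_iff.1 hz
  have hN : thetaNum k z ≠ 0 := mt thetaNum_eq_zero_iff.1 hz'
  rw [zetaRatio, zetaRatio, thetaA_add_half, thetaNum_add_half]
  rw [div_mul_div_comm, div_eq_one_iff_eq (mul_ne_zero hN hA)]
  linear_combination thetaA k z * thetaNum k z * zetaFun_mul_zetaFun_add_half hz hz'

lemma eventually_zetaRatio_eq_inv {z : ℂ} (hz : zetaDen k z = 0) :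
    zetaRatio k =ᶠ[𝓝[≠] z] fun w ↦ (zetaRatio k (w + 1 / 2))⁻¹ := by
  have hz' := zetaDen_add_half_ne_zero hz
  have hne := (hasDerivAt_zetaFun hz').eventually_ne (c := 0)
    (zetaFunDeriv_ne_zero hz' (zetaFun_add_half_eq_zero hz))
  have hD := (eventually_zetaDen_ne_zero hz').filter_mono (nhdsWithin_le_nhds (s := {z + 1 / 2}ᶜ))
  have hshift := tendsto_add_const_nhdsNE z (1 / 2)
  filter_upwards [hshift.eventually hne, hshift.eventually hD] with w hw hw'
  exact eq_inv_of_mul_eq_one_left <|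
    zetaRatio_mul_zetaRatio_add_half (mt zetaFun_add_half_eq_zero hw) hw'

lemma meromorphicAt_zetaRatio (z : ℂ) : MeromorphicAt (zetaRatio k) z := by
  by_cases hz : zetaDen k z = 0
  · have h := meromorphicAt_zetaRatio_of_ne_zero (zetaDen_add_half_ne_zero hz)
    exact (h.comp_analyticAt (f := zetaRatio k) (g := (· + 1 / 2)) (by fun_prop)).inv.congr
      (eventually_zetaRatio_eq_inv hz).symm
  · exact meromorphicAt_zetaRatio_of_ne_zero hz

lemma meromorphicOrderAt_zetaRatio (z : ℂ) : meromorphicOrderAt (zetaRatio k) z = 0 := by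
  by_cases hz : zetaDen k z = 0
  · have h : meromorphicOrderAt (zetaRatio k ∘ (· + 1 / 2)) z = 0 := by
      rw [meromorphicOrderAt_comp_add_const_eq_meromorphicOrderAt,
        meromorphicOrderAt_zetaRatio_of_ne_zero (zetaDen_add_half_ne_zero hz)]
    rw [meromorphicOrderAt_congr (eventually_zetaRatio_eq_inv hz)]
    exact meromorphicOrderAt_inv.trans (by rw [← neg_zero, ← h]; rfl)
  · exact meromorphicOrderAt_zetaRatio_of_ne_zero hz

lemma exists_zetaFun_mul_thetaA_eq :
    ∃ κ : ℂ, ∀ z, zetaDen k z ≠ 0 → zetaFun k z * thetaA k z = κ * thetaNum k z := by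
  obtain ⟨κ, hκ⟩ := exists_eventuallyEq_const_of_periodic meromorphicAt_zetaRatio
    (fun z ↦ (meromorphicOrderAt_zetaRatio z).ge) zetaRatio_add_one (zetaRatio_add_tau (k := k))
  refine ⟨κ, fun z hz ↦ ?_⟩
  have hA := (differentiable_thetaA (k := k)).continuous.continuousAt (x := z)
  have hN := (differentiable_thetaNum (k := k)).continuous.continuousAt (x := z)
  refine ((((analyticAt_zetaFun hz).continuousAt.mul hA).eventuallyEq_nhds_iff_eventuallyEq_nhdsNE
    (continuousAt_const.mul hN)).1 ?_).eq_of_nhds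
  filter_upwards [hκ z] with w hw
  by_cases hw₀ : thetaNum k w = 0
  · simp [zetaFun_eq_zero_of_thetaNum hw₀, hw₀]
  · exact (div_eq_iff hw₀).1 hw

omit [NeZero k] in
lemma cnRe_quarter : cnRe k (1 / 4) = 0 := by
  have : 4 * ellK k * (1 / 4 : ℂ).re = ellK k := by norm_num; ring
  rw [cnRe, this, cn_ellK]

lemma exists_zetaFun_eq : ∃ κ : ℂ, κ ^ 2 = 1 ∧
    ∀ z, zetaDen k z ≠ 0 → zetaFun k z * thetaA k z = κ * thetaNum k z := by
  obtain ⟨κ, hκ⟩ := exists_zetaFun_mul_thetaA_eq (k := k)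
  refine ⟨κ, ?_, hκ⟩
  have hz : zetaDen k (1 / 4) ≠ 0 := by rw [zetaDen, cnRe_quarter]; simp
  have hz' : zetaDen k (1 / 4 + 1 / 2) ≠ 0 := by
    rw [zetaDen_add_half, cnRe_quarter]; simp
  have hA : thetaA k (1 / 4) ≠ 0 := mt thetaA_eq_zero_iff.1 hz
  have hN : thetaNum k (1 / 4) ≠ 0 := mt thetaNum_eq_zero_iff.1 hz'
  have h := hκ _ hz'
  rw [thetaA_add_half, thetaNum_add_half] at h
  refine mul_right_cancel₀ (mul_ne_zero hA hN) ?_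
  linear_combination thetaA k (1 / 4) * thetaNum k (1 / 4) * zetaFun_mul_zetaFun_add_half hz hz' -
    zetaFun k (1 / 4 + 1 / 2) * thetaNum k (1 / 4) * hκ _ hz - κ * thetaNum k (1 / 4) * h

end

/-! ### Theta functions as coordinates on the curve -/

/-- The coefficient `k² - k'²` of the equation of the curve. -/
def modDiff (k : ℝ) : ℂ := (k : ℂ) ^ 2 - (compl k : ℂ) ^ 2

/-- The binary quartic form `q` in the homogeneous equation `W² + q(Z₀, Z₁) = 0` of the curve. -/
def curveForm (k : ℝ) (X Y : ℂ) : ℂ :=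
  (ellK k : ℂ) ^ 2 / 4 * (Y ^ 4 + 2 * modDiff k * X ^ 2 * Y ^ 2 + X ^ 4)

/-- The partial derivative of `curveForm` in its second variable; as the form is symmetric,
exchanging the arguments gives the other partial derivative. -/
def curvePartial (k : ℝ) (X Y : ℂ) : ℂ :=
  (ellK k : ℂ) ^ 2 * (Y ^ 3 + modDiff k * X ^ 2 * Y)

lemma curveForm_symm (k : ℝ) (X Y : ℂ) : curveForm k X Y = curveForm k Y X := by
  rw [curveForm, curveForm]; ring

lemma curveForm_mul (k : ℝ) (c X Y : ℂ) :
    curveForm k (c * X) (c * Y) = c ^ 4 * curveForm k X Y := by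
  rw [curveForm, curveForm]; ring

lemma curvePartial_mul_add (k : ℝ) (X Y : ℂ) :
    curvePartial k Y X * X + curvePartial k X Y * Y = 4 * curveForm k X Y := by
  rw [curvePartial, curvePartial, curveForm]; ring

lemma hasDerivWithinAt_curveForm {𝕜 : Type*} [NontriviallyNormedField 𝕜] [NormedAlgebra 𝕜 ℂ]
    {k : ℝ} {f g : 𝕜 → ℂ} {f' g' : ℂ} {s : Set 𝕜} {t : 𝕜} (hf : HasDerivWithinAt f f' s t)
    (hg : HasDerivWithinAt g g' s t) :
    HasDerivWithinAt (fun t ↦ curveForm k (f t) (g t))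
      (curvePartial k (g t) (f t) * f' + curvePartial k (f t) (g t) * g') s t := by
  have h := ((hg.fun_pow 4).fun_add (((hf.fun_pow 2).const_mul (2 * modDiff k)).fun_mul
    (hg.fun_pow 2)) |>.fun_add (hf.fun_pow 4)).const_mul ((ellK k : ℂ) ^ 2 / 4)
  refine h.congr_deriv ?_
  rw [curvePartial, curvePartial]
  push_cast
  ring

/-- The Wronskian `f g' - f' g`. -/
def wronskian (f g : ℂ → ℂ) (z : ℂ) : ℂ := f z * deriv g z - deriv f z * g z

lemma wronskian_swap (f g : ℂ → ℂ) (z : ℂ) : wronskian g f z = -wronskian f g z := by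
  rw [wronskian, wronskian]; ring

lemma wronskian_add {f g f₁ g₁ u : ℂ → ℂ} {a c : ℂ} (hf : ∀ z, f (z + a) = u z * f₁ z)
    (hg : ∀ z, g (z + a) = c * (u z * g₁ z)) {z : ℂ} (hu : DifferentiableAt ℂ u z)
    (hf₁ : DifferentiableAt ℂ f₁ z) (hg₁ : DifferentiableAt ℂ g₁ z) :
    wronskian f g (z + a) = c * u z ^ 2 * wronskian f₁ g₁ z := by
  rw [wronskian, wronskian, ← deriv_comp_add_const, ← deriv_comp_add_const, _root_.funext hf,
    _root_.funext hg, hf, hg, deriv_const_mul _ (hu.fun_mul hg₁), deriv_fun_mul hu hf₁,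
    deriv_fun_mul hu hg₁]
  ring

/-- The sign that relates `ζ` to the quotient of `thetaNum` and `thetaA`. -/
def thetaSign (k : ℝ) : ℂ := Classical.epsilon fun κ : ℂ ↦ κ ^ 2 = 1 ∧
    ∀ z, zetaDen k z ≠ 0 → zetaFun k z * thetaA k z = κ * thetaNum k z

/-- The numerator of `ζ` as a theta function. -/
def thetaB (k : ℝ) (z : ℂ) : ℂ := thetaSign k * thetaNum k z

/-- The coordinate `W` of weight two of the curve, as a theta function; since `ζ' = 4 η` for the
parameter `z = ∫ v`, it is a quarter of the Wronskian of the two coordinates of weight one. -/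
def thetaC (k : ℝ) (z : ℂ) : ℂ := wronskian (thetaA k) (thetaB k) z / 4

section

variable {k : ℝ}

lemma thetaB_add_half (z : ℂ) : thetaB k (z + 1 / 2) = thetaSign k * thetaA k z := by
  rw [thetaB, thetaNum_add_half]

lemma thetaB_add_one (z : ℂ) : thetaB k (z + 1) = thetaB k z := by
  rw [thetaB, thetaNum_add_one, thetaB]

/-- The factor of automorphy, up to sign, of the theta functions for the half period
`(1 + τ) / 2`. -/
def halfFactor (k : ℝ) (z : ℂ) : ℂ := -expTwoPi (tau k / 2 - z)

variable [Fact (|k| < 1)] [NeZero k]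

lemma thetaSign_sq : thetaSign k ^ 2 = 1 := (Classical.epsilon_spec exists_zetaFun_eq).1

lemma thetaSign_ne_zero : thetaSign k ≠ 0 := fun h ↦ by simpa [h] using thetaSign_sq (k := k)

lemma zetaFun_mul_thetaA {z : ℂ} (hz : zetaDen k z ≠ 0) : zetaFun k z * thetaA k z = thetaB k z :=
  (Classical.epsilon_spec exists_zetaFun_eq).2 z hz

@[fun_prop]
lemma differentiable_thetaB : Differentiable ℂ (thetaB k) := by unfold thetaB; fun_prop

@[fun_prop]
lemma differentiable_thetaC : Differentiable ℂ (thetaC k) := by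
  unfold thetaC wronskian
  fun_prop

lemma thetaA_add_half_eq (z : ℂ) : thetaA k (z + 1 / 2) = thetaSign k * thetaB k z := by
  rw [thetaA_add_half, thetaB]
  linear_combination -thetaNum k z * thetaSign_sq (k := k)

lemma thetaB_add_tau (z : ℂ) : thetaB k (z + tau k) = thetaFactor k z * thetaB k z := by
  rw [thetaB, thetaNum_add_tau, thetaB, mul_left_comm]

lemma thetaC_add_half (z : ℂ) : thetaC k (z + 1 / 2) = -thetaC k z := by
  have h := wronskian_add (f := thetaA k) (g := thetaB k) (u := fun _ ↦ thetaSign k) (c := 1)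
    (z := z) thetaA_add_half_eq (fun z ↦ by rw [thetaB_add_half, one_mul]) (by fun_prop)
    (by fun_prop) (by fun_prop)
  rw [thetaC, h, thetaSign_sq, wronskian_swap, thetaC]
  ring

lemma thetaC_add_one (z : ℂ) : thetaC k (z + 1) = thetaC k z := by
  rw [show z + 1 = z + 1 / 2 + 1 / 2 by ring, thetaC_add_half, thetaC_add_half, neg_neg]

omit [Fact (|k| < 1)] [NeZero k] in
@[fun_prop]
lemma differentiable_thetaFactor : Differentiable ℂ (thetaFactor k) := by
  unfold thetaFactor; fun_prop

lemma thetaC_add_tau (z : ℂ) : thetaC k (z + tau k) = thetaFactor k z ^ 2 * thetaC k z := by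
  rw [thetaC, wronskian_add (c := 1) thetaA_add_tau (fun z ↦ by rw [thetaB_add_tau, one_mul])
    (by fun_prop) (by fun_prop) (by fun_prop), thetaC]
  ring

lemma thetaA_add_half_period (z : ℂ) :
    thetaA k (z + (1 + tau k) / 2) = halfFactor k z * thetaA k z := by
  have h₁ : theta (tau k) (z + (1 + tau k) / 2 - 1 / 2) =
      halfFactor k z * theta (tau k) (z - tau k / 2) := by
    rw [show z + (1 + tau k) / 2 - 1 / 2 = z - tau k / 2 + tau k by ring, theta_add_tau, neg_sub,
      halfFactor]
  have h₂ : theta (tau k) (z + (1 + tau k) / 2 - tau k / 2) = theta (tau k) (z - 1 / 2) := by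
    rw [← theta_add_one _ (z - 1 / 2)]; ring_nf
  rw [thetaA, thetaA, h₁, h₂]
  ring

lemma thetaB_add_half_period (z : ℂ) :
    thetaB k (z + (1 + tau k) / 2) = -1 * (halfFactor k z * thetaB k z) := by
  have h : halfFactor k (z + 1 / 2) = -halfFactor k z := by
    rw [halfFactor, halfFactor,
      show tau k / 2 - z = tau k / 2 - (z + 1 / 2) + 1 / 2 by ring, expTwoPi_add _ (1 / 2),
      expTwoPi_half, mul_neg_one, neg_neg]
  rw [thetaB, thetaB, ← thetaA_add_half, ← thetaA_add_half, add_right_comm,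
    thetaA_add_half_period, h]
  ring

omit [Fact (|k| < 1)] [NeZero k] in
@[fun_prop]
lemma differentiable_halfFactor : Differentiable ℂ (halfFactor k) := by
  unfold halfFactor; fun_prop

lemma thetaC_add_half_period (z : ℂ) :
    thetaC k (z + (1 + tau k) / 2) = -(halfFactor k z ^ 2 * thetaC k z) := by
  rw [thetaC, wronskian_add thetaA_add_half_period thetaB_add_half_period
    (by fun_prop) (by fun_prop) (by fun_prop), thetaC]
  ring

lemma four_mul_thetaC {z : ℂ} (hz : zetaDen k z ≠ 0) :
    4 * thetaC k z = zetaFunDeriv k z * thetaA k z ^ 2 := by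
  have h₁ : (fun w ↦ zetaFun k w * thetaA k w) =ᶠ[𝓝 z] thetaB k :=
    (eventually_zetaDen_ne_zero hz).mono fun w hw ↦ zetaFun_mul_thetaA hw
  have h₂ := (hasDerivAt_zetaFun hz).fun_mul (differentiable_thetaA (k := k) z).hasDerivAt
  rw [thetaC, wronskian, ← h₁.deriv_eq, h₂.deriv, ← zetaFun_mul_thetaA hz]
  ring

lemma thetaC_sq_add_curveForm (z : ℂ) :
    thetaC k z ^ 2 + curveForm k (thetaA k z) (thetaB k z) = 0 := by
  have main {z : ℂ} (hz : zetaDen k z ≠ 0) :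
      thetaC k z ^ 2 + curveForm k (thetaA k z) (thetaB k z) = 0 := by
    rw [curveForm, modDiff, ← zetaFun_mul_thetaA hz]
    linear_combination
      (1 / 16) * (4 * thetaC k z + zetaFunDeriv k z * thetaA k z ^ 2) * four_mul_thetaC hz +
      (1 / 16) * thetaA k z ^ 4 * zetaFunDeriv_sq hz
  by_cases hz : zetaDen k z = 0
  · have h := main (zetaDen_add_half_ne_zero hz)
    have hs : thetaSign k ^ 4 = 1 := by
      rw [pow_mul (thetaSign k) 2 2, thetaSign_sq, one_pow]
    rwa [thetaC_add_half, thetaA_add_half_eq, thetaB_add_half, curveForm_mul, hs, one_mul,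
      curveForm_symm, neg_sq] at h
  · exact main hz

lemma thetaA_ne_zero_or_thetaB_ne_zero (z : ℂ) : thetaA k z ≠ 0 ∨ thetaB k z ≠ 0 := by
  by_contra! h
  have hz := thetaA_eq_zero_iff.1 h.1
  have h' := thetaA_add_half_eq (k := k) z
  rw [h.2, mul_zero, thetaA_eq_zero_iff] at h'
  exact zetaDen_add_half_ne_zero hz h'

lemma zetaDen_zero : zetaDen k 0 = 2 := by
  norm_num [zetaDen, cnRe, cnIm, cn_zero]

lemma thetaA_zero_ne_zero : thetaA k 0 ≠ 0 := by
  rw [Ne, thetaA_eq_zero_iff, zetaDen_zero]; norm_num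

lemma zetaFunDeriv_zero : zetaFunDeriv k 0 = 2 * I * ellK k := by
  simp [zetaFunDeriv, zetaDen_zero, snRe, cnRe, dnRe, snIm, cnIm, dnIm, sn_zero, cn_zero, dn_zero]
  ring

lemma thetaC_zero : thetaC k 0 = I * ellK k / 2 * thetaA k 0 ^ 2 := by
  have h := four_mul_thetaC (k := k) (z := 0) (by rw [zetaDen_zero]; norm_num)
  rw [zetaFunDeriv_zero] at h
  linear_combination h / 4

lemma thetaC_half : thetaC k (1 / 2) = -(I * ellK k / 2) * thetaB k (1 / 2) ^ 2 := by
  rw [← zero_add (1 / 2), thetaC_add_half, thetaB_add_half, thetaC_zero, mul_pow, thetaSign_sq]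
  ring

lemma thetaC_half_period : thetaC k ((1 + tau k) / 2) =
    -(I * ellK k / 2) * thetaA k ((1 + tau k) / 2) ^ 2 := by
  rw [← zero_add ((1 + tau k) / 2), thetaC_add_half_period, thetaA_add_half_period, thetaC_zero]
  ring

lemma thetaC_half_tau : thetaC k (tau k / 2) = I * ellK k / 2 * thetaB k (tau k / 2) ^ 2 := by
  have h := thetaC_half_period (k := k)
  rw [show (1 + tau k) / 2 = tau k / 2 + 1 / 2 by ring, thetaC_add_half, thetaA_add_half_eq,
    mul_pow, thetaSign_sq] at h
  linear_combination -h

lemma thetaC_mul_deriv (z : ℂ) : 2 * thetaC k z * deriv (thetaC k) z +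
    (curvePartial k (thetaB k z) (thetaA k z) * deriv (thetaA k) z +
      curvePartial k (thetaA k z) (thetaB k z) * deriv (thetaB k) z) = 0 := by
  have hA := (differentiable_thetaA (k := k) z).hasDerivAt.hasDerivWithinAt (s := Set.univ)
  have hB := (differentiable_thetaB (k := k) z).hasDerivAt.hasDerivWithinAt (s := Set.univ)
  have hC := (((differentiable_thetaC (k := k) z).hasDerivAt.hasDerivWithinAt.fun_pow 2).fun_add
    (hasDerivWithinAt_curveForm (k := k) hA hB)).hasDerivAt univ_mem
  rw [_root_.funext thetaC_sq_add_curveForm] at hC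
  have h := hC.unique (hasDerivAt_const z 0)
  norm_num at h
  linear_combination h

/-- The identity for `η'` holds after multiplication by `thetaC`, by differentiation of the equation
of the curve. -/
lemma wronskian_thetaC (z : ℂ) :
    deriv (thetaC k) z * thetaA k z - 2 * thetaC k z * deriv (thetaA k) z =
      -2 * curvePartial k (thetaA k z) (thetaB k z) := by
  let X (z : ℂ) : ℂ := deriv (thetaC k) z * thetaA k z - 2 * thetaC k z * deriv (thetaA k) z +
    2 * curvePartial k (thetaA k z) (thetaB k z)
  have hX : Differentiable ℂ X := by
    unfold X curvePartial
    fun_prop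
  have hmul (z : ℂ) : thetaC k z * X z = 0 := by
    have hdef : 4 * thetaC k z =
        thetaA k z * deriv (thetaB k) z - deriv (thetaA k) z * thetaB k z := by
      rw [thetaC, wronskian]; ring
    linear_combination thetaA k z / 2 * thetaC_mul_deriv (k := k) z -
      2 * deriv (thetaA k) z * thetaC_sq_add_curveForm (k := k) z -
      deriv (thetaA k) z / 2 * curvePartial_mul_add k (thetaA k z) (thetaB k z) +
      curvePartial k (thetaA k z) (thetaB k z) / 2 * hdef
  have hC₀ : thetaC k 0 ≠ 0 := by
    rw [thetaC_zero]
    have hK : (ellK k : ℂ) ≠ 0 := ofReal_ne_zero.2 (ellK_pos k).ne'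
    simp [hK, thetaA_zero_ne_zero]
  have hX₀ : X z = 0 :=
    ((AnalyticOnNhd.eq_zero_or_eq_zero_of_mul_eq_zero (U := Set.univ)
      (fun z _ ↦ (differentiable_thetaC (k := k)).analyticAt z) (fun z _ ↦ hX.analyticAt z)
      (fun z _ ↦ hmul z) isPreconnected_univ).resolve_left (fun h ↦ hC₀ (h 0 trivial))) z trivial
  linear_combination hX₀

end

/-! ### The differential of the second kind -/

lemma meromorphicOrderAt_div_sq_nonneg {f g : ℂ → ℂ} {z : ℂ} (hf : AnalyticAt ℂ f z)
    (hg : AnalyticAt ℂ g z) (h₂ : 2 ≤ analyticOrderAt f z) (h₁ : analyticOrderAt g z = 1) :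
    0 ≤ meromorphicOrderAt (fun z ↦ f z / g z ^ 2) z := by
  have hdiv : meromorphicOrderAt (fun z ↦ f z / g z ^ 2) z =
      meromorphicOrderAt f z - meromorphicOrderAt (g ^ 2) z :=
    meromorphicOrderAt_div hf.meromorphicAt (hg.pow 2).meromorphicAt
  rw [hdiv, hf.meromorphicOrderAt_eq, (hg.pow 2).meromorphicOrderAt_eq, analyticOrderAt_pow hg, h₁]
  cases h : analyticOrderAt f z with
  | top => simp
  | coe m =>
    rw [h] at h₂
    have hm : 2 ≤ m := by exact_mod_cast h₂
    have h₃ : (0 : WithTop ℤ) ≤ ((m - 2 : ℤ) : WithTop ℤ) := WithTop.coe_nonneg.2 (by lia)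
    simpa using h₃

lemma hasDerivAt_wronskian {f g : ℂ → ℂ} (hf : Differentiable ℂ f) (hg : Differentiable ℂ g)
    (z : ℂ) : HasDerivAt (wronskian f g)
      (f z * deriv (deriv g) z - deriv (deriv f) z * g z) z := by
  refine ((hf z).hasDerivAt.fun_mul (hg.deriv z).hasDerivAt |>.fun_sub
    ((hf.deriv z).hasDerivAt.fun_mul (hg z).hasDerivAt)).congr_deriv ?_
  ring

/-- The numerator of `K² ζ² - (A' / (4 A))'`, where `A` is `thetaA`. -/
def gammaNum (k : ℝ) (z : ℂ) : ℂ :=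
  (ellK k : ℂ) ^ 2 * thetaB k z ^ 2 - wronskian (thetaA k) (deriv (thetaA k)) z / 4

/-- The incomplete elliptic integral of the second kind. -/
def ellEInt (k φ : ℝ) : ℝ := ∫ u in (0 : ℝ)..φ, ellDelta k u

section

variable {k : ℝ}

lemma hasDerivAt_ellEInt (φ : ℝ) : HasDerivAt (ellEInt k) (ellDelta k φ) φ :=
  intervalIntegral.integral_hasDerivAt_right (continuous_ellDelta.intervalIntegrable _ _)
    (continuous_ellDelta.stronglyMeasurableAtFilter _ _) continuous_ellDelta.continuousAt

lemma ellEInt_zero : ellEInt k 0 = 0 := intervalIntegral.integral_same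

lemma ellEInt_two_pi : ellEInt k (2 * Real.pi) = 4 * ellE k := by
  have hint (a b : ℝ) : IntervalIntegrable (ellDelta k) volume a b :=
    continuous_ellDelta.intervalIntegrable a b
  have hper := intervalIntegral.integral_comp_add_right (a := 0) (b := Real.pi)
    (ellDelta k) Real.pi
  simp only [ellDelta_add_pi, zero_add] at hper
  have hpi : ∫ u in (0 : ℝ)..Real.pi, ellDelta k u = 2 * ellE k :=
    integral_zero_pi_of_symm continuous_ellDelta ellDelta_pi_sub
  rw [ellEInt, two_mul, ← intervalIntegral.integral_add_adjacent_intervals (hint 0 Real.pi)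
    (hint Real.pi _), ← hper, hpi]
  ring

lemma hasDerivAt_thetaFactor (z : ℂ) :
    HasDerivAt (thetaFactor k) (-(4 * Real.pi * I) * thetaFactor k z) z := by
  have h : HasDerivAt (fun z : ℂ ↦ tau k / 2 - 2 * z) (-2) z := by
    simpa using ((hasDerivAt_id z).const_mul 2).const_sub (tau k / 2)
  refine ((hasDerivAt_expTwoPi (tau k / 2 - 2 * z)).comp z h).neg.congr_deriv ?_
  rw [thetaFactor]
  ring

lemma deriv_thetaA_add_one (z : ℂ) : deriv (thetaA k) (z + 1) = deriv (thetaA k) z := by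
  rw [← deriv_comp_add_const, _root_.funext thetaA_add_one]

lemma logDeriv_thetaA_add_one (z : ℂ) : logDeriv (thetaA k) (z + 1) = logDeriv (thetaA k) z := by
  rw [logDeriv_apply, logDeriv_apply, deriv_thetaA_add_one, thetaA_add_one]

lemma gammaNum_add_one (z : ℂ) : gammaNum k (z + 1) = gammaNum k z := by
  have h : deriv (deriv (thetaA k)) (z + 1) = deriv (deriv (thetaA k)) z := by
    rw [← deriv_comp_add_const, _root_.funext deriv_thetaA_add_one]
  rw [gammaNum, wronskian, thetaA_add_one, thetaB_add_one, deriv_thetaA_add_one, h, gammaNum,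
    wronskian]

lemma quarter_re (x : ℝ) : (x + tau k / 4).re = x := by simp [tau_re]

variable [Fact (|k| < 1)]

lemma four_mul_ellK_mul_quarter_im (x : ℝ) :
    4 * ellK k * (x + tau k / 4).im = ellK (compl k) := by
  have him : (x + tau k / 4 : ℂ).im = (tau k).im / 4 := by simp
  rw [him, ← ellK_mul_tau_im]
  ring

/-- A primitive of `ζ²` on the line `ℝ + τ / 4`. -/
def zetaSqPrimitive (k x : ℝ) : ℂ :=
  (ellEInt k (amplitude k (4 * ellK k * x)) / (2 * ellK k) - x : ℝ) +
    I * |k| / (2 * ellK k) * cn k (4 * ellK k * x)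

lemma zetaSqPrimitive_one :
    zetaSqPrimitive k 1 = zetaSqPrimitive k 0 + (2 * ellE k - ellK k) / ellK k := by
  have hK : (ellK k : ℂ) ≠ 0 := ofReal_ne_zero.2 (ellK_pos k).ne'
  have ham : amplitude k (4 * ellK k * 1) = 2 * Real.pi := by
    rw [show 4 * ellK k * 1 = 0 + 2 * ellK k + 2 * ellK k by ring, amplitude_add, amplitude_add,
      amplitude_zero]
    ring
  simp only [zetaSqPrimitive, cn, ham, mul_zero, amplitude_zero, ellEInt_two_pi, ellEInt_zero,
    Real.cos_two_pi, Real.cos_zero]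
  push_cast
  field_simp
  ring

variable [NeZero k]

@[fun_prop]
lemma differentiable_deriv_thetaA : Differentiable ℂ (deriv (thetaA k)) :=
  differentiable_thetaA.deriv

lemma deriv_thetaA_add_tau (z : ℂ) : deriv (thetaA k) (z + tau k) =
    thetaFactor k z * (deriv (thetaA k) z - 4 * Real.pi * I * thetaA k z) := by
  rw [← deriv_comp_add_const, _root_.funext thetaA_add_tau, ((hasDerivAt_thetaFactor z).fun_mul
    (differentiable_thetaA (k := k) z).hasDerivAt).deriv]
  ring

lemma deriv_thetaA_sq_of_zero {z : ℂ} (hz : thetaA k z = 0) :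
    deriv (thetaA k) z ^ 2 = -4 * (ellK k : ℂ) ^ 2 * thetaB k z ^ 2 := by
  have hB := (thetaA_ne_zero_or_thetaB_ne_zero z).resolve_left (not_not.2 hz)
  have hcurve := thetaC_sq_add_curveForm (k := k) z
  rw [thetaC, wronskian, curveForm, hz] at hcurve
  refine mul_left_cancel₀ (pow_ne_zero 2 hB) ?_
  linear_combination 16 * hcurve

lemma deriv_thetaA_mul_deriv_deriv_of_zero {z : ℂ} (hz : thetaA k z = 0) :
    deriv (thetaA k) z * deriv (deriv (thetaA k)) z =
      -8 * (ellK k : ℂ) ^ 2 * thetaB k z * deriv (thetaB k) z := by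
  have hB := (thetaA_ne_zero_or_thetaB_ne_zero z).resolve_left (not_not.2 hz)
  have hC : HasDerivAt (thetaC k) _ z :=
    (hasDerivAt_wronskian differentiable_thetaA differentiable_thetaB z).div_const 4
  have hcurve := thetaC_mul_deriv (k := k) z
  rw [hC.deriv, thetaC, wronskian, curvePartial, curvePartial, hz] at hcurve
  refine mul_left_cancel₀ (pow_ne_zero 2 hB) ?_
  linear_combination 8 * hcurve

lemma hasDerivAt_gammaNum (z : ℂ) : HasDerivAt (gammaNum k)
    (2 * (ellK k : ℂ) ^ 2 * thetaB k z * deriv (thetaB k) z -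
      (thetaA k z * deriv (deriv (deriv (thetaA k))) z -
        deriv (deriv (thetaA k)) z * deriv (thetaA k) z) / 4) z := by
  refine ((((differentiable_thetaB (k := k) z).hasDerivAt.fun_pow 2).const_mul
    ((ellK k : ℂ) ^ 2)).fun_sub ((hasDerivAt_wronskian differentiable_thetaA
    differentiable_deriv_thetaA z).div_const 4)).congr_deriv ?_
  push_cast
  ring

lemma differentiable_gammaNum : Differentiable ℂ (gammaNum k) :=
  fun z ↦ (hasDerivAt_gammaNum z).differentiableAt

lemma gammaNum_of_zero {z : ℂ} (hz : thetaA k z = 0) : gammaNum k z = 0 := by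
  rw [gammaNum, wronskian, hz]
  linear_combination deriv_thetaA_sq_of_zero hz / 4

lemma deriv_gammaNum_of_zero {z : ℂ} (hz : thetaA k z = 0) : deriv (gammaNum k) z = 0 := by
  rw [(hasDerivAt_gammaNum z).deriv, hz]
  linear_combination deriv_thetaA_mul_deriv_deriv_of_zero hz / 4

lemma gammaNum_add_tau (z : ℂ) : gammaNum k (z + tau k) = thetaFactor k z ^ 2 * gammaNum k z := by
  have h := wronskian_add (f := thetaA k) (g := deriv (thetaA k))
    (g₁ := fun z ↦ deriv (thetaA k) z - 4 * Real.pi * I * thetaA k z) (c := 1) (z := z)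
    thetaA_add_tau (fun z ↦ by rw [deriv_thetaA_add_tau, one_mul])
    (by fun_prop) (by fun_prop) (by fun_prop)
  have hsub : wronskian (thetaA k) (fun z ↦ deriv (thetaA k) z - 4 * Real.pi * I * thetaA k z) z =
      wronskian (thetaA k) (deriv (thetaA k)) z := by
    rw [wronskian, deriv_fun_sub (by fun_prop) (by fun_prop), deriv_const_mul _ (by fun_prop),
      wronskian]
    ring
  rw [gammaNum, thetaB_add_tau, h, hsub, gammaNum]
  ring

lemma meromorphicOrderAt_gammaNum_div_nonneg (z : ℂ) :
    0 ≤ meromorphicOrderAt (fun z ↦ gammaNum k z / thetaA k z ^ 2) z := by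
  have hA := (differentiable_thetaA (k := k)).analyticAt z
  have hγ := (differentiable_gammaNum (k := k)).analyticAt z
  by_cases hz : thetaA k z = 0
  · exact meromorphicOrderAt_div_sq_nonneg hγ hA
      (two_le_analyticOrderAt hγ (gammaNum_of_zero hz) (deriv_gammaNum_of_zero hz))
      (hA.analyticOrderAt_eq_one_of_zero_deriv_ne_zero hz (deriv_thetaA_ne_zero hz))
  · exact (hγ.div (hA.pow 2) (pow_ne_zero 2 hz)).meromorphicOrderAt_nonneg

lemma exists_gammaNum_eq : ∃ c : ℂ, ∀ z, gammaNum k z = c * thetaA k z ^ 2 := by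
  have hA := differentiable_thetaA (k := k)
  have hγ := differentiable_gammaNum (k := k)
  obtain ⟨c, hc⟩ := exists_eventuallyEq_const_of_periodic (τ := tau k)
    (fun z ↦ (hγ.analyticAt z).meromorphicAt.fun_div ((hA.analyticAt z).meromorphicAt.fun_pow 2))
    meromorphicOrderAt_gammaNum_div_nonneg
    (fun z ↦ by rw [gammaNum_add_one, thetaA_add_one])
    (fun z ↦ by rw [gammaNum_add_tau, thetaA_add_tau, mul_pow,
      mul_div_mul_left _ _ (pow_ne_zero 2 (thetaFactor_ne_zero z))])
  refine ⟨c, fun z ↦ ?_⟩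
  by_cases hz : thetaA k z = 0
  · rw [gammaNum_of_zero hz, hz]; ring
  · have hcont : ContinuousAt (fun z ↦ gammaNum k z / thetaA k z ^ 2) z :=
      hγ.continuous.continuousAt.div (hA.continuous.continuousAt.pow 2) (pow_ne_zero 2 hz)
    exact (div_eq_iff (pow_ne_zero 2 hz)).1
      ((hcont.eventuallyEq_nhds_iff_eventuallyEq_nhdsNE continuousAt_const).1 (hc z)).eq_of_nhds

lemma hasDerivAt_logDeriv_thetaA {z : ℂ} (hz : thetaA k z ≠ 0) :
    HasDerivAt (logDeriv (thetaA k))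
      (wronskian (thetaA k) (deriv (thetaA k)) z / thetaA k z ^ 2) z := by
  refine ((differentiable_deriv_thetaA z).hasDerivAt.div
    (differentiable_thetaA z).hasDerivAt hz).congr_deriv ?_
  rw [wronskian]
  ring

lemma zetaDen_quarter (x : ℝ) : zetaDen k (x + tau k / 4) = 1 := by
  rw [zetaDen, cnIm, four_mul_ellK_mul_quarter_im, cn_ellK, ofReal_zero, mul_zero, add_zero]

lemma dn_compl_ellK_compl : dn (compl k) (ellK (compl k)) = |k| := by
  rw [← sq_eq_sq₀ (dn_pos _).le (abs_nonneg k), dn_sq, sn_ellK, compl_sq, sq_abs]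
  ring

lemma zetaFun_quarter (x : ℝ) : zetaFun k (x + tau k / 4) =
    I * |k| * sn k (4 * ellK k * x) - dn k (4 * ellK k * x) := by
  rw [zetaFun, zetaDen_quarter, snRe, dnRe, snIm, dnIm, four_mul_ellK_mul_quarter_im, quarter_re,
    dn_compl_ellK_compl, sn_ellK]
  push_cast
  ring

lemma hasDerivAt_zetaSqPrimitive (x : ℝ) :
    HasDerivAt (zetaSqPrimitive k) (zetaFun k (x + tau k / 4) ^ 2) x := by
  have hK : (ellK k : ℂ) ≠ 0 := ofReal_ne_zero.2 (ellK_pos k).ne'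
  have hlin : HasDerivAt (fun x : ℝ ↦ 4 * ellK k * x) (4 * ellK k) x := by
    simpa using (hasDerivAt_id x).const_mul (4 * ellK k)
  have hE : HasDerivAt (fun x : ℝ ↦ ellEInt k (amplitude k (4 * ellK k * x)) / (2 * ellK k) - x)
      (2 * dn k (4 * ellK k * x) ^ 2 - 1) x := by
    refine ((((hasDerivAt_ellEInt _).comp x ((hasDerivAt_amplitude _).comp x hlin)).div_const
      (2 * ellK k)).sub (hasDerivAt_id x)).congr_deriv ?_
    have hK := (ellK_pos k).ne'
    rw [dn, Function.comp_apply]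
    field_simp
    ring
  have hcn := ((hasDerivAt_cn (k := k) _).comp x hlin).ofReal_comp
  refine (hE.ofReal_comp.add (hcn.const_mul (I * |k| / (2 * ellK k)))).congr_deriv ?_
  have hdn : (dn k (4 * ellK k * x) : ℂ) ^ 2 = 1 - |k| ^ 2 * sn k (4 * ellK k * x) ^ 2 := by
    rw [← ofReal_pow |k|, sq_abs]; exact_mod_cast dn_sq (k := k) _
  rw [zetaFun_quarter]
  push_cast
  field_simp
  linear_combination 2 * hdn - 2 * |k| ^ 2 * sn k (4 * ellK k * x) ^ 2 * I_sq

/-- Along the line `ℝ + τ / 4` the derivative `c` of `K² ∫ ζ² - A' / (4 A)` is its increment over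
the period `1`, which is `K²` times that of `∫ ζ²`. -/
lemma gammaNum_eq (z : ℂ) : gammaNum k z =
    (ellK k : ℂ) ^ 2 * ((2 * ellE k - ellK k) / ellK k) * thetaA k z ^ 2 := by
  obtain ⟨c, hc⟩ := exists_gammaNum_eq (k := k)
  let F (x : ℝ) : ℂ := (ellK k : ℂ) ^ 2 * zetaSqPrimitive k x -
    logDeriv (thetaA k) (x + tau k / 4) / 4 - c * x
  have hF (x : ℝ) : HasDerivAt F 0 x := by
    have hD : zetaDen k (x + tau k / 4) ≠ 0 := by rw [zetaDen_quarter]; exact one_ne_zero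
    have hA : thetaA k (x + tau k / 4) ≠ 0 := thetaA_eq_zero_iff.not.2 hD
    have hlin : HasDerivAt (fun x : ℝ ↦ (x : ℂ) + tau k / 4) 1 x :=
      ofRealCLM.hasDerivAt.add_const _
    refine ((((hasDerivAt_zetaSqPrimitive x).const_mul ((ellK k : ℂ) ^ 2)).sub
      (((hasDerivAt_logDeriv_thetaA hA).comp x hlin).div_const 4)).sub
      (ofRealCLM.hasDerivAt.const_mul c)).congr_deriv ?_
    have hγ := hc (x + tau k / 4)
    rw [gammaNum, ← zetaFun_mul_thetaA hD] at hγ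
    rw [ofRealCLM_apply, ofReal_one]
    generalize (x : ℂ) + tau k / 4 = w at hγ hA ⊢
    field_simp
    linear_combination 4 * hγ
  have hF₀₁ : F 1 = F 0 :=
    is_const_of_deriv_eq_zero (fun x ↦ (hF x).differentiableAt) (fun x ↦ (hF x).deriv) 1 0
  have hlog : logDeriv (thetaA k) (1 + tau k / 4) = logDeriv (thetaA k) (0 + tau k / 4) := by
    rw [zero_add, add_comm, logDeriv_thetaA_add_one]
  simp only [F, zetaSqPrimitive_one, ofReal_one, ofReal_zero] at hF₀₁
  rw [hc]
  linear_combination -thetaA k z ^ 2 * (hF₀₁ + hlog / 4)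

lemma hasDerivAt_logDeriv_thetaA_div_four {z : ℂ} (hz : thetaA k z ≠ 0) :
    HasDerivAt (fun z ↦ logDeriv (thetaA k) z / 4)
      ((ellK k : ℂ) ^ 2 * ((thetaB k z / thetaA k z) ^ 2 -
        (2 * ellE k - ellK k) / ellK k)) z := by
  refine ((hasDerivAt_logDeriv_thetaA hz).div_const 4).congr_deriv ?_
  have hγ := gammaNum_eq (k := k) z
  rw [gammaNum] at hγ
  generalize (2 * (ellE k : ℂ) - ellK k) / ellK k = e at hγ ⊢
  field_simp
  linear_combination -4 * hγ

end

/-! ### Lifting paths on the curve to the plane -/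

lemma eqOn_Icc_of_hasDerivWithinAt_smul {𝕜 E : Type*} [NormedField 𝕜] [NormedAddCommGroup E]
    [NormedSpace ℝ E] [NormedSpace 𝕜 E] {v : E → E} (hv : LocallyLipschitz v) {α : ℝ → 𝕜}
    {f g : ℝ → E} {a b : ℝ} (hα : ContinuousOn α (Set.Icc a b))
    (hf : ∀ s ∈ Set.Icc a b, HasDerivWithinAt f (α s • v (f s)) (Set.Icc a b) s)
    (hg : ∀ s ∈ Set.Icc a b, HasDerivWithinAt g (α s • v (g s)) (Set.Icc a b) s)
    (ha : f a = g a) : Set.EqOn f g (Set.Icc a b) := by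
  have hfc : ContinuousOn f (Set.Icc a b) := fun s hs ↦ (hf s hs).continuousWithinAt
  have hgc : ContinuousOn g (Set.Icc a b) := fun s hs ↦ (hg s hs).continuousWithinAt
  obtain ⟨L, hL⟩ := hv.locallyLipschitzOn.exists_lipschitzOnWith_of_compact
    ((isCompact_Icc.image_of_continuousOn hfc).union (isCompact_Icc.image_of_continuousOn hgc))
  obtain ⟨M, hM⟩ := isCompact_Icc.exists_bound_of_continuousOn hα
  have hlip (s : ℝ) (hs : s ∈ Set.Ico a b) : LipschitzOnWith (M.toNNReal * L)
      (fun p ↦ α s • v p) (f '' Set.Icc a b ∪ g '' Set.Icc a b) :=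
    ((lipschitzWith_smul (α s)).comp_lipschitzOnWith hL).weaken <| by
      gcongr; exact NNReal.le_toNNReal_of_coe_le (hM s (Set.Ico_subset_Icc_self hs))
  have hright {h : ℝ → E} (hh : ∀ s ∈ Set.Icc a b,
      HasDerivWithinAt h (α s • v (h s)) (Set.Icc a b) s) (s : ℝ) (hs : s ∈ Set.Ico a b) :
      HasDerivWithinAt h (α s • v (h s)) (Set.Ici s) s :=
    (hh s (Set.Ico_subset_Icc_self hs)).mono_of_mem_nhdsWithin <|
      mem_of_superset (Icc_mem_nhdsGE hs.2) (Set.Icc_subset_Icc_left hs.1)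
  exact ODE_solution_unique_of_mem_Icc_right hlip hfc (hright hf)
    (fun s hs ↦ .inl (Set.mem_image_of_mem f (Set.Ico_subset_Icc_self hs))) hgc (hright hg)
    (fun s hs ↦ .inr (Set.mem_image_of_mem g (Set.Ico_subset_Icc_self hs))) ha

/-- The theta functions map `w` to the point with homogeneous coordinates `(X₀, X₁, X₂)`. The
equations are those of proportionality with weights `1, 1, 2`, cleared of denominators. -/
def Lifts (k : ℝ) (w X₀ X₁ X₂ : ℂ) : Prop :=
  X₀ * thetaB k w - X₁ * thetaA k w = 0 ∧ X₂ * thetaA k w ^ 2 - thetaC k w * X₀ ^ 2 = 0 ∧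
    X₂ * thetaB k w ^ 2 - thetaC k w * X₁ ^ 2 = 0

/-- A path in homogeneous coordinates whose velocity is `α` times the vector field dual to
`dζ / η`. As a change of the homogeneous coordinates affects the derivatives, the velocity enters
through the weighted Wronskians of the coordinates. -/
structure IsFlow (k : ℝ) (Z₀ Z₁ W α : ℝ → ℂ) : Prop where
  ne_zero : ∀ s ∈ Set.Icc (0 : ℝ) 1, Z₀ s ≠ 0 ∨ Z₁ s ≠ 0
  continuous : Continuous α
  exists_deriv : ∀ s ∈ Set.Icc (0 : ℝ) 1, ∃ a b c : ℂ,
    HasDerivWithinAt Z₀ a (Set.Icc 0 1) s ∧ HasDerivWithinAt Z₁ b (Set.Icc 0 1) s ∧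
    HasDerivWithinAt W c (Set.Icc 0 1) s ∧ Z₀ s * b - Z₁ s * a = α s * W s ∧
    Z₀ s * c - 2 * W s * a = α s * (-(curvePartial k (Z₀ s) (Z₁ s) / 2)) ∧
    Z₁ s * c - 2 * W s * b = α s * (curvePartial k (Z₁ s) (Z₀ s) / 2)

/-- The vector field on the affine curve, in the coordinates `ζ` and `η`, dual to `dζ / η`. -/
def curveField (k : ℝ) (p : ℂ × ℂ) : ℂ × ℂ := (p.2, -(curvePartial k 1 p.1 / 2))

lemma locallyLipschitz_curveField (k : ℝ) : LocallyLipschitz (curveField k) := by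
  refine ContDiff.locallyLipschitz (𝕂 := ℝ) ?_
  unfold curveField curvePartial
  fun_prop

lemma curvePartial_div (k : ℝ) {X : ℂ} (hX : X ≠ 0) (Y : ℂ) :
    curvePartial k 1 (Y / X) = curvePartial k X Y / X ^ 3 := by
  rw [curvePartial, curvePartial]
  field_simp

section

variable {k : ℝ} {Z₀ Z₁ W α z : ℝ → ℂ}

lemma IsFlow.swap (h : IsFlow k Z₀ Z₁ W α) : IsFlow k Z₁ Z₀ (fun s ↦ -W s) α where
  ne_zero s hs := (h.ne_zero s hs).symm
  continuous := h.continuous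
  exists_deriv s hs := by
    obtain ⟨a, b, c, ha, hb, hc, h₀₁, h₀, h₁⟩ := h.exists_deriv s hs
    exact ⟨b, a, -c, hb, ha, hc.neg, by linear_combination -h₀₁, by linear_combination -h₁,
      by linear_combination -h₀⟩

lemma IsFlow.continuousOn (h : IsFlow k Z₀ Z₁ W α) : ContinuousOn Z₀ (Set.Icc 0 1) ∧
    ContinuousOn Z₁ (Set.Icc 0 1) ∧ ContinuousOn W (Set.Icc 0 1) := by
  choose! a b c ha hb hc _ using h.exists_deriv
  exact ⟨fun s hs ↦ (ha s hs).continuousWithinAt, fun s hs ↦ (hb s hs).continuousWithinAt,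
    fun s hs ↦ (hc s hs).continuousWithinAt⟩

lemma IsFlow.hasDerivWithinAt_affine (h : IsFlow k Z₀ Z₁ W α) {s : ℝ} (hs : s ∈ Set.Icc (0 : ℝ) 1)
    (hZ : Z₀ s ≠ 0) : HasDerivWithinAt (fun s ↦ (Z₁ s / Z₀ s, W s / Z₀ s ^ 2))
      (α s • curveField k (Z₁ s / Z₀ s, W s / Z₀ s ^ 2)) (Set.Icc 0 1) s := by
  obtain ⟨a, b, c, ha, hb, hc, h₀₁, h₀, -⟩ := h.exists_deriv s hs
  refine ((hb.fun_div ha hZ).prodMk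
    (hc.fun_div (ha.fun_pow 2) (pow_ne_zero 2 hZ))).congr_deriv ?_
  rw [curveField, curvePartial_div k hZ, Prod.smul_mk, smul_eq_mul, smul_eq_mul]
  refine Prod.ext ?_ ?_
  · field_simp
    linear_combination h₀₁
  · push_cast
    field_simp
    linear_combination 2 * h₀

lemma Lifts.smul {w ζ η : ℂ} (h : Lifts k w 1 ζ η) (X : ℂ) :
    Lifts k w X (ζ * X) (η * X ^ 2) := by
  obtain ⟨h₁, h₂, h₃⟩ := h
  exact ⟨by linear_combination X * h₁, by linear_combination X ^ 2 * h₂,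
    by linear_combination X ^ 2 * h₃⟩

lemma Lifts.of_smul {w ζ η X : ℂ} (hX : X ≠ 0) (h : Lifts k w X (ζ * X) (η * X ^ 2)) :
    Lifts k w 1 ζ η := by
  obtain ⟨h₁, h₂, h₃⟩ := h
  exact ⟨mul_left_cancel₀ hX (by linear_combination h₁),
    mul_left_cancel₀ (pow_ne_zero 2 hX) (by linear_combination h₂),
    mul_left_cancel₀ (pow_ne_zero 2 hX) (by linear_combination h₃)⟩

lemma lifts_iff_div_eq_div {w X₀ X₁ X₂ : ℂ} (hX : X₀ ≠ 0) (hA : thetaA k w ≠ 0) :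
    Lifts k w X₀ X₁ X₂ ↔
      (X₁ / X₀, X₂ / X₀ ^ 2) = (thetaB k w / thetaA k w, thetaC k w / thetaA k w ^ 2) := by
  rw [Prod.mk.injEq, div_eq_div_iff hX hA,
    div_eq_div_iff (pow_ne_zero 2 hX) (pow_ne_zero 2 hA)]
  refine ⟨fun ⟨h₁, h₂, _⟩ ↦ ⟨by linear_combination -h₁, by linear_combination h₂⟩,
    fun ⟨h₁, h₂⟩ ↦ ⟨by linear_combination -h₁, by linear_combination h₂, ?_⟩⟩
  refine mul_left_cancel₀ (pow_ne_zero 2 hX) ?_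
  linear_combination (-X₂ * (X₁ * thetaA k w + thetaB k w * X₀)) * h₁ + X₁ ^ 2 * h₂

variable [Fact (|k| < 1)] [NeZero k]

lemma Lifts.thetaA_ne_zero {w X₀ X₁ X₂ : ℂ} (h : Lifts k w X₀ X₁ X₂) (hX : X₀ ≠ 0) :
    thetaA k w ≠ 0 := by
  intro hA
  have hB := (thetaA_ne_zero_or_thetaB_ne_zero w).resolve_left (not_not.2 hA)
  exact mul_ne_zero hX hB (by linear_combination h.1 + X₁ * hA)

lemma Lifts.div_eq {w X₀ X₁ X₂ : ℂ} (h : Lifts k w X₀ X₁ X₂) (hX : X₀ ≠ 0) :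
    X₁ / X₀ = thetaB k w / thetaA k w :=
  congrArg Prod.fst ((lifts_iff_div_eq_div hX (h.thetaA_ne_zero hX)).1 h)

lemma Lifts.add_half {w X₀ X₁ X₂ : ℂ} (h : Lifts k w X₀ X₁ X₂) :
    Lifts k (w + 1 / 2) X₁ X₀ (-X₂) := by
  have hs := thetaSign_sq (k := k)
  obtain ⟨h₁, h₂, h₃⟩ := h
  rw [Lifts, thetaB_add_half, thetaA_add_half_eq, thetaC_add_half]
  exact ⟨by linear_combination -thetaSign k * h₁,
    by linear_combination -h₃ - X₂ * thetaB k w ^ 2 * hs,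
    by linear_combination -h₂ - X₂ * thetaA k w ^ 2 * hs⟩

lemma Lifts.of_add_half {w X₀ X₁ X₂ : ℂ} (h : Lifts k (w + 1 / 2) X₁ X₀ (-X₂)) :
    Lifts k w X₀ X₁ X₂ := by
  have h' := h.add_half
  rw [neg_neg, add_assoc, add_halves] at h'
  rwa [Lifts, thetaA_add_one, thetaB_add_one, thetaC_add_one] at h'

lemma hasDerivAt_thetaB_div_thetaA {w : ℂ} (hA : thetaA k w ≠ 0) :
    HasDerivAt (fun w ↦ thetaB k w / thetaA k w) (4 * (thetaC k w / thetaA k w ^ 2)) w := by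
  refine ((differentiable_thetaB (k := k) w).hasDerivAt.fun_div
    (differentiable_thetaA w).hasDerivAt hA).congr_deriv ?_
  rw [thetaC, wronskian]; ring

lemma hasDerivAt_thetaC_div_thetaA_sq {w : ℂ} (hA : thetaA k w ≠ 0) :
    HasDerivAt (fun w ↦ thetaC k w / thetaA k w ^ 2)
      (4 * -(curvePartial k 1 (thetaB k w / thetaA k w) / 2)) w := by
  refine ((differentiable_thetaC (k := k) w).hasDerivAt.fun_div
    ((differentiable_thetaA w).hasDerivAt.fun_pow 2) (pow_ne_zero 2 hA)).congr_deriv ?_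
  rw [curvePartial_div k hA]
  push_cast
  field_simp
  linear_combination 2 * wronskian_thetaC (k := k) w

lemma hasDerivAt_affine_theta {s : ℝ} (hz : HasDerivAt z (α s / 4) s)
    (hA : thetaA k (z s) ≠ 0) :
    HasDerivAt (fun s ↦ (thetaB k (z s) / thetaA k (z s), thetaC k (z s) / thetaA k (z s) ^ 2))
      (α s • curveField k
        (thetaB k (z s) / thetaA k (z s), thetaC k (z s) / thetaA k (z s) ^ 2)) s := by
  refine (((hasDerivAt_thetaB_div_thetaA hA).comp s hz).prodMk
    ((hasDerivAt_thetaC_div_thetaA_sq hA).comp s hz)).congr_deriv ?_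
  rw [curveField, Prod.smul_mk, smul_eq_mul, smul_eq_mul]
  exact Prod.ext (by ring) (by ring)

lemma IsFlow.lifts_of_forall_ne_zero (h : IsFlow k Z₀ Z₁ W α)
    (hz : ∀ s, HasDerivAt z (α s / 4) s) {a b : ℝ} (ha : 0 ≤ a) (hb : b ≤ 1)
    (hne : ∀ s ∈ Set.Icc a b, Z₀ s ≠ 0 ∧ thetaA k (z s) ≠ 0)
    (hm : Lifts k (z a) (Z₀ a) (Z₁ a) (W a)) {s : ℝ} (hs : s ∈ Set.Icc a b) :
    Lifts k (z s) (Z₀ s) (Z₁ s) (W s) := by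
  have hsub : Set.Icc a b ⊆ Set.Icc 0 1 := Set.Icc_subset_Icc ha hb
  have haab : a ∈ Set.Icc a b := Set.left_mem_Icc.2 (hs.1.trans hs.2)
  rw [lifts_iff_div_eq_div (hne s hs).1 (hne s hs).2]
  rw [lifts_iff_div_eq_div (hne a haab).1 (hne a haab).2] at hm
  exact eqOn_Icc_of_hasDerivWithinAt_smul (locallyLipschitz_curveField k)
    h.continuous.continuousOn
    (fun s hs ↦ (h.hasDerivWithinAt_affine (hsub hs) (hne s hs).1).mono hsub)
    (fun s hs ↦ (hasDerivAt_affine_theta (hz s) (hne s hs).2).hasDerivWithinAt) hm hs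

lemma IsFlow.lifts_mem_nhdsGT (h : IsFlow k Z₀ Z₁ W α)
    (hz : ∀ s, HasDerivAt z (α s / 4) s) {a : ℝ} (ha : a ∈ Set.Ico (0 : ℝ) 1)
    (hZ : Z₀ a ≠ 0) (hm : Lifts k (z a) (Z₀ a) (Z₁ a) (W a)) :
    {s | Lifts k (z s) (Z₀ s) (Z₁ s) (W s)} ∈ 𝓝[>] a := by
  have hle : 𝓝[≥] a ≤ 𝓝[Set.Icc 0 1] a := by
    rw [← nhdsWithin_Icc_eq_nhdsGE ha.2]
    exact nhdsWithin_mono _ (Set.Icc_subset_Icc_left ha.1)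
  have hZev : ∀ᶠ s in 𝓝[≥] a, Z₀ s ≠ 0 :=
    ((h.continuousOn.1 a (Set.Ico_subset_Icc_self ha)).eventually_ne hZ).filter_mono hle
  have hAev : ∀ᶠ s in 𝓝[≥] a, thetaA k (z s) ≠ 0 :=
    (((differentiable_thetaA (k := k)).continuous.continuousAt.comp
      (hz a).continuousAt).eventually_ne (hm.thetaA_ne_zero hZ)).filter_mono nhdsWithin_le_nhds
  have hlt : ∀ᶠ s in 𝓝[≥] a, s < 1 := (eventually_lt_nhds ha.2).filter_mono nhdsWithin_le_nhds
  obtain ⟨b, hab, hsub⟩ := mem_nhdsGE_iff_exists_Icc_subset.1 ((hZev.and hAev).and hlt)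
  filter_upwards [Ioc_mem_nhdsGT hab] with s hs
  exact h.lifts_of_forall_ne_zero hz ha.1 (hsub (Set.right_mem_Icc.2 (le_of_lt hab))).2.le
    (fun s hs ↦ (hsub hs).1) hm (Set.Ioc_subset_Icc_self hs)

lemma IsFlow.isClosed_lifts (h : IsFlow k Z₀ Z₁ W α) (hz : Continuous z) :
    IsClosed ({s | Lifts k (z s) (Z₀ s) (Z₁ s) (W s)} ∩ Set.Icc 0 1) := by
  have hA := ((differentiable_thetaA (k := k)).continuous.comp hz).continuousOn (s := Set.Icc 0 1)
  have hB := ((differentiable_thetaB (k := k)).continuous.comp hz).continuousOn (s := Set.Icc 0 1)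
  have hC := ((differentiable_thetaC (k := k)).continuous.comp hz).continuousOn (s := Set.Icc 0 1)
  obtain ⟨h₀, h₁, hW⟩ := h.continuousOn
  have hcont := ((h₀.mul hB).sub (h₁.mul hA)).prodMk
    (((hW.mul (hA.pow 2)).sub (hC.mul (h₀.pow 2))).prodMk
      ((hW.mul (hB.pow 2)).sub (hC.mul (h₁.pow 2))))
  convert hcont.preimage_isClosed_of_isClosed isClosed_Icc (isClosed_singleton (x := 0)) using 1
  ext s
  simp [Lifts, Prod.ext_iff, and_comm]

lemma IsFlow.lifts (h : IsFlow k Z₀ Z₁ W α) (hz : ∀ s, HasDerivAt z (α s / 4) s)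
    (h₀ : Lifts k (z 0) (Z₀ 0) (Z₁ 0) (W 0)) {s : ℝ} (hs : s ∈ Set.Icc (0 : ℝ) 1) :
    Lifts k (z s) (Z₀ s) (Z₁ s) (W s) := by
  have hzc : Continuous z := continuous_iff_continuousAt.2 fun s ↦ (hz s).continuousAt
  refine (h.isClosed_lifts hzc).Icc_subset_of_forall_mem_nhdsWithin h₀ ?_ hs
  rintro a ⟨hm, ha⟩
  rcases h.ne_zero a (Set.Ico_subset_Icc_self ha) with hZ | hZ
  · exact h.lifts_mem_nhdsGT hz ha hZ hm
  · exact mem_of_superset (h.swap.lifts_mem_nhdsGT (z := fun s ↦ z s + 1 / 2)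
      (fun s ↦ (hz s).add_const _) ha hZ hm.add_half) fun _ ↦ Lifts.of_add_half

lemma wronskian_thetaC_thetaB (w : ℂ) :
    deriv (thetaC k) w * thetaB k w - 2 * thetaC k w * deriv (thetaB k) w =
      2 * curvePartial k (thetaB k w) (thetaA k w) := by
  have hA : deriv (thetaA k) (w + 1 / 2) = thetaSign k * deriv (thetaB k) w := by
    rw [← deriv_comp_add_const, _root_.funext thetaA_add_half_eq,
      deriv_const_mul _ (differentiable_thetaB w)]
  have hC : deriv (thetaC k) (w + 1 / 2) = -deriv (thetaC k) w := by
    rw [← deriv_comp_add_const, _root_.funext thetaC_add_half, deriv.fun_neg]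
  have h := wronskian_thetaC (k := k) (w + 1 / 2)
  rw [hA, hC, thetaA_add_half_eq, thetaB_add_half, thetaC_add_half] at h
  refine mul_left_cancel₀ (thetaSign_ne_zero (k := k)) ?_
  rw [curvePartial] at h ⊢
  linear_combination -h + 2 * (ellK k : ℂ) ^ 2 * thetaSign k *
    (thetaA k w ^ 3 + modDiff k * thetaB k w ^ 2 * thetaA k w) * thetaSign_sq (k := k)

lemma isFlow_segment (w : ℂ) : IsFlow k (fun s ↦ thetaA k (w - s * w))
    (fun s ↦ thetaB k (w - s * w)) (fun s ↦ thetaC k (w - s * w)) (fun _ ↦ -4 * w) where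
  ne_zero s _ := thetaA_ne_zero_or_thetaB_ne_zero _
  continuous := continuous_const
  exists_deriv s _ := by
    have hl : HasDerivAt (fun s : ℝ ↦ w - s * w) (-w) s := by
      simpa using ((ofRealCLM.hasDerivAt (x := s)).mul_const w).const_sub w
    have hderiv {f : ℂ → ℂ} (hf : Differentiable ℂ f) :=
      ((hf (w - s * w)).hasDerivAt.comp s hl).hasDerivWithinAt (s := Set.Icc 0 1)
    refine ⟨_, _, _, hderiv differentiable_thetaA, hderiv differentiable_thetaB,
      hderiv differentiable_thetaC, ?_, ?_, ?_⟩
    · rw [thetaC, wronskian]; ring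
    · linear_combination -w * wronskian_thetaC (k := k) (w - s * w)
    · linear_combination -w * wronskian_thetaC_thetaB (k := k) (w - s * w)

lemma lifts_add_iff {l : ℂ} (hl : l ∈ periodLattice (tau k)) {z X₀ X₁ X₂ : ℂ} :
    Lifts k (z + l) X₀ X₁ X₂ ↔ Lifts k z X₀ X₁ X₂ := by
  refine Iff.of_eq (add_eq_of_mem_periodLattice (f := fun z ↦ Lifts k z X₀ X₁ X₂)
    (fun z ↦ ?_) (fun z ↦ ?_) hl z)
  · simp only [Lifts, thetaA_add_one, thetaB_add_one, thetaC_add_one]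
  · have hu := thetaFactor_ne_zero (k := k) z
    simp only [Lifts, thetaA_add_tau, thetaB_add_tau, thetaC_add_tau, mul_pow,
      mul_left_comm _ (thetaFactor k z), mul_left_comm _ (thetaFactor k z ^ 2), mul_assoc,
      ← mul_sub, mul_eq_zero, hu, pow_eq_zero_iff two_ne_zero, false_or]

lemma thetaB_zero : thetaB k 0 = 0 := by
  rw [thetaB, thetaNum, theta_eq_zero_iff.2 (zero_mem _), zero_mul, mul_zero]

lemma thetaB_half_period : thetaB k ((1 + tau k) / 2) = 0 := by
  rw [thetaB, thetaNum, sub_self, theta_eq_zero_iff.2 (zero_mem _), mul_zero, mul_zero]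

lemma mem_periodLattice_of_lifts_zero {w : ℂ}
    (h : Lifts k w (thetaA k 0) (thetaB k 0) (thetaC k 0)) : w ∈ periodLattice (tau k) := by
  have hA := h.thetaA_ne_zero thetaA_zero_ne_zero
  obtain ⟨h₁, h₂, -⟩ := h
  have hB : thetaB k w = 0 := by simpa [thetaB_zero, thetaA_zero_ne_zero (k := k)] using h₁
  rw [thetaB, mul_eq_zero_iff_left (thetaSign_ne_zero (k := k)), thetaNum, mul_eq_zero] at hB
  refine theta_eq_zero_iff.1 (hB.resolve_right fun hB ↦ ?_)
  -- The zeros `(1 + τ) / 2 + l` of `ζ` lie on the other sheet, with the opposite value of `η`.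
  have hl : Lifts k ((1 + tau k) / 2) 1 0 (-(I * ellK k / 2)) := by
    rw [Lifts, thetaB_half_period, thetaC_half_period]
    exact ⟨by ring, by ring, by ring⟩
  have hC := ((lifts_add_iff (theta_eq_zero_iff.1 hB)).2 hl).2.1
  rw [add_sub_cancel] at hC
  rw [thetaC_zero] at h₂
  have hne : I * ellK k * (thetaA k 0 * thetaA k w) ^ 2 ≠ 0 := by
    simp [(ellK_pos k).ne', hA, thetaA_zero_ne_zero (k := k)]
  exact hne (by linear_combination h₂ - thetaA k 0 ^ 2 * hC)

lemma mem_periodLattice_of_lifts {w z : ℂ}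
    (h : Lifts k w (thetaA k z) (thetaB k z) (thetaC k z)) : w - z ∈ periodLattice (tau k) := by
  have hl (s : ℝ) : HasDerivAt (fun s : ℝ ↦ w - s * z) (-4 * z / 4) s :=
    (((ofRealCLM.hasDerivAt (x := s)).mul_const z).const_sub w).congr_deriv <| by
      rw [ofRealCLM_apply, ofReal_one]; ring
  refine mem_periodLattice_of_lifts_zero ?_
  simpa using (isFlow_segment z).lifts hl (by simpa using h) (Set.right_mem_Icc.2 zero_le_one)

end

/-! ### Integrals along paths on the curve -/

section

open scoped ComplexOrder

lemma eq_smul_of_mul_eq_mul {ι 𝕜 : Type*} [Fintype ι] [RCLike 𝕜] {D V : ι → 𝕜} (hD : D ≠ 0)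
    (h : ∀ i j, D i * V j = D j * V i) : V = (star D ⬝ᵥ V / (star D ⬝ᵥ D)) • D := by
  have hDD : star D ⬝ᵥ D ≠ 0 := mt dotProduct_star_self_eq_zero.1 hD
  ext j
  rw [Pi.smul_apply, smul_eq_mul, div_mul_eq_mul_div, eq_div_iff hDD, dotProduct, dotProduct,
    Finset.mul_sum, Finset.sum_mul]
  exact Finset.sum_congr rfl fun i _ ↦ by linear_combination star D i * h i j

lemma exists_continuous_smul_eq_of_mul_eq_mul {ι 𝕜 : Type*} [Finite ι] [RCLike 𝕜] {a b : ℝ}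
    (hab : a ≤ b) {D V : ℝ → ι → 𝕜} (hD : ContinuousOn D (Set.Icc a b))
    (hV : ContinuousOn V (Set.Icc a b)) (hD₀ : ∀ s ∈ Set.Icc a b, D s ≠ 0)
    (h : ∀ s ∈ Set.Icc a b, ∀ i j, D s i * V s j = D s j * V s i) :
    ∃ α : ℝ → 𝕜, Continuous α ∧ ∀ s ∈ Set.Icc a b, V s = α s • D s := by
  cases nonempty_fintype ι
  let α₀ (s : ℝ) : 𝕜 := star (D s) ⬝ᵥ V s / (star (D s) ⬝ᵥ D s)
  have hα₀ : ContinuousOn α₀ (Set.Icc a b) := by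
    unfold α₀ dotProduct
    exact ContinuousOn.div (by fun_prop) (by fun_prop) fun s hs ↦
      mt dotProduct_star_self_eq_zero.1 (hD₀ s hs)
  refine ⟨Set.IccExtend hab ((Set.Icc a b).domRestrict α₀),
    (continuousOn_iff_continuous_domRestrict.1 hα₀).Icc_extend', fun s hs ↦ ?_⟩
  rw [Set.IccExtend_of_mem hab _ hs]
  exact eq_smul_of_mul_eq_mul (hD₀ s hs) (h s hs)

end

lemma countable_setOf_zero_of_deriv_ne_zero {E : Type*} [NormedAddCommGroup E] [NormedSpace ℝ E]
    (f : ℝ → E) : {s | f s = 0 ∧ deriv f s ≠ 0}.Countable := by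
  set S := {s | f s = 0 ∧ deriv f s ≠ 0}
  suffices hS : S ⊆ {s ∈ S | 𝓝[S ∩ Set.Ioi s] s = ⊥} from
    countable_setOfPred_isolated_right_within.mono hS
  refine fun s hs ↦ ⟨hs, ?_⟩
  have hne := (differentiableAt_of_deriv_ne_zero hs.2).hasDerivAt.eventually_ne (c := 0) hs.2
  have hne' : ∀ᶠ x in 𝓝[S ∩ Set.Ioi s] s, f x ≠ 0 :=
    hne.filter_mono (nhdsWithin_mono _ fun x hx ↦ ne_of_gt hx.2)
  rw [← empty_mem_iff_bot]
  filter_upwards [hne', self_mem_nhdsWithin] with x hx hxS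
  exact hx hxS.1.1

section

variable {k : ℝ}

lemma mul_comm_of_tangent {X Y Z a b c : ℂ} (hcurve : Z ^ 2 + curveForm k X Y = 0)
    (htangent : 2 * Z * c + (curvePartial k Y X * a + curvePartial k X Y * b) = 0) (i j : Fin 3) :
    let D := ![Z, -(curvePartial k X Y / 2), curvePartial k Y X / 2]
    let V := ![X * b - Y * a, X * c - 2 * Z * a, Y * c - 2 * Z * b]
    D i * V j = D j * V i := by
  have heuler := curvePartial_mul_add k X Y
  have h₀₁ : Z * (X * c - 2 * Z * a) = -(curvePartial k X Y / 2) * (X * b - Y * a) := by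
    linear_combination X / 2 * htangent - 2 * a * hcurve - a / 2 * heuler
  have h₀₂ : Z * (Y * c - 2 * Z * b) = curvePartial k Y X / 2 * (X * b - Y * a) := by
    linear_combination Y / 2 * htangent - 2 * b * hcurve - b / 2 * heuler
  have h₁₂ : -(curvePartial k X Y / 2) * (Y * c - 2 * Z * b) =
      curvePartial k Y X / 2 * (X * c - 2 * Z * a) := by
    linear_combination Z * htangent - 2 * c * hcurve - c / 2 * heuler
  intro D V
  fin_cases i <;> fin_cases j
  exacts [rfl, h₀₁, h₀₂, h₀₁.symm, rfl, h₁₂, h₀₂.symm, h₁₂.symm, rfl]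

variable [Fact (|k| < 1)]

lemma curveForm_branchPoint : curveForm k 1 (compl k + I * |k|) = 0 := by
  have hk : ((|k| : ℝ) : ℂ) ^ 2 = k ^ 2 := by rw [← ofReal_pow, sq_abs, ofReal_pow]
  have hc := ofReal_compl_sq (k := k)
  have hsq : ((compl k : ℂ) + I * |k|) ^ 2 = -modDiff k + 2 * I * (compl k * |k|) := by
    rw [modDiff]
    linear_combination I ^ 2 * hk + k ^ 2 * I_sq
  have hone : modDiff k ^ 2 + 4 * (compl k ^ 2 * k ^ 2) = 1 := by
    rw [modDiff, hc]
    ring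
  have hroot : ((compl k : ℂ) + I * |k|) ^ 4 +
      2 * modDiff k * ((compl k : ℂ) + I * |k|) ^ 2 + 1 = 0 := by
    rw [show ((compl k : ℂ) + I * |k|) ^ 4 = (((compl k : ℂ) + I * |k|) ^ 2) ^ 2 by ring, hsq]
    linear_combination -hone + 4 * (compl k : ℂ) ^ 2 * |k| ^ 2 * I_sq - 4 * compl k ^ 2 * hk
  rw [curveForm]
  linear_combination (ellK k : ℂ) ^ 2 / 4 * hroot

variable [NeZero k]

lemma modDiff_sq_ne_one : modDiff k ^ 2 ≠ 1 := by
  have hk : (k : ℂ) ≠ 0 := ofReal_ne_zero.2 (NeZero.ne k)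
  have hc : (compl k : ℂ) ≠ 0 := ofReal_ne_zero.2 compl_pos.ne'
  intro h
  refine mul_ne_zero (pow_ne_zero 2 hk) (pow_ne_zero 2 hc) ?_
  rw [modDiff, ofReal_compl_sq] at h
  rw [ofReal_compl_sq]
  linear_combination -h / 4

lemma curvePartial_ne_zero {X Y : ℂ} (h : X ≠ 0 ∨ Y ≠ 0) :
    curvePartial k X Y ≠ 0 ∨ curvePartial k Y X ≠ 0 := by
  have hK : (ellK k : ℂ) ^ 2 ≠ 0 := pow_ne_zero 2 (ofReal_ne_zero.2 (ellK_pos k).ne')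
  have hm : 1 - modDiff k ^ 2 ≠ 0 := sub_ne_zero.2 modDiff_sq_ne_one.symm
  contrapose! h
  obtain ⟨h₁, h₂⟩ := h
  rw [curvePartial, mul_eq_zero_iff_left hK] at h₁ h₂
  have hXY : (1 - modDiff k ^ 2) * (X * Y) ^ 3 = 0 := by
    linear_combination X ^ 3 * h₁ - modDiff k * X ^ 2 * Y * h₂
  rcases mul_eq_zero.1 (pow_eq_zero_iff three_ne_zero |>.1 ((mul_eq_zero_iff_left hm).1 hXY))
    with rfl | rfl
  · exact ⟨rfl, by simpa using h₁⟩
  · exact ⟨by simpa using h₂, rfl⟩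

lemma CurvePath.exists_isFlow (c : CurvePath k) : ∃ α, IsFlow k c.Z₀ c.Z₁ c.W α := by
  set S := Set.Icc (0 : ℝ) 1
  have hu : UniqueDiffOn ℝ S := uniqueDiffOn_Icc zero_lt_one
  have hderiv {f : ℝ → ℂ} (hf : ContDiffOn ℝ 1 f S) (s : ℝ) (hs : s ∈ S) :
      HasDerivWithinAt f (derivWithin f S s) S s :=
    (hf.differentiableOn one_ne_zero s hs).hasDerivWithinAt
  have ha := hderiv c.contDiffOn_Z₀
  have hb := hderiv c.contDiffOn_Z₁
  have he := hderiv c.contDiffOn_W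
  let D (s : ℝ) : Fin 3 → ℂ := ![c.W s, -(curvePartial k (c.Z₀ s) (c.Z₁ s) / 2),
    curvePartial k (c.Z₁ s) (c.Z₀ s) / 2]
  let V (s : ℝ) : Fin 3 → ℂ := ![c.Z₀ s * derivWithin c.Z₁ S s - c.Z₁ s * derivWithin c.Z₀ S s,
    c.Z₀ s * derivWithin c.W S s - 2 * c.W s * derivWithin c.Z₀ S s,
    c.Z₁ s * derivWithin c.W S s - 2 * c.W s * derivWithin c.Z₁ S s]
  have hD (s : ℝ) (hs : s ∈ S) : D s ≠ 0 := fun h ↦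
    (curvePartial_ne_zero (k := k) (c.ne_zero s hs)).elim
      (· (by simpa [D] using congrFun h 1)) (· (by simpa [D] using congrFun h 2))
  have hDV (s : ℝ) (hs : s ∈ S) (i j : Fin 3) : D s i * V s j = D s j * V s i := by
    have htangent := (hu s hs).eq_deriv _ (((he s hs).fun_pow 2).fun_add
      (hasDerivWithinAt_curveForm (k := k) (ha s hs) (hb s hs)))
      ((hasDerivWithinAt_const s S (0 : ℂ)).congr (fun x hx ↦ c.on_curve x hx) (c.on_curve s hs))
    exact mul_comm_of_tangent (c.on_curve s hs) (by simpa using htangent) i j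
  have ca := c.contDiffOn_Z₀.continuousOn_derivWithin hu le_rfl
  have cb := c.contDiffOn_Z₁.continuousOn_derivWithin hu le_rfl
  have ce := c.contDiffOn_W.continuousOn_derivWithin hu le_rfl
  have c₀ := c.contDiffOn_Z₀.continuousOn
  have c₁ := c.contDiffOn_Z₁.continuousOn
  have c₂ := c.contDiffOn_W.continuousOn
  obtain ⟨α, hα, hDV⟩ := exists_continuous_smul_eq_of_mul_eq_mul zero_le_one (D := D) (V := V)
    (by unfold D curvePartial; fun_prop) (by unfold V; fun_prop) hD hDV
  exact ⟨α, c.ne_zero, hα, fun s hs ↦ ⟨_, _, _, ha s hs, hb s hs, he s hs,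
    congrFun (hDV s hs) 0, congrFun (hDV s hs) 1, congrFun (hDV s hs) 2⟩⟩

lemma IsFlow.dzetaOverEta_ae_eq {c : CurvePath k} {α : ℝ → ℂ} (h : IsFlow k c.Z₀ c.Z₁ c.W α) :
    ∀ᵐ s, s ∈ Set.uIoc (0 : ℝ) 1 → c.dzetaOverEta s = α s := by
  rw [Set.uIoc_of_le zero_le_one]
  filter_upwards [(countable_setOf_zero_of_deriv_ne_zero c.W).ae_notMem volume,
    (Set.countable_singleton (1 : ℝ)).ae_notMem volume] with s hW h₁ hs
  have hnhds : Set.Icc (0 : ℝ) 1 ∈ 𝓝 s := Icc_mem_nhds hs.1 (lt_of_le_of_ne hs.2 h₁)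
  have hs' := Set.Ioc_subset_Icc_self hs
  obtain ⟨a, b, e, ha, hb, he, h₀₁, h₀, h₁⟩ := h.exists_deriv s hs'
  rw [CurvePath.dzetaOverEta, (ha.hasDerivAt hnhds).deriv, (hb.hasDerivAt hnhds).deriv, h₀₁]
  by_cases hW₀ : c.W s = 0
  · have he₀ : e = 0 := by
      by_contra he₀
      exact hW ⟨hW₀, by rwa [(he.hasDerivAt hnhds).deriv]⟩
    rw [hW₀, he₀] at h₀ h₁
    suffices hα : α s = 0 by rw [hα, zero_mul, zero_div]
    rcases curvePartial_ne_zero (k := k) (c.ne_zero s hs') with hP | hP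
    · exact (mul_eq_zero.1 (by linear_combination 2 * h₀)).resolve_right hP
    · exact (mul_eq_zero.1 (by linear_combination -2 * h₁)).resolve_right hP
  · exact mul_div_cancel_right₀ _ hW₀

lemma CurvePath.exists_lift (c : CurvePath k) {w : ℂ} (h₀ : Lifts k w (c.Z₀ 0) (c.Z₁ 0) (c.W 0)) :
    ∃ z α : ℝ → ℂ, Continuous α ∧ (∀ s, HasDerivAt z (α s / 4) s) ∧ z 0 = w ∧
      z 1 = w + c.intV ∧ (∀ s ∈ Set.Icc (0 : ℝ) 1, Lifts k (z s) (c.Z₀ s) (c.Z₁ s) (c.W s)) ∧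
      ∀ᵐ s, s ∈ Set.uIoc (0 : ℝ) 1 → c.dzetaOverEta s = α s := by
  obtain ⟨α, hα⟩ := c.exists_isFlow
  let z (s : ℝ) : ℂ := w + ∫ t in (0 : ℝ)..s, α t / 4
  have hz (s : ℝ) : HasDerivAt z (α s / 4) s :=
    ((hα.continuous.div_const 4).integral_hasStrictDerivAt 0 s).hasDerivAt.const_add w
  have hz₀ : z 0 = w := by simp [z]
  have hz₁ : w + c.intV = z 1 := congrArg (w + ·) <| intervalIntegral.integral_congr_ae <|
    hα.dzetaOverEta_ae_eq.mono fun s h hs ↦ congrArg (· / 4) (h hs)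
  exact ⟨z, α, hα.continuous, hz, hz₀, hz₁.symm,
    fun s hs ↦ hα.lifts hz (by rwa [hz₀]) hs, hα.dzetaOverEta_ae_eq⟩

lemma CurvePath.lifts_intV (c : CurvePath k) {w : ℂ} (h₀ : Lifts k w (c.Z₀ 0) (c.Z₁ 0) (c.W 0)) :
    Lifts k (w + c.intV) (c.Z₀ 1) (c.Z₁ 1) (c.W 1) := by
  obtain ⟨z, α, -, -, -, hz₁, hl, -⟩ := c.exists_lift h₀
  exact hz₁ ▸ hl 1 (Set.right_mem_Icc.2 zero_le_one)

lemma CurvePath.intGamma_eq {c : CurvePath k} (hc : c.AvoidsInfty) {w : ℂ}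
    (h₀ : Lifts k w (c.Z₀ 0) (c.Z₁ 0) (c.W 0)) :
    c.intGamma = logDeriv (thetaA k) (w + c.intV) / 4 - logDeriv (thetaA k) w / 4 := by
  obtain ⟨z, α, hα, hz, hz₀, hz₁, hl, hae⟩ := c.exists_lift h₀
  have hA (s : ℝ) (hs : s ∈ Set.Icc (0 : ℝ) 1) : thetaA k (z s) ≠ 0 :=
    (hl s hs).thetaA_ne_zero (hc s hs)
  have hzc : Continuous z := continuous_iff_continuousAt.2 fun s ↦ (hz s).continuousAt
  have hAc : Continuous fun s ↦ thetaA k (z s) := differentiable_thetaA.continuous.comp hzc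
  have hBc : Continuous fun s ↦ thetaB k (z s) := differentiable_thetaB.continuous.comp hzc
  have huIcc := Set.uIcc_of_le (zero_le_one (α := ℝ))
  rw [← hz₁, ← hz₀, ← intervalIntegral.integral_eq_sub_of_hasDerivAt (a := 0) (b := 1)
    (f := fun s ↦ logDeriv (thetaA k) (z s) / 4) (f' := fun s ↦ (ellK k : ℂ) ^ 2 *
      ((thetaB k (z s) / thetaA k (z s)) ^ 2 - (2 * (ellE k : ℂ) - ellK k) / ellK k) * (α s / 4))]
  · refine intervalIntegral.integral_congr_ae ?_
    filter_upwards [hae] with s h hs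
    have hs' := huIcc ▸ Set.uIoc_subset_uIcc hs
    rw [h hs, (hl s hs').div_eq (hc s hs')]
    ring
  · intro s hs
    exact (hasDerivAt_logDeriv_thetaA_div_four (hA s (huIcc ▸ hs))).comp s (hz s)
  · refine ContinuousOn.intervalIntegrable ?_
    rw [huIcc]
    have hζ := hBc.continuousOn.div hAc.continuousOn hA
    exact (((hζ.pow 2).sub continuousOn_const).const_smul ((ellK k : ℂ) ^ 2)).mul
      (hα.div_const 4).continuousOn

lemma thetaA_half : thetaA k (1 / 2) = 0 := by
  rw [thetaA, sub_self, theta_eq_zero_iff.2 (zero_mem _), zero_mul]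

lemma thetaA_half_tau : thetaA k (tau k / 2) = 0 := by
  rw [thetaA, sub_self, theta_eq_zero_iff.2 (zero_mem _), mul_zero]

lemma CurvePath.IsAtInftyOne.lifts {c : CurvePath k} {s : ℝ} (h : c.IsAtInftyOne s) :
    Lifts k (1 / 2) (c.Z₀ s) (c.Z₁ s) (c.W s) := by
  rw [Lifts, h.1, h.2, thetaA_half, thetaC_half]
  exact ⟨by ring, by ring, by ring⟩

lemma lifts_branchPoint : Lifts k ((1 - tau k) / 4) 1 (compl k + I * |k|) 0 := by
  have hre : 4 * ellK k * ((1 - tau k) / 4).re = ellK k := by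
    rw [div_ofNat_re, sub_re, tau_re, one_re]; ring
  have him : 4 * ellK k * ((1 - tau k) / 4).im = -ellK (compl k) := by
    rw [← ellK_mul_tau_im, div_ofNat_im, sub_im, one_im]; ring
  have hneg : -ellK (compl k) + 2 * ellK (compl k) = ellK (compl k) := by ring
  have hsn : sn (compl k) (-ellK (compl k)) = -1 := by
    rw [← neg_eq_iff_eq_neg, ← sn_add, hneg, sn_ellK]
  have hdn : dn (compl k) (-ellK (compl k)) = |k| := by
    rw [← dn_add, hneg, dn_compl_ellK_compl]
  have hdn' : dn k (ellK k) = compl k := by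
    rw [dn, amplitude_ellK, ellDelta, Real.sin_pi_div_two, one_pow, mul_one, compl]
  have hden : zetaDen k ((1 - tau k) / 4) = 1 := by
    rw [zetaDen, cnRe, hre, cn_ellK]; simp
  have hζ : zetaFun k ((1 - tau k) / 4) = compl k + I * |k| := by
    rw [zetaFun, hden, snRe, dnRe, snIm, dnIm, hre, him, hsn, hdn, hdn', sn_ellK]
    push_cast
    ring
  have hB := zetaFun_mul_thetaA (k := k) (z := (1 - tau k) / 4) (by rw [hden]; exact one_ne_zero)
  rw [hζ] at hB
  have hC : thetaC k ((1 - tau k) / 4) = 0 := by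
    have h := thetaC_sq_add_curveForm (k := k) ((1 - tau k) / 4)
    rw [← hB, mul_comm _ (thetaA k _), ← mul_one (thetaA k _), mul_assoc, one_mul, curveForm_mul,
      curveForm_branchPoint, mul_zero, add_zero] at h
    exact pow_eq_zero_iff two_ne_zero |>.1 h
  rw [Lifts, ← hB, hC]
  exact ⟨by ring, by ring, by ring⟩

end

/-! ### The theta function cutting out the mini-twistor section -/

/-- The homogeneous form of the section `η = a - b ζ - e ζ²`. -/
def sectionForm (a b e X Y : ℂ) : ℂ := a * X ^ 2 - b * (X * Y) - e * Y ^ 2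

/-- The function `W - (a Z₀² - b Z₀ Z₁ - e Z₁²)`, pulled back to the plane. Its zeros are the
points at which the curve meets the section `η = a - b ζ - e ζ²`. -/
def incidence (k : ℝ) (a b e z : ℂ) : ℂ := thetaC k z - sectionForm a b e (thetaA k z) (thetaB k z)

/-- The theta function which vanishes at the points over `ζ = x`. -/
def thetaFiber (k : ℝ) (x z : ℂ) : ℂ := thetaB k z - x * thetaA k z

/-- The `ζ i` are the solutions, with multiplicity, of the quartic obtained by restricting
`η = a - b ζ - e ζ²` to the curve. -/
def IsFactored (k : ℝ) (a b e : ℂ) (ζ : Fin 4 → ℂ) : Prop :=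
  ∀ x, sectionForm a b e 1 x ^ 2 + curveForm k 1 x =
    (e ^ 2 + (ellK k : ℂ) ^ 2 / 4) * ∏ i, (x - ζ i)

section

variable {k : ℝ} {a b e : ℂ} {ζ : Fin 4 → ℂ}

lemma sectionForm_mul (a b e c X Y : ℂ) :
    sectionForm a b e (c * X) (c * Y) = c ^ 2 * sectionForm a b e X Y := by
  rw [sectionForm, sectionForm]; ring

lemma IsFactored.homogeneous (h : IsFactored k a b e ζ) (X Y : ℂ) :
    sectionForm a b e X Y ^ 2 + curveForm k X Y =
      (e ^ 2 + (ellK k : ℂ) ^ 2 / 4) * ∏ i, (Y - ζ i * X) := by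
  rcases eq_or_ne X 0 with rfl | hX
  · simp only [sectionForm, curveForm, mul_zero, sub_zero, Fin.prod_const]
    ring
  · obtain ⟨y, rfl⟩ : ∃ y, Y = X * y := ⟨Y / X, (mul_div_cancel₀ Y hX).symm⟩
    have hprod : ∏ i, (X * y - ζ i * X) = X ^ 4 * ∏ i, (y - ζ i) := by
      rw [← Fin.prod_const, ← Finset.prod_mul_distrib]
      exact Finset.prod_congr rfl fun i _ ↦ by ring
    have hS := sectionForm_mul a b e X 1 y
    have hQ := curveForm_mul k X 1 y
    rw [mul_one] at hS hQ
    rw [hprod, hS, hQ]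
    linear_combination X ^ 4 * h y

lemma IsFactored.sum_eq (h : IsFactored k a b e ζ) :
    (e ^ 2 + (ellK k : ℂ) ^ 2 / 4) * ∑ i, ζ i = -2 * b * e := by
  have h₁ := h 1
  have h₂ := h (-1)
  have h₃ := h 2
  have h₄ := h (-2)
  simp only [sectionForm, curveForm, Fin.prod_univ_four, Fin.sum_univ_four] at h₁ h₂ h₃ h₄ ⊢
  linear_combination (h₃ - h₄ - 2 * h₁ + 2 * h₂) / 12

lemma lifts_sectionForm_iff {w x : ℂ} : Lifts k w 1 x (sectionForm a b e 1 x) ↔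
    thetaFiber k x w = 0 ∧ incidence k a b e w = 0 := by
  refine ⟨fun ⟨h₁, h₂, _⟩ ↦ ?_, fun ⟨h₁, h₂⟩ ↦ ?_⟩
  · have hB : thetaB k w = thetaA k w * x := by linear_combination h₁
    have hS := sectionForm_mul a b e (thetaA k w) 1 x
    rw [mul_one] at hS
    rw [thetaFiber, incidence, hB, hS]
    exact ⟨by ring, by linear_combination -h₂⟩
  · have hB : thetaB k w = thetaA k w * x := by rw [thetaFiber] at h₁; linear_combination h₁
    have hS := sectionForm_mul a b e (thetaA k w) 1 x
    rw [mul_one] at hS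
    rw [incidence, sub_eq_zero, hB, hS] at h₂
    rw [Lifts, hB, h₂]
    exact ⟨by ring, by ring, by ring⟩

lemma incidence_neg (a b e w : ℂ) :
    incidence k (-a) (-b) (-e) w = 2 * thetaC k w - incidence k a b e w := by
  rw [incidence, incidence, sectionForm, sectionForm]; ring

variable [Fact (|k| < 1)] [NeZero k]

lemma differentiable_sectionForm_theta (a b e : ℂ) :
    Differentiable ℂ fun z ↦ sectionForm a b e (thetaA k z) (thetaB k z) := by
  unfold sectionForm; fun_prop

@[fun_prop]
lemma differentiable_incidence (a b e : ℂ) : Differentiable ℂ (incidence k a b e) :=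
  differentiable_thetaC.sub (differentiable_sectionForm_theta a b e)

@[fun_prop]
lemma differentiable_thetaFiber (x : ℂ) : Differentiable ℂ (thetaFiber k x) := by
  unfold thetaFiber; fun_prop

lemma incidence_add_one (a b e z : ℂ) : incidence k a b e (z + 1) = incidence k a b e z := by
  rw [incidence, incidence, thetaA_add_one, thetaB_add_one, thetaC_add_one]

lemma incidence_add_tau (a b e z : ℂ) :
    incidence k a b e (z + tau k) = thetaFactor k z ^ 2 * incidence k a b e z := by
  rw [incidence, incidence, thetaA_add_tau, thetaB_add_tau, thetaC_add_tau, sectionForm_mul,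
    mul_sub]

lemma Lifts.sub_mem_periodLattice_iff {w z x y : ℂ} (hz : Lifts k z 1 x y) :
    w - z ∈ periodLattice (tau k) ↔ Lifts k w 1 x y := by
  refine ⟨fun hl ↦ by simpa using (lifts_add_iff hl).2 hz, fun hw ↦ ?_⟩
  have hB : x * thetaA k z = thetaB k z := by linear_combination -hz.1
  have hC : y * thetaA k z ^ 2 = thetaC k z := by linear_combination hz.2.1
  have h := hw.smul (thetaA k z)
  rw [hB, hC] at h
  exact mem_periodLattice_of_lifts h

lemma thetaA_ne_zero_of_thetaFiber {w x : ℂ} (h : thetaFiber k x w = 0) : thetaA k w ≠ 0 := by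
  intro hA
  refine (thetaA_ne_zero_or_thetaB_ne_zero w).elim (· hA) (· ?_)
  rwa [thetaFiber, hA, mul_zero, sub_zero] at h

lemma deriv_thetaFiber_mul {w x : ℂ} (h : thetaFiber k x w = 0) :
    deriv (thetaFiber k x) w * thetaA k w = 4 * thetaC k w := by
  have hd : deriv (thetaFiber k x) w = deriv (thetaB k) w - x * deriv (thetaA k) w :=
    (differentiable_thetaB.differentiableAt.hasDerivAt.sub
      (differentiable_thetaA.differentiableAt.hasDerivAt.const_mul x)).deriv
  rw [hd, thetaC, wronskian]
  rw [thetaFiber] at h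
  linear_combination deriv (thetaA k) w * h

open Classical in
lemma analyticOrderAt_thetaFiber {w : ℂ} (hC : thetaC k w ≠ 0) (x : ℂ) :
    analyticOrderAt (thetaFiber k x) w = if thetaFiber k x w = 0 then 1 else 0 := by
  have han := (differentiable_thetaFiber (k := k) x).analyticAt w
  split_ifs with h
  · refine han.analyticOrderAt_eq_one_of_zero_deriv_ne_zero h fun h' ↦ hC ?_
    have := deriv_thetaFiber_mul h
    rw [h', zero_mul] at this
    linear_combination -this / 4
  · exact han.analyticOrderAt_eq_zero.2 h

/-- Over a branch point the coordinate `ζ` is ramified. -/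
lemma two_le_analyticOrderAt_thetaFiber {w x : ℂ} (hC : thetaC k w = 0)
    (h : thetaFiber k x w = 0) : 2 ≤ analyticOrderAt (thetaFiber k x) w := by
  refine two_le_analyticOrderAt ((differentiable_thetaFiber x).analyticAt w) h ?_
  refine (mul_eq_zero.1 ?_).resolve_right (thetaA_ne_zero_of_thetaFiber h)
  rw [deriv_thetaFiber_mul h, hC, mul_zero]

lemma deriv_incidence (a b e w : ℂ) : deriv (incidence k a b e) w = deriv (thetaC k) w -
    ((2 * a * thetaA k w - b * thetaB k w) * deriv (thetaA k) w -
      (b * thetaA k w + 2 * e * thetaB k w) * deriv (thetaB k) w) := by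
  have hA := (differentiable_thetaA (k := k) w).hasDerivAt
  have hB := (differentiable_thetaB (k := k) w).hasDerivAt
  have hS := (((hA.fun_pow 2).const_mul a).fun_sub ((hA.fun_mul hB).const_mul b)).fun_sub
    ((hB.fun_pow 2).const_mul e)
  rw [show incidence k a b e = fun z ↦ thetaC k z - (a * thetaA k z ^ 2 -
    b * (thetaA k z * thetaB k z) - e * thetaB k z ^ 2) from rfl,
    ((differentiable_thetaC (k := k) w).hasDerivAt.fun_sub hS).deriv]
  push_cast
  ring

lemma deriv_incidence_mul (a b e w : ℂ) : deriv (incidence k a b e) w * thetaA k w =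
    2 * deriv (thetaA k) w * incidence k a b e w - 2 * curvePartial k (thetaA k w) (thetaB k w) +
      4 * thetaC k w * (b * thetaA k w + 2 * e * thetaB k w) := by
  have hwr := wronskian_thetaC (k := k) w
  have hC : 4 * thetaC k w = thetaA k w * deriv (thetaB k) w - deriv (thetaA k) w * thetaB k w := by
    rw [thetaC, wronskian]; ring
  rw [deriv_incidence, incidence, sectionForm]
  linear_combination hwr - (b * thetaA k w + 2 * e * thetaB k w) * hC

lemma curvePartial_theta_ne_zero {w : ℂ} (hA : thetaA k w ≠ 0) (hC : thetaC k w = 0) :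
    curvePartial k (thetaA k w) (thetaB k w) ≠ 0 := by
  intro h
  have hQ := thetaC_sq_add_curveForm (k := k) w
  rw [hC, zero_pow two_ne_zero, zero_add] at hQ
  have hE := curvePartial_mul_add k (thetaA k w) (thetaB k w)
  rw [hQ, h, zero_mul, add_zero, mul_zero] at hE
  exact (curvePartial_ne_zero (thetaA_ne_zero_or_thetaB_ne_zero w)).elim (· h)
    (· ((mul_eq_zero.1 hE).resolve_right hA))

lemma analyticOrderAt_incidence_of_thetaC_eq_zero {w : ℂ} (hA : thetaA k w ≠ 0)
    (hC : thetaC k w = 0) (h : incidence k a b e w = 0) :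
    analyticOrderAt (incidence k a b e) w = 1 := by
  refine ((differentiable_incidence a b e).analyticAt
    w).analyticOrderAt_eq_one_of_zero_deriv_ne_zero h fun hd ↦ curvePartial_theta_ne_zero hA hC ?_
  have := deriv_incidence_mul (k := k) a b e w
  rw [hd, h, hC] at this
  linear_combination this / 2

lemma incidence_mul_incidence_neg (h : IsFactored k a b e ζ) (w : ℂ) :
    incidence k a b e w * incidence k (-a) (-b) (-e) w =
      -(e ^ 2 + (ellK k : ℂ) ^ 2 / 4) * ∏ i, thetaFiber k (ζ i) w := by
  have hprod := h.homogeneous (thetaA k w) (thetaB k w)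
  rw [incidence_neg, incidence]
  unfold thetaFiber
  linear_combination thetaC_sq_add_curveForm (k := k) w - hprod

lemma exists_thetaFiber_eq_zero (h : IsFactored k a b e ζ)
    (he : e ^ 2 + (ellK k : ℂ) ^ 2 / 4 ≠ 0) {w : ℂ} (hw : incidence k a b e w = 0) :
    ∃ i, thetaFiber k (ζ i) w = 0 := by
  have hprod := incidence_mul_incidence_neg h w
  rw [hw, zero_mul, eq_comm, mul_eq_zero, or_iff_right (neg_ne_zero.2 he)] at hprod
  simpa using Finset.prod_eq_zero_iff.1 hprod

lemma analyticOrderAt_incidence_add (h : IsFactored k a b e ζ)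
    (he : e ^ 2 + (ellK k : ℂ) ^ 2 / 4 ≠ 0) (w : ℂ) :
    analyticOrderAt (incidence k a b e) w + analyticOrderAt (incidence k (-a) (-b) (-e)) w =
      ∑ i, analyticOrderAt (thetaFiber k (ζ i)) w := by
  have han (i : Fin 4) : AnalyticAt ℂ (thetaFiber k (ζ i)) w :=
    (differentiable_thetaFiber (ζ i)).analyticAt w
  rw [← analyticOrderAt_mul ((differentiable_incidence a b e).analyticAt w)
    ((differentiable_incidence _ _ _).analyticAt w), show incidence k a b e *
      incidence k (-a) (-b) (-e) = (fun _ ↦ -(e ^ 2 + (ellK k : ℂ) ^ 2 / 4)) *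
      ∏ i, thetaFiber k (ζ i) from _root_.funext fun z ↦ by
        simp only [Pi.mul_apply, Finset.prod_apply, incidence_mul_incidence_neg h],
    analyticOrderAt_mul analyticAt_const (Finset.univ.analyticAt_prod fun i _ ↦ han i),
    analyticAt_const.analyticOrderAt_eq_zero.2 (neg_ne_zero.2 he), zero_add,
    analyticOrderAt_finset_prod _ fun i _ ↦ han i]

open Classical in
lemma sum_thetaFiber_eq_one (h : IsFactored k a b e ζ) (he : e ^ 2 + (ellK k : ℂ) ^ 2 / 4 ≠ 0)
    {w : ℂ} (hw : incidence k a b e w = 0) (hC : thetaC k w = 0) :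
    ∑ i, (if thetaFiber k (ζ i) w = 0 then 1 else 0 : ℕ∞) = 1 := by
  obtain ⟨i, hi⟩ := exists_thetaFiber_eq_zero h he hw
  have hA := thetaA_ne_zero_of_thetaFiber hi
  have hsum := analyticOrderAt_incidence_add h he w
  rw [analyticOrderAt_incidence_of_thetaC_eq_zero hA hC hw,
    analyticOrderAt_incidence_of_thetaC_eq_zero hA hC
      (by rw [incidence_neg, hC, hw, mul_zero, sub_zero])] at hsum
  have hle (i : Fin 4) : 2 * (if thetaFiber k (ζ i) w = 0 then 1 else 0 : ℕ∞) ≤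
      analyticOrderAt (thetaFiber k (ζ i)) w := by
    split_ifs with hi
    · exact (mul_one _).trans_le (two_le_analyticOrderAt_thetaFiber hC hi)
    · exact (mul_zero _).trans_le zero_le
  have htwo := Finset.sum_le_sum fun i (_ : i ∈ Finset.univ) ↦ hle i
  have hpos : 0 < (Finset.univ.filter fun i ↦ thetaFiber k (ζ i) w = 0).card :=
    Finset.card_pos.2 ⟨i, by simpa using hi⟩
  rw [← Finset.mul_sum, ← hsum, one_add_one_eq_two, Finset.sum_boole] at htwo
  rw [Finset.sum_boole]
  norm_cast at htwo ⊢
  omega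

open Classical in
lemma analyticOrderAt_incidence_of_eq_zero (h : IsFactored k a b e ζ)
    (he : e ^ 2 + (ellK k : ℂ) ^ 2 / 4 ≠ 0) {w : ℂ} (hw : incidence k a b e w = 0) :
    analyticOrderAt (incidence k a b e) w =
      ∑ i, if thetaFiber k (ζ i) w = 0 then 1 else 0 := by
  by_cases hC : thetaC k w = 0
  · obtain ⟨i, hi⟩ := exists_thetaFiber_eq_zero h he hw
    rw [sum_thetaFiber_eq_one h he hw hC, analyticOrderAt_incidence_of_thetaC_eq_zero
      (thetaA_ne_zero_of_thetaFiber hi) hC hw]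
  · have hneg : analyticOrderAt (incidence k (-a) (-b) (-e)) w = 0 := by
      refine ((differentiable_incidence _ _ _).analyticAt w).analyticOrderAt_eq_zero.2 ?_
      rw [incidence_neg, hw, sub_zero]
      exact mul_ne_zero two_ne_zero hC
    have hsum := analyticOrderAt_incidence_add h he w
    rwa [hneg, add_zero, Finset.sum_congr rfl fun i _ ↦ analyticOrderAt_thetaFiber hC (ζ i)] at hsum

open Classical in
lemma analyticOrderAt_incidence (h : IsFactored k a b e ζ)
    (he : e ^ 2 + (ellK k : ℂ) ^ 2 / 4 ≠ 0) {z : Fin 4 → ℂ}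
    (hz : ∀ i, Lifts k (z i) 1 (ζ i) (sectionForm a b e 1 (ζ i))) (w : ℂ) :
    analyticOrderAt (incidence k a b e) w =
      ∑ i, if w - z i ∈ periodLattice (tau k) then 1 else 0 := by
  simp only [fun i ↦ (hz i).sub_mem_periodLattice_iff (w := w), lifts_sectionForm_iff]
  by_cases hw : incidence k a b e w = 0
  · simp only [hw, and_true, analyticOrderAt_incidence_of_eq_zero h he hw]
  · simp only [hw, and_false, if_false, Finset.sum_const_zero,
      ((differentiable_incidence a b e).analyticAt w).analyticOrderAt_eq_zero.2 hw]

end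

/-! ### Abel's theorem for the mini-twistor section -/

/-- The theta function with zeros at the points `z i` and their translates. -/
def thetaProd {ι : Type*} [Fintype ι] (τ : ℂ) (z : ι → ℂ) (w : ℂ) : ℂ := ∏ i, theta τ (w - z i)

section

variable {ι : Type*} [Fintype ι] {τ : ℂ}

lemma thetaProd_add_one (z : ι → ℂ) (w : ℂ) : thetaProd τ z (w + 1) = thetaProd τ z w := by
  simp only [thetaProd, add_sub_right_comm, theta_add_one]

variable [Fact (0 < τ.im)]

@[fun_prop]
lemma differentiable_thetaProd (z : ι → ℂ) : Differentiable ℂ (thetaProd τ z) := by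
  unfold thetaProd; fun_prop

open Classical in
lemma analyticOrderAt_thetaProd (z : ι → ℂ) (w : ℂ) :
    analyticOrderAt (thetaProd τ z) w = ∑ i, if w - z i ∈ periodLattice τ then 1 else 0 := by
  have hd (i : ι) : Differentiable ℂ fun w ↦ theta τ (w - z i) := by fun_prop
  rw [show thetaProd τ z = ∏ i, fun w ↦ theta τ (w - z i) from _root_.funext fun w ↦ by
      rw [Finset.prod_apply, thetaProd],
    analyticOrderAt_finset_prod _ fun i _ ↦ (hd i).analyticAt w]
  simp only [analyticOrderAt_theta_sub]

lemma analyticOrderAt_thetaProd_ne_top (z : ι → ℂ) (w : ℂ) :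
    analyticOrderAt (thetaProd τ z) w ≠ ⊤ := by
  classical
  rw [analyticOrderAt_thetaProd, Finset.sum_boole]
  exact ENat.natCast_ne_top _

lemma thetaProd_add_tau (z : ι → ℂ) (w : ℂ) : thetaProd τ z (w + τ) =
    (-1) ^ Fintype.card ι * expTwoPi (∑ i, z i - Fintype.card ι * w) * thetaProd τ z w := by
  have hexp : ∏ i, expTwoPi (-(w - z i)) = expTwoPi (∑ i, z i - Fintype.card ι * w) := by
    simp only [expTwoPi, ← Complex.exp_sum, ← Finset.mul_sum, neg_sub, Finset.sum_sub_distrib,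
      Finset.sum_const, Finset.card_univ, nsmul_eq_mul]
  simp only [thetaProd, add_sub_right_comm, theta_add_tau, Finset.prod_mul_distrib,
    Finset.prod_neg, Finset.card_univ, hexp]

lemma logDeriv_thetaProd {z : ι → ℂ} {w : ℂ} (hw : thetaProd τ z w ≠ 0) :
    logDeriv (thetaProd τ z) w = ∑ i, logDeriv (theta τ) (w - z i) := by
  unfold thetaProd
  rw [logDeriv_prod (fun i hi ↦ Finset.prod_ne_zero_iff.1 hw i hi) (fun i _ ↦ by fun_prop)]
  simp only [sub_eq_add_neg, logDeriv_comp_add_const]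

end

section

variable {k : ℝ} {a b e : ℂ} {ζ z : Fin 4 → ℂ}

lemma thetaFactor_sq (k : ℝ) (w : ℂ) : thetaFactor k w ^ 2 = expTwoPi (tau k - 4 * w) := by
  rw [thetaFactor, neg_sq, sq, ← expTwoPi_add]
  ring_nf

variable [Fact (|k| < 1)] [NeZero k]

lemma exists_incidence_eq (h : IsFactored k a b e ζ) (he : e ^ 2 + (ellK k : ℂ) ^ 2 / 4 ≠ 0)
    (hz : ∀ i, Lifts k (z i) 1 (ζ i) (sectionForm a b e 1 (ζ i))) :
    ∃ n m : ℤ, ∃ c : ℂ, ∑ i, z i = (1 - n) * tau k - m ∧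
      ∀ w, incidence k a b e w = c * expTwoPi (n * w) * thetaProd (tau k) z w := by
  classical
  obtain ⟨n, m, c, hs, hexp⟩ := exists_eq_mul_expTwoPi_mul (τ := tau k) (s := tau k - ∑ i, z i)
    (u := fun w ↦ expTwoPi (∑ i, z i - 4 * w)) (differentiable_incidence a b e)
    (differentiable_thetaProd (τ := tau k) z) (analyticOrderAt_thetaProd_ne_top (τ := tau k) z)
    (fun w ↦ by rw [analyticOrderAt_incidence h he hz, analyticOrderAt_thetaProd])
    (incidence_add_one a b e) (thetaProd_add_one (τ := tau k) z) (fun w ↦ expTwoPi_ne_zero _)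
    (fun w ↦ by rw [incidence_add_tau, thetaFactor_sq, ← expTwoPi_add]; ring_nf)
    (fun w ↦ by rw [thetaProd_add_tau, Fintype.card_fin]; norm_num)
  exact ⟨n, m, c, by linear_combination -hs, hexp⟩

lemma logDeriv_incidence {n : ℤ} {c : ℂ}
    (h : ∀ w, incidence k a b e w = c * expTwoPi (n * w) * thetaProd (tau k) z w) {w : ℂ}
    (hw : incidence k a b e w ≠ 0) :
    logDeriv (incidence k a b e) w =
      2 * Real.pi * I * n + ∑ i, logDeriv (theta (tau k)) (w - z i) := by
  rw [h w] at hw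
  have hT := right_ne_zero_of_mul hw
  have hE := left_ne_zero_of_mul hw
  have hexp : HasDerivAt (fun w ↦ expTwoPi (n * w)) (2 * Real.pi * I * expTwoPi (n * w) * n) w :=
    (hasDerivAt_expTwoPi (n * w)).comp w (hasDerivAt_const_mul (n : ℂ))
  rw [_root_.funext h, logDeriv_mul w hE hT (hexp.differentiableAt.const_mul c)
    (differentiable_thetaProd z w), logDeriv_const_mul _ _ (left_ne_zero_of_mul hE),
    logDeriv_thetaProd hT, logDeriv_apply, hexp.deriv, mul_right_comm,
    mul_div_cancel_right₀ _ (expTwoPi_ne_zero _)]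

end

/-! ### Logarithmic derivatives at the points over infinity -/

section

variable {τ : ℂ} [Fact (0 < τ.im)]

lemma half_notMem_periodLattice : (1 / 2 : ℂ) ∉ periodLattice τ := by
  rw [show (1 / 2 : ℂ) = (0 : ℝ) * τ + (1 / 2 : ℝ) by push_cast; ring,
    mem_periodLattice_iff_of_real]
  exact fun ⟨_, n, hn⟩ ↦ half_ne_intCast n hn

lemma half_tau_notMem_periodLattice : τ / 2 ∉ periodLattice τ := by
  rw [show τ / 2 = (1 / 2 : ℝ) * τ + (0 : ℝ) by push_cast; ring, mem_periodLattice_iff_of_real]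
  exact fun ⟨⟨m, hm⟩, _⟩ ↦ half_ne_intCast m hm

lemma quarter_notMem_periodLattice : (1 + τ) / 4 ∉ periodLattice τ := by
  rw [show (1 + τ) / 4 = (1 / 4 : ℝ) * τ + (1 / 4 : ℝ) by push_cast; ring,
    mem_periodLattice_iff_of_real]
  exact fun ⟨⟨m, hm⟩, _⟩ ↦ half_ne_intCast (2 * m) (by push_cast; linarith)

lemma logDeriv_theta_half : logDeriv (theta τ) (1 / 2) = Real.pi * I := by
  have hneg := logDeriv_theta_neg (half_notMem_periodLattice (τ := τ))
  have hadd := logDeriv_theta_add_one τ (-(1 / 2))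
  rw [show -(1 / 2 : ℂ) + 1 = 1 / 2 by ring, hneg] at hadd
  linear_combination hadd / 2

lemma logDeriv_theta_half_tau : logDeriv (theta τ) (τ / 2) = 0 := by
  have hneg := logDeriv_theta_neg (half_tau_notMem_periodLattice (τ := τ))
  have hadd := logDeriv_theta_add_tau (neg_mem_iff.not.2 (half_tau_notMem_periodLattice (τ := τ)))
  rw [show -(τ / 2) + τ = τ / 2 by ring, hneg] at hadd
  linear_combination hadd / 2

end

section

variable {k : ℝ}

lemma logDeriv_thetaA_add_int (z : ℂ) (m : ℤ) :
    logDeriv (thetaA k) (z + m) = logDeriv (thetaA k) z := by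
  have h : Function.Periodic (logDeriv (thetaA k)) 1 := logDeriv_thetaA_add_one
  simpa using h.int_mul m z

variable [Fact (|k| < 1)] [NeZero k]

lemma logDeriv_thetaA {z : ℂ} (hz : thetaA k z ≠ 0) : logDeriv (thetaA k) z =
    logDeriv (theta (tau k)) (z - 1 / 2) + logDeriv (theta (tau k)) (z - tau k / 2) := by
  rw [thetaA] at hz
  unfold thetaA
  rw [logDeriv_mul z (left_ne_zero_of_mul hz) (right_ne_zero_of_mul hz) (by fun_prop)
    (by fun_prop)]
  simp only [sub_eq_add_neg, logDeriv_comp_add_const]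

lemma logDeriv_thetaB {z : ℂ} (hz : thetaB k z ≠ 0) : logDeriv (thetaB k) z =
    logDeriv (theta (tau k)) z + logDeriv (theta (tau k)) (z - (1 + tau k) / 2) := by
  rw [thetaB, thetaNum] at hz
  have hz' := right_ne_zero_of_mul hz
  unfold thetaB thetaNum
  rw [logDeriv_const_mul _ _ (left_ne_zero_of_mul hz), logDeriv_mul z (left_ne_zero_of_mul hz')
    (right_ne_zero_of_mul hz') (by fun_prop) (by fun_prop)]
  simp only [sub_eq_add_neg, logDeriv_comp_add_const]

lemma logDeriv_thetaA_branchPoint :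
    logDeriv (thetaA k) ((1 - tau k) / 4) = 4 * Real.pi * I := by
  have hmem := quarter_notMem_periodLattice (τ := tau k)
  have hadd := logDeriv_theta_add_tau (τ := tau k) (z := (1 - tau k) / 4 - tau k / 2) fun h ↦
    hmem (by convert add_mem h (tau_mem_periodLattice (tau k)) using 1; ring)
  rw [show (1 - tau k) / 4 - tau k / 2 + tau k = (1 + tau k) / 4 by ring] at hadd
  rw [logDeriv_thetaA (lifts_branchPoint.thetaA_ne_zero one_ne_zero),
    show (1 - tau k) / 4 - 1 / 2 = -((1 + tau k) / 4) by ring, logDeriv_theta_neg hmem]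
  linear_combination -hadd

lemma thetaB_ne_zero_of_thetaA {z : ℂ} (hz : thetaA k z = 0) : thetaB k z ≠ 0 :=
  (thetaA_ne_zero_or_thetaB_ne_zero z).resolve_left (not_not.2 hz)

lemma logDeriv_thetaB_half : logDeriv (thetaB k) (1 / 2) = 3 * Real.pi * I := by
  rw [logDeriv_thetaB (thetaB_ne_zero_of_thetaA thetaA_half),
    show 1 / 2 - (1 + tau k) / 2 = -(tau k / 2) by ring,
    logDeriv_theta_neg half_tau_notMem_periodLattice, logDeriv_theta_half,
    logDeriv_theta_half_tau]
  ring

lemma logDeriv_thetaB_half_tau : logDeriv (thetaB k) (tau k / 2) = Real.pi * I := by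
  rw [logDeriv_thetaB (thetaB_ne_zero_of_thetaA thetaA_half_tau),
    show tau k / 2 - (1 + tau k) / 2 = -(1 / 2) by ring,
    logDeriv_theta_neg half_notMem_periodLattice, logDeriv_theta_half, logDeriv_theta_half_tau]
  ring

variable {a b e : ℂ} {ζ z : Fin 4 → ℂ}

lemma deriv_thetaA_of_thetaA {p ε : ℂ} (hA : thetaA k p = 0)
    (hC : thetaC k p = -(ε * (I * ellK k / 2)) * thetaB k p ^ 2) :
    deriv (thetaA k) p = 2 * ε * I * ellK k * thetaB k p := by
  rw [thetaC, wronskian, hA] at hC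
  refine mul_left_cancel₀ (thetaB_ne_zero_of_thetaA hA) ?_
  linear_combination -4 * hC

lemma deriv_thetaC_of_thetaA {p ε : ℂ} (hA : thetaA k p = 0) (hε : ε ^ 2 = 1)
    (hC : thetaC k p = -(ε * (I * ellK k / 2)) * thetaB k p ^ 2) :
    deriv (thetaC k) p = -(ε * I * ellK k) * (thetaB k p * deriv (thetaB k) p) := by
  have hK : (ellK k : ℂ) ≠ 0 := by exact_mod_cast (ellK_pos k).ne'
  have hε0 : ε ≠ 0 := by rintro rfl; norm_num at hε
  have h := thetaC_mul_deriv (k := k) p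
  rw [hA, hC, curvePartial, curvePartial] at h
  refine mul_left_cancel₀ (mul_ne_zero (mul_ne_zero (mul_ne_zero hε0 I_ne_zero) hK)
    (pow_ne_zero 2 (thetaB_ne_zero_of_thetaA hA))) ?_
  linear_combination -h + (ellK k : ℂ) ^ 2 * thetaB k p ^ 3 * deriv (thetaB k) p *
    (ε ^ 2 * I_sq - hε)

/-- `ε = ±1` selects one of the two points over `ζ = ∞`, at which `η / ζ² = -ε i K / 2`. -/
lemma logDeriv_incidence_of_thetaA {p ε : ℂ} (hA : thetaA k p = 0) (hε : ε ^ 2 = 1)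
    (hC : thetaC k p = -(ε * (I * ellK k / 2)) * thetaB k p ^ 2)
    (h0 : incidence k a b e p ≠ 0) :
    logDeriv (incidence k a b e) p =
      2 * logDeriv (thetaB k) p + 4 * ε * I * ellK k * b / (2 * e - ε * I * ellK k) := by
  have hB := thetaB_ne_zero_of_thetaA hA
  have hval : incidence k a b e p = (2 * e - ε * I * ellK k) * thetaB k p ^ 2 / 2 := by
    rw [incidence, sectionForm, hA, hC]; ring
  have hne : 2 * e - ε * I * ellK k ≠ 0 := fun h ↦ h0 (by rw [hval, h]; ring)
  have hder : deriv (incidence k a b e) p = (2 * e - ε * I * ellK k) *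
      (thetaB k p * deriv (thetaB k) p) + 2 * ε * I * ellK k * b * thetaB k p ^ 2 := by
    rw [deriv_incidence, deriv_thetaC_of_thetaA hA hε hC, deriv_thetaA_of_thetaA hA hC, hA]
    ring
  rw [logDeriv_apply, logDeriv_apply, hder, hval]
  field_simp
  ring

lemma incidence_ne_zero_of_thetaA (h : IsFactored k a b e ζ)
    (he : e ^ 2 + (ellK k : ℂ) ^ 2 / 4 ≠ 0) {p : ℂ} (hA : thetaA k p = 0) :
    incidence k a b e p ≠ 0 := fun h0 ↦
  have ⟨_, hi⟩ := exists_thetaFiber_eq_zero h he h0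
  thetaA_ne_zero_of_thetaFiber hi hA

lemma logDeriv_theta_sub_add {z : ℂ} (hz : thetaA k z ≠ 0) :
    logDeriv (theta (tau k)) (1 / 2 - z) + logDeriv (theta (tau k)) (tau k / 2 - z) =
      4 * Real.pi * I - logDeriv (thetaA k) z := by
  rw [logDeriv_thetaA hz, ← neg_sub z (1 / 2), ← neg_sub z (tau k / 2),
    logDeriv_theta_neg (theta_eq_zero_iff.not.1 (left_ne_zero_of_mul hz)),
    logDeriv_theta_neg (theta_eq_zero_iff.not.1 (right_ne_zero_of_mul hz))]
  ring

lemma logDeriv_incidence_add (h : IsFactored k a b e ζ) (he : e ^ 2 + (ellK k : ℂ) ^ 2 / 4 ≠ 0)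
    (hz : ∀ i, thetaA k (z i) ≠ 0) {n : ℤ} {c : ℂ}
    (hc : ∀ w, incidence k a b e w = c * expTwoPi (n * w) * thetaProd (tau k) z w) :
    logDeriv (incidence k a b e) (1 / 2) + logDeriv (incidence k a b e) (tau k / 2) =
      4 * Real.pi * I * n + 16 * Real.pi * I - ∑ i, logDeriv (thetaA k) (z i) := by
  rw [logDeriv_incidence hc (incidence_ne_zero_of_thetaA h he thetaA_half),
    logDeriv_incidence hc (incidence_ne_zero_of_thetaA h he thetaA_half_tau),
    add_add_add_comm, ← Finset.sum_add_distrib,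
    Finset.sum_congr rfl fun i _ ↦ logDeriv_theta_sub_add (hz i), Finset.sum_sub_distrib,
    Fin.sum_const, nsmul_eq_mul]
  push_cast
  ring

lemma div_sub_div_eq {K : ℂ} (he : e ^ 2 + K ^ 2 / 4 ≠ 0) :
    4 * I * K * b / (2 * e - I * K) - 4 * I * K * b / (2 * e + I * K) =
      -(2 * K ^ 2 * b / (e ^ 2 + K ^ 2 / 4)) := by
  have hmul : e ^ 2 + K ^ 2 / 4 = (2 * e - I * K) * (2 * e + I * K) / 4 := by
    linear_combination K ^ 2 / 4 * I_sq
  rw [hmul] at he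
  have hne := left_ne_zero_of_mul (div_ne_zero_iff.1 he).1
  have hne' := right_ne_zero_of_mul (div_ne_zero_iff.1 he).1
  rw [hmul, div_sub_div _ _ hne hne', div_div_eq_mul_div, ← neg_div]
  congr 1
  linear_combination 8 * K ^ 2 * b * I_sq

lemma logDeriv_incidence_add_eq (h : IsFactored k a b e ζ)
    (he : e ^ 2 + (ellK k : ℂ) ^ 2 / 4 ≠ 0) :
    logDeriv (incidence k a b e) (1 / 2) + logDeriv (incidence k a b e) (tau k / 2) =
      8 * Real.pi * I - 2 * (ellK k : ℂ) ^ 2 * b / (e ^ 2 + (ellK k : ℂ) ^ 2 / 4) := by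
  rw [logDeriv_incidence_of_thetaA (ε := 1) thetaA_half (one_pow 2)
      (by rw [thetaC_half, one_mul]) (incidence_ne_zero_of_thetaA h he thetaA_half),
    logDeriv_incidence_of_thetaA (ε := -1) thetaA_half_tau (by ring)
      (by rw [thetaC_half_tau, neg_one_mul, neg_neg])
      (incidence_ne_zero_of_thetaA h he thetaA_half_tau),
    logDeriv_thetaB_half, logDeriv_thetaB_half_tau]
  linear_combination div_sub_div_eq (b := b) he

theorem exists_sum_eq_and_sum_logDeriv_eq (h : IsFactored k a b e ζ)
    (he : e ^ 2 + (ellK k : ℂ) ^ 2 / 4 ≠ 0)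
    (hz : ∀ i, Lifts k (z i) 1 (ζ i) (sectionForm a b e 1 (ζ i))) :
    ∃ n m : ℤ, ∑ i, z i = (1 - n) * tau k - m ∧
      ∑ i, logDeriv (thetaA k) (z i) = 4 * Real.pi * I * n + 8 * Real.pi * I +
        2 * (ellK k : ℂ) ^ 2 * b / (e ^ 2 + (ellK k : ℂ) ^ 2 / 4) := by
  obtain ⟨n, m, c, hsum, hc⟩ := exists_incidence_eq h he hz
  refine ⟨n, m, hsum, ?_⟩
  have hlog := logDeriv_incidence_add h he (fun i ↦ (hz i).thetaA_ne_zero one_ne_zero) hc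
  rw [logDeriv_incidence_add_eq h he] at hlog
  linear_combination hlog

end

/-! ### Contours to the Atiyah–Ward points -/

section

variable {k x₁ x₂ x₃ : ℝ} {ζ : Fin 4 → ℂ}

lemma miniTwistor_eq_sectionForm (x₁ x₂ x₃ : ℝ) (ζ : ℂ) :
    miniTwistor x₁ x₂ x₃ ζ = sectionForm (x₂ - I * x₁) (2 * x₃) (x₂ + I * x₁) 1 ζ := by
  rw [miniTwistor, sectionForm]; ring

lemma isFactored_of_roots
    (h : (atiyahWard k x₁ x₂ x₃).roots = (Finset.univ : Finset (Fin 4)).val.map ζ) :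
    IsFactored k (x₂ - I * x₁) (2 * x₃) (x₂ + I * x₁) ζ := by
  set ℓ := (atiyahWard k x₁ x₂ x₃).leadingCoeff
  have hprod (x : ℂ) : sectionForm (x₂ - I * x₁) (2 * x₃) (x₂ + I * x₁) 1 x ^ 2 +
      curveForm k 1 x = ℓ * ∏ i, (x - ζ i) := by
    have heval := congrArg (Polynomial.eval x)
      (IsAlgClosed.splits (atiyahWard k x₁ x₂ x₃)).eq_prod_roots
    rw [h, Multiset.map_map, eval_mul, eval_C, eval_multiset_prod, Multiset.map_map] at heval
    simp only [Function.comp_def, eval_sub, eval_X, eval_C] at heval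
    refine Eq.trans ?_ heval
    simp [atiyahWard, sectionForm, curveForm, modDiff]
  -- the fourth difference extracts the coefficient of `x ^ 4`
  have hℓ : ℓ = ((x₂ + I * x₁ : ℂ)) ^ 2 + (ellK k : ℂ) ^ 2 / 4 := by
    have h₀ := hprod 0
    have h₁ := hprod 1
    have h₂ := hprod (-1)
    have h₃ := hprod 2
    have h₄ := hprod (-2)
    simp only [sectionForm, curveForm, Fin.prod_univ_four] at h₀ h₁ h₂ h₃ h₄
    linear_combination -(h₃ + h₄ - 4 * h₁ - 4 * h₂ + 6 * h₀) / 24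
  intro x
  rw [hprod x, hℓ]

lemma sq_add_ellK_sq_div_four (k x₁ x₂ : ℝ) : ((x₂ : ℂ) + I * x₁) ^ 2 + (ellK k : ℂ) ^ 2 / 4 =
    ((ellK k : ℂ) ^ 2 - 4 * ((x₁ : ℂ) - I * x₂) ^ 2) / 4 := by
  linear_combination (x₁ ^ 2 + x₂ ^ 2 : ℂ) * I_sq

lemma CurvePath.lifts_of_isAt {c : CurvePath k} {s : ℝ} {ζ η w : ℂ} (h : c.IsAt s ζ η) :
    Lifts k w (c.Z₀ s) (c.Z₁ s) (c.W s) ↔ Lifts k w 1 ζ η := by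
  obtain ⟨hX, hY, hW⟩ := h
  rw [hY, hW]
  exact ⟨fun h ↦ h.of_smul hX, fun h ↦ h.smul _⟩

lemma sum_mu (x₁ x₂ x₃ : ℝ) (N : ℤ) (ζ : Fin 4 → ℂ) (c : Fin 4 → CurvePath k) :
    ∑ i, mu x₁ x₂ x₃ N (ζ i) (c i) = ∑ i, (c i).intGamma + I * Real.pi +
      4 * (I * Real.pi * N) - I * (((x₁ : ℂ) - I * x₂) * ∑ i, ζ i - 4 * I * x₃) := by
  simp only [mu, betaOne, Fin.sum_univ_four]
  ring

lemma sum_mu_of_sum_intGamma (hx : (ellK k : ℂ) ^ 2 - 4 * ((x₁ : ℂ) - I * x₂) ^ 2 ≠ 0)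
    (h : IsFactored k (x₂ - I * x₁) (2 * x₃) (x₂ + I * x₁) ζ) {N : ℤ} {c : Fin 4 → CurvePath k}
    (hγ : ∑ i, (c i).intGamma = 4 * (ellK k : ℂ) ^ 2 * x₃ /
      ((ellK k : ℂ) ^ 2 - 4 * ((x₁ : ℂ) - I * x₂) ^ 2) - I * Real.pi * (N + 1)) :
    ∑ i, mu x₁ x₂ x₃ N (ζ i) (c i) = 3 * I * Real.pi * N := by
  have hζ : ∑ i, ζ i = -16 * x₃ * (x₂ + I * x₁) /
      ((ellK k : ℂ) ^ 2 - 4 * ((x₁ : ℂ) - I * x₂) ^ 2) := by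
    rw [eq_div_iff hx]
    have hvieta := h.sum_eq
    rw [sq_add_ellK_sq_div_four] at hvieta
    linear_combination 4 * hvieta
  rw [sum_mu, hγ, hζ]
  field_simp
  linear_combination (4 * (ellK k : ℂ) ^ 2 * x₃ + 16 * x₃ * I * x₁ * x₂ -
    16 * x₃ * I ^ 2 * x₂ ^ 2) * I_sq

variable [Fact (|k| < 1)] [NeZero k]

lemma CurvePath.lifts_half_add_intV {δ : CurvePath k} {ζ η : ℂ} (h₀ : δ.IsAtInftyOne 0)
    (h₁ : δ.IsAt 1 ζ η) : Lifts k (1 / 2 + δ.intV) 1 ζ η :=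
  (lifts_of_isAt h₁).1 (δ.lifts_intV h₀.lifts)

lemma CurvePath.intGamma_eq_of_correlated {δ c : CurvePath k} (hc : c.AvoidsInfty)
    (h₀ : c.IsAt 0 (compl k + I * |k|) 0) (h : δ.Correlated c) :
    c.intGamma = logDeriv (thetaA k) (1 / 2 + δ.intV) / 4 - Real.pi * I := by
  obtain ⟨m, hm⟩ := h
  rw [intGamma_eq hc ((lifts_of_isAt h₀).2 lifts_branchPoint), logDeriv_thetaA_branchPoint, hm,
    show 1 / 2 + (c.intV - (1 + tau k) / 4 + m) = (1 - tau k) / 4 + c.intV + m by ring,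
    logDeriv_thetaA_add_int]
  ring

lemma sum_intGamma_eq {δ c : Fin 4 → CurvePath k} (hc : ∀ i, (c i).AvoidsInfty)
    (h₀ : ∀ i, (c i).IsAt 0 (compl k + I * |k|) 0) (hcor : ∀ i, (δ i).Correlated (c i)) {n : ℤ}
    (hlog : ∑ i, logDeriv (thetaA k) (1 / 2 + (δ i).intV) = 4 * Real.pi * I * n +
      8 * Real.pi * I + 2 * (ellK k : ℂ) ^ 2 * (2 * x₃) /
        (((x₂ : ℂ) + I * x₁) ^ 2 + (ellK k : ℂ) ^ 2 / 4)) :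
    ∑ i, (c i).intGamma = 4 * (ellK k : ℂ) ^ 2 * x₃ /
      ((ellK k : ℂ) ^ 2 - 4 * ((x₁ : ℂ) - I * x₂) ^ 2) - I * Real.pi * ((1 - n : ℤ) + 1) := by
  rw [Finset.sum_congr rfl fun i _ ↦ CurvePath.intGamma_eq_of_correlated (hc i) (h₀ i) (hcor i),
    Finset.sum_sub_distrib, ← Finset.sum_div, hlog, sq_add_ellK_sq_div_four, div_div_eq_mul_div,
    Fin.sum_const, nsmul_eq_mul]
  push_cast
  ring

end

end TwoMonopole

end

open TwoMonopole in
theorem proposition4p1 (k : ℝ) (hk0 : 0 < k) (hk1 : k < 1) (x₁ x₂ x₃ : ℝ)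
    (hx : (TwoMonopole.ellK k : ℂ) ^ 2 - 4 * ((x₁ : ℂ) - Complex.I * x₂) ^ 2 ≠ 0)
    (ζ η : Fin 4 → ℂ)
    -- the four solutions of the Atiyah–Ward equation, with multiplicity
    (hζ : (TwoMonopole.atiyahWard k x₁ x₂ x₃).roots = (Finset.univ : Finset (Fin 4)).val.map ζ)
    (hη : ∀ i, η i = TwoMonopole.miniTwistor x₁ x₂ x₃ (ζ i))
    -- contours from `∞₁` to the four points
    (δ : Fin 4 → TwoMonopole.CurvePath k)
    (hδ0 : ∀ i, (δ i).IsAtInftyOne 0) (hδ1 : ∀ i, (δ i).IsAt 1 (ζ i) (η i)) :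
    ∃ N M : ℤ,
      ∑ i, (δ i).intV = N * TwoMonopole.tau k + M ∧
      -- contours from `P₀ = (k' + i k, 0)` to the four points
      ∀ c : Fin 4 → TwoMonopole.CurvePath k,
        (∀ i, (c i).AvoidsInfty) →
        (∀ i, (c i).IsAt 0 ((TwoMonopole.compl k : ℂ) + Complex.I * k) 0) →
        (∀ i, (c i).IsAt 1 (ζ i) (η i)) →
        (∀ i, (δ i).Correlated (c i)) →
          ∑ i, (c i).intGamma =
              4 * (TwoMonopole.ellK k : ℂ) ^ 2 * x₃ /
                ((TwoMonopole.ellK k : ℂ) ^ 2 - 4 * ((x₁ : ℂ) - Complex.I * x₂) ^ 2)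
              - Complex.I * Real.pi * (N + 1) ∧
          ∑ i, TwoMonopole.mu x₁ x₂ x₃ N (ζ i) (c i) = 3 * Complex.I * Real.pi * N := by
  have : Fact (|k| < 1) := ⟨by rwa [abs_of_pos hk0]⟩
  have : NeZero k := ⟨hk0.ne'⟩
  have hfac := isFactored_of_roots hζ
  have he : ((x₂ : ℂ) + I * x₁) ^ 2 + (ellK k : ℂ) ^ 2 / 4 ≠ 0 := by
    rw [sq_add_ellK_sq_div_four]
    exact div_ne_zero hx (by norm_num)
  have hz (i : Fin 4) : Lifts k (1 / 2 + (δ i).intV) 1 (ζ i)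
      (sectionForm (x₂ - I * x₁) (2 * x₃) (x₂ + I * x₁) 1 (ζ i)) := by
    rw [← miniTwistor_eq_sectionForm, ← hη]
    exact CurvePath.lifts_half_add_intV (hδ0 i) (hδ1 i)
  obtain ⟨n, m, hsum, hlog⟩ := exists_sum_eq_and_sum_logDeriv_eq hfac he hz
  refine ⟨1 - n, -m - 2, ?_, fun c hc hc0 _ hcor ↦ ?_⟩
  · rw [Finset.sum_add_distrib, Fin.sum_const, nsmul_eq_mul] at hsum
    push_cast at hsum ⊢
    linear_combination hsum
  have hγ := sum_intGamma_eq hc (by simpa only [abs_of_pos hk0] using hc0) hcor hlog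
  exact ⟨hγ, sum_mu_of_sum_intGamma hx hfac hγ⟩
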